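/- Let $m\ge 1$ and let $(\vec\beta_p)_{p\ge 2}$ be vectors in $\mathbb R^m$ with $\vec\beta_p=0$ for odd $p$ and $\sum_{p\ge2}2^p\vec\beta_p(j)^2<\infty$ for each $j$. For an $m\times m$ matrix $A$ with entries in $[-1,1]$ put $\xi(A)=\sum_{p\ge 2}(\vec\beta_p\otimes\vec\beta_p)\odot A^{\circ p}$, where $\odot$ and $^{\circ p}$ are the entrywise product and power, and let $\xi',\xi'',\xi'''$ be its entrywise derivatives. Let $\vec h\in\mathbb R^m$, let $Q$ be a positive semidefinite $m\times m$ matrix with unit diagonal, and let $\langle A,B\rangle=\sum_{i,j}A_{ij}B_{ij}$. Consider pairs $(x,\Phi)$ of the following kind. The function $x:[0,m]\to[0,1]$ is nondecreasing and right-continuous with $x(0)=0$ and $x(m)=1$; let $\mu$ be the probability measure on $[0,m]$ with $\mu([0,t])=x(t)$. The path $\Phi$ on $[0,m]$ takes positive semidefinite $m\times m$ matrices as values, is nondecreasing in the positive semidefinite order, is continuously differentiable with Lipschitz derivative, and satisfies $\Phi(0)=0$, $\Phi(m)=Q$ and $\mathrm{Trace}\,\Phi(t)=t$ for all $t\in\mathrm{supp}\,\mu$.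 With $t_x=\inf\{t\in[0,m]:x(t)=1\}$, one requires $t_x<m$ and $\det(Q-\Phi(t_x))>0$. For such a pair put $\hat\Phi(t)=\int_t^m x(s)\Phi'(s)\,ds$ and $$\mathscr C(x,\Phi)=\frac12\left[\int_0^m x(t)\big\langle \xi'(\Phi(t))+\vec h\vec h^T,\Phi'(t)\big\rangle dt+\log\det\big(\Phi(m)-\Phi(\hat T)\big)+\int_0^{\hat T}\big\langle\hat\Phi(t)^{-1},\Phi'(t)\big\rangle dt\right],$$ where $\hat T\in(t_x,m)$ is any point with $\det(\Phi(m)-\Phi(\hat T))>0$ (the value does not depend on it). Let $(x,\Phi)$ minimize $\mathscr C$ among all these pairs, and let $\mu_P$ be the measure with $\mu_P([0,t])=x(t)$. If $0\le a<b<m$ and $(a,b)\subseteq\mathrm{supp}\,\mu_P$, then for all $u\in(a,b)$ the trace below is positive and $$\mu_P([0,u])=\frac{\langle\xi'''(\Phi(u)),\Phi'(u)^{\circ3}\rangle}{2\,\mathrm{Trace}\left(\Big(\Phi'(u)^{1/2}\big(\xi''(\Phi(u))\odot\Phi'(u)\big)\Phi'(u)^{1/2}\Big)^{3/2}\right)}.$$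 -/

import Mathlib

open MeasureTheory Set
open scoped Matrix

noncomputable section

namespace VectorSpin

variable {m : ℕ}

/-- Standing assumptions on the inverse temperatures `β p = (β_p(1), …, β_p(m))`, `p ≥ 2`, of a
mixed even `p`-spin model: only even `p ≥ 2` occur and `∑ 2^p β_p(j)^2 < ∞` for every copy `j`. -/
structure IsMixedEven (β : ℕ → Fin m → ℝ) : Prop where
  eq_zero_of_lt : ∀ p, p < 2 → β p = 0
  eq_zero_of_odd : ∀ p, Odd p → β p = 0
  summable : ∀ j, Summable fun p => (2 : ℝ) ^ p * β p j ^ 2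

/-- The `r`-th derivative of `ξ(A) = ∑_p (β_p ⊗ β_p) ⊙ A^{∘p}`, taken entry by entry:
`∑_p p (p-1) ⋯ (p-r+1) (β_p ⊗ β_p) ⊙ A^{∘(p-r)}`.
The coefficient `p.descFactorial r` vanishes for `p < r`. -/
def xiDeriv (β : ℕ → Fin m → ℝ) (r : ℕ) (A : Matrix (Fin m) (Fin m) ℝ) :
    Matrix (Fin m) (Fin m) ℝ :=
  Matrix.of fun i j => ∑' p : ℕ, (p.descFactorial r : ℝ) * (β p i * β p j) * A i j ^ (p - r)

/-- The Frobenius inner product of two matrices. -/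
def frob (A B : Matrix (Fin m) (Fin m) ℝ) : ℝ := ∑ i, ∑ j, A i j * B i j

/-- The constraints `Q`: positive semidefinite matrices with entries in `[-1,1]` and unit
diagonal. -/
structure IsConstraint (Q : Matrix (Fin m) (Fin m) ℝ) : Prop where
  posSemidef : Q.PosSemidef
  entries : ∀ i j, Q i j ∈ Icc (-1 : ℝ) 1
  diag : ∀ i, Q i i = 1

/-- The distribution function `x(t) = μ([0,t])`. -/
def orderParam (μ : Measure ℝ) (t : ℝ) : ℝ := μ.real (Icc 0 t)

/-- The measure `μ` on `[0,m]` belongs to a nondecreasing right-continuous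
`x : [0,m] → [0,1]` with `x(0) = 0` and `x(m) = 1` through `x(t) = μ([0,t])`. -/
structure IsOrderMeasure (m : ℕ) (μ : Measure ℝ) : Prop where
  isProbabilityMeasure : IsProbabilityMeasure μ
  compl_eq_zero : μ (Icc (0 : ℝ) m)ᶜ = 0
  orderParam_zero : orderParam μ 0 = 0

/-- `t_x = inf {t ∈ [0,m] | x(t) = 1}`. -/
def topPoint (m : ℕ) (μ : Measure ℝ) : ℝ := sInf {t | t ∈ Icc (0 : ℝ) m ∧ orderParam μ t = 1}

/-- The derivative `Φ'(t)` of a matrix path on `[0,m]`, taken entry by entry (one-sided at the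
endpoints). -/
def pathDeriv (Φ : ℝ → Matrix (Fin m) (Fin m) ℝ) (t : ℝ) : Matrix (Fin m) (Fin m) ℝ :=
  Matrix.of fun i j => derivWithin (fun s => Φ s i j) (Icc (0 : ℝ) m) t

/-- The matrix paths: continuously differentiable monotone paths of positive semidefinite
matrices from `0` to `Q` on `[0,m]` with Lipschitz derivative (hence Lipschitz themselves), and with
`Trace Φ(t) = t` for every `t` in the support of `μ`. -/
structure IsPath (Q : Matrix (Fin m) (Fin m) ℝ) (μ : Measure ℝ)
    (Φ : ℝ → Matrix (Fin m) (Fin m) ℝ) : Prop where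
  posSemidef : ∀ t ∈ Icc (0 : ℝ) m, (Φ t).PosSemidef
  monotone : ∀ s ∈ Icc (0 : ℝ) m, ∀ t ∈ Icc (0 : ℝ) m, s ≤ t → (Φ t - Φ s).PosSemidef
  zero : Φ 0 = 0
  top : Φ m = Q
  differentiable : ∀ i j, DifferentiableOn ℝ (fun t => Φ t i j) (Icc (0 : ℝ) m)
  lipschitz_deriv : ∃ K, ∀ i j, LipschitzOnWith K (fun t => pathDeriv Φ t i j) (Icc (0 : ℝ) m)
  trace_eq : ∀ t ∈ μ.support, (Φ t).trace = t

/-- `Φ̂(t) = ∫_t^m x(s) Φ'(s) ds`. -/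
def hatPath (μ : Measure ℝ) (Φ : ℝ → Matrix (Fin m) (Fin m) ℝ) (t : ℝ) :
    Matrix (Fin m) (Fin m) ℝ :=
  Matrix.of fun i j => ∫ s in t..(m : ℝ), orderParam μ s * pathDeriv Φ s i j

/-- The Crisanti–Sommers functional `𝒞(x,Φ)`, written with the cut-off point `T`. -/
def csFunctional (β : ℕ → Fin m → ℝ) (h : Fin m → ℝ) (μ : Measure ℝ)
    (Φ : ℝ → Matrix (Fin m) (Fin m) ℝ) (T : ℝ) : ℝ :=
  (1 / 2) *
    ((∫ t in (0 : ℝ)..(m : ℝ),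
        orderParam μ t * frob (xiDeriv β 1 (Φ t) + Matrix.vecMulVec h h) (pathDeriv Φ t))
      + Real.log (Φ m - Φ T).det
      + ∫ t in (0 : ℝ)..T, frob (hatPath μ Φ t)⁻¹ (pathDeriv Φ t))

/-- The pairs `(x,Φ)` over which the functional is minimized. -/
structure IsAdmissible (Q : Matrix (Fin m) (Fin m) ℝ) (μ : Measure ℝ)
    (Φ : ℝ → Matrix (Fin m) (Fin m) ℝ) : Prop where
  isOrderMeasure : IsOrderMeasure m μ
  isPath : IsPath Q μ Φ
  topPoint_lt : topPoint m μ < m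
  det_pos : 0 < (Q - Φ (topPoint m μ)).det

/-- The cut-off points: those `T` with `t_x < T < m` for which `Φ(m) - Φ(T)` is nonsingular, so that
the logarithm in the functional is finite. The value of the functional is the same for all of
them. -/
def cutoffs (μ : Measure ℝ) (Φ : ℝ → Matrix (Fin m) (Fin m) ℝ) : Set ℝ :=
  {T | topPoint m μ < T ∧ T < m ∧ 0 < (Φ m - Φ T).det}

/-- `(x,Φ)`, with `x(t) = μ([0,t])`, is a minimizer of the Crisanti–Sommers functional. -/
def IsMinimizer (β : ℕ → Fin m → ℝ) (h : Fin m → ℝ) (Q : Matrix (Fin m) (Fin m) ℝ)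
    (μ : Measure ℝ) (Φ : ℝ → Matrix (Fin m) (Fin m) ℝ) : Prop :=
  IsAdmissible Q μ Φ ∧
    ∀ (ν : Measure ℝ) (Ψ : ℝ → Matrix (Fin m) (Fin m) ℝ), IsAdmissible Q ν Ψ →
      ∀ T ∈ cutoffs μ Φ, ∀ S ∈ cutoffs ν Ψ,
        csFunctional β h μ Φ T ≤ csFunctional β h ν Ψ S

/-- The power `A^r` of a positive semidefinite matrix, by functional calculus. -/
def psdPow (A : Matrix (Fin m) (Fin m) ℝ) (r : ℝ) : Matrix (Fin m) (Fin m) ℝ :=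
  cfc (fun y : ℝ => y ^ r) A

/-- `(D^{1/2} (ξ''(A) ⊙ D) D^{1/2})^{3/2}`. -/
def threeHalves (β : ℕ → Fin m → ℝ) (A D : Matrix (Fin m) (Fin m) ℝ) :
    Matrix (Fin m) (Fin m) ℝ :=
  psdPow (psdPow D (1 / 2) * (xiDeriv β 2 A ⊙ D) * psdPow D (1 / 2)) (3 / 2)

end VectorSpin

end

/-! Write x(t) = μ([0,t]), D = Φ', R = Φ̂ and P = R⁻¹, and let T be a cut-off point. Minimality
yields an Euler–Lagrange equation on supp μ, and differentiating it twice on (a,b) gives the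
formula.

Stationarity. The functional is invariant under reparametrization of time, so the trace condition
only fixes the clock: a convex combination of Φ with any monotone path becomes admissible after a
time change that also pushes μ forward (`IsMinimizer.eventually_le_mixPath`). Integration by parts
against x brings twice the first variation into the form -∫⟨G, Φ₁ - Φ⟩ dμ with G(t) = ξ'(Φ(t)) + hhᵀ
- ∫_0^t PDP (`tendsto_slope_csFunctional`). Hence ∫⟨G, Φ₁ - Φ⟩ dμ ≤ 0 for all competitors Φ₁. Since
μ lives on (0,T), mollification extends this to paths that jump at 0 and at T, in particular to Φ +
εRGR + ε²Ct·1 for small ε > 0. This path is monotone: its right derivative is (1-ε)D + εR(ξ''(Φ)⊙D)R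
- εx(DGR + RGD) + ε²C·1, where the ξ'' term is positive semidefinite by the Schur product theorem
and the cross terms are absorbed by D and ε²C after completing a square (`quad_step_nonneg`).
Letting ε → 0 gives ∫⟨G, RGR⟩ dμ ≤ 0. The integrand is the squared norm of R^{1/2}GR^{1/2}, so G = 0
on supp μ (`IsMinimizer.gradPath_eq_zero`).

The formula. On (a,b), G' = 0 reads ξ''(Φ)⊙D = PDP. As D is only Lipschitz, the second
differentiation is done in weak form. Put W(t) = P(t)D(u)P(t) - ξ''(Φ(t))⊙D(u). Both terms are
self-adjoint operations applied to D(u), so ⟨D(t), W(t)⟩ = 0, and W(u) = 0. Dividing ⟨D(t), W(t) -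
W(u)⟩ by t - u and letting t decrease to u gives ⟨D(u), W'(u)⟩ = 0, which by P' = xPDP is ⟨ξ''',
D^{∘3}⟩ = 2x(u) Trace(PDPDPD). Finally D^{1/2}(PDP)D^{1/2} is the square of D^{1/2}PD^{1/2}, so its
3/2 power has trace Trace(PDPDPD), which is positive because Trace D = 1 forces D ≠ 0. -/

namespace VectorSpin

variable {m : ℕ}

/-! ### The power series of ξ and its derivatives. -/

section Covariance

variable {β : ℕ → Fin m → ℝ}

/-- The scalar power series in the entry `(i, j)` of `xiDeriv β r`. -/
noncomputable def xiEntry (β : ℕ → Fin m → ℝ) (r : ℕ) (i j : Fin m) (y : ℝ) : ℝ :=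
  ∑' p : ℕ, (p.descFactorial r : ℝ) * (β p i * β p j) * y ^ (p - r)

theorem xiDeriv_apply (r : ℕ) (A : Matrix (Fin m) (Fin m) ℝ) (i j : Fin m) :
    xiDeriv β r A i j = xiEntry β r i j (A i j) := rfl

theorem xiEntry_comm (r : ℕ) (i j : Fin m) (y : ℝ) : xiEntry β r i j y = xiEntry β r j i y := by
  simp only [xiEntry, mul_comm (β _ i)]

/-- On the ball of radius 3/2 the weight p^r (3/2)^p equals p^r (3/4)^p · 2^p, and p^r (3/4)^p is
bounded. A radius above 1 leaves room around the entries in [-1,1], both for termwise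
differentiation and for slightly perturbed paths. -/
theorem IsMixedEven.exists_summable_bound (hβ : IsMixedEven β) (r : ℕ) (i j : Fin m) :
    ∃ w : ℕ → ℝ, Summable w ∧ ∀ p, ∀ y ∈ Metric.ball (0 : ℝ) (3 / 2),
      ‖(p.descFactorial r : ℝ) * (β p i * β p j) * y ^ (p - r)‖ ≤ w p := by
  have hs : Summable fun p => (2 : ℝ) ^ p * |β p i * β p j| := by
    refine Summable.of_nonneg_of_le (fun p => by positivity) (fun p => ?_)
      ((hβ.summable i).add (hβ.summable j))
    rw [← mul_add]
    refine mul_le_mul_of_nonneg_left ?_ (by positivity)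
    rw [abs_mul]
    nlinarith [sq_nonneg (|β p i| - |β p j|), sq_abs (β p i), sq_abs (β p j),
      abs_nonneg (β p i), abs_nonneg (β p j)]
  have hlim : Filter.Tendsto (fun p : ℕ => (p : ℝ) ^ r * (3 / 4 : ℝ) ^ p) Filter.atTop (nhds 0) :=
    tendsto_pow_const_mul_const_pow_of_abs_lt_one r (by rw [abs_of_pos] <;> norm_num)
  obtain ⟨B, hB⟩ := hlim.bddAbove_range
  refine ⟨fun p => B * ((2 : ℝ) ^ p * |β p i * β p j|), hs.mul_left B, fun p y hy => ?_⟩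
  have hy' : |y| ≤ 3 / 2 := by
    have := Metric.mem_ball.1 hy
    rw [Real.dist_eq, sub_zero] at this
    exact this.le
  have hBp : (p : ℝ) ^ r * (3 / 4 : ℝ) ^ p ≤ B := hB ⟨p, rfl⟩
  have h1 : |y| ^ (p - r) ≤ (3 / 2 : ℝ) ^ p :=
    (pow_le_pow_left₀ (abs_nonneg y) hy' _).trans
      (pow_le_pow_right₀ (by norm_num) (Nat.sub_le p r))
  have h2 : (p.descFactorial r : ℝ) ≤ (p : ℝ) ^ r := by exact_mod_cast Nat.descFactorial_le_pow p r
  rw [norm_mul, norm_mul, norm_pow, Real.norm_eq_abs, Real.norm_eq_abs, Real.norm_eq_abs,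
    Nat.abs_cast]
  calc (p.descFactorial r : ℝ) * |β p i * β p j| * |y| ^ (p - r)
      ≤ (p : ℝ) ^ r * |β p i * β p j| * (3 / 2 : ℝ) ^ p := by gcongr
    _ = ((p : ℝ) ^ r * (3 / 4 : ℝ) ^ p) * ((2 : ℝ) ^ p * |β p i * β p j|) := by
        rw [show (3 / 2 : ℝ) = 3 / 4 * 2 by norm_num, mul_pow]; ring
    _ ≤ B * ((2 : ℝ) ^ p * |β p i * β p j|) := by gcongr

theorem IsMixedEven.summable_xiEntry (hβ : IsMixedEven β) (r : ℕ) (i j : Fin m) {y : ℝ}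
    (hy : |y| < 3 / 2) :
    Summable fun p : ℕ => (p.descFactorial r : ℝ) * (β p i * β p j) * y ^ (p - r) := by
  obtain ⟨w, hw, hb⟩ := hβ.exists_summable_bound r i j
  exact Summable.of_norm_bounded hw fun p => hb p y (by simpa using hy)

theorem IsMixedEven.hasDerivAt_xiEntry (hβ : IsMixedEven β) (r : ℕ) (i j : Fin m) {y : ℝ}
    (hy : |y| < 3 / 2) : HasDerivAt (xiEntry β r i j) (xiEntry β (r + 1) i j y) y := by
  obtain ⟨w, hw, hb⟩ := hβ.exists_summable_bound (r + 1) i j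
  refine hasDerivAt_tsum_of_isPreconnected hw Metric.isOpen_ball
    (convex_ball (0 : ℝ) (3 / 2)).isPreconnected (fun p z _ => ?_) (fun p z hz => hb p z hz)
    (y₀ := 0) (by simp) (hβ.summable_xiEntry r i j (by norm_num)) (by simpa using hy)
  have := (hasDerivAt_pow (p - r) z).const_mul ((p.descFactorial r : ℝ) * (β p i * β p j))
  refine this.congr_deriv ?_
  rw [Nat.descFactorial_succ, Nat.cast_mul, Nat.sub_sub]
  ring

theorem IsMixedEven.xiEntry_one_zero (hβ : IsMixedEven β) (i j : Fin m) :
    xiEntry β 1 i j 0 = 0 := by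
  refine (tsum_congr fun p => ?_).trans tsum_zero
  rcases lt_or_ge p 2 with hp | hp
  · simp [hβ.eq_zero_of_lt p hp]
  · rw [zero_pow (by omega), mul_zero]

end Covariance

/-! ### Real quadratic forms and Schur products. -/

section Forms

theorem dotProduct_mulVec_eq_sum (A : Matrix (Fin m) (Fin m) ℝ) (v w : Fin m → ℝ) :
    v ⬝ᵥ A *ᵥ w = ∑ i, ∑ j, v i * w j * A i j := by
  simp only [dotProduct, Matrix.mulVec, Finset.mul_sum]
  exact Finset.sum_congr rfl fun i _ => Finset.sum_congr rfl fun j _ => by ring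

theorem posSemidef_iff_real {A : Matrix (Fin m) (Fin m) ℝ} :
    A.PosSemidef ↔ A.IsHermitian ∧ ∀ v : Fin m → ℝ, 0 ≤ v ⬝ᵥ A *ᵥ v := by
  rw [Matrix.posSemidef_iff_dotProduct_mulVec]
  simp

theorem quad_nonneg {A : Matrix (Fin m) (Fin m) ℝ} (hA : A.PosSemidef) (v : Fin m → ℝ) :
    0 ≤ v ⬝ᵥ A *ᵥ v := (posSemidef_iff_real.1 hA).2 v

theorem transpose_eq {A : Matrix (Fin m) (Fin m) ℝ} (hA : A.IsHermitian) : Aᵀ = A := by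
  rw [← Matrix.conjTranspose_eq_transpose_of_trivial]; exact hA

theorem isHermitian_of_symm {A : Matrix (Fin m) (Fin m) ℝ} (hA : ∀ i j, A i j = A j i) :
    A.IsHermitian := by
  ext i j; simp [hA i j]

theorem symm_apply {A : Matrix (Fin m) (Fin m) ℝ} (hA : A.IsHermitian) (i j : Fin m) :
    A i j = A j i := by
  conv_lhs => rw [← transpose_eq hA]
  rfl

theorem posSemidef_map_pow {A : Matrix (Fin m) (Fin m) ℝ} (hA : A.PosSemidef) (k : ℕ) :
    (A.map fun y => y ^ k).PosSemidef := by
  induction k with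
  | zero =>
    have := Matrix.posSemidef_vecMulVec_self_star (R := ℝ) (fun _ : Fin m => 1)
    convert! this using 1
    ext i j; simp [Matrix.vecMulVec_apply]
  | succ k ih =>
    convert! ih.hadamard hA using 1

/-- The form at e_i ± e_j is nonnegative, which bounds ∓A i j by the mean of two diagonal entries.
-/
theorem abs_apply_le_of_diag_le {A : Matrix (Fin m) (Fin m) ℝ} (hA : A.PosSemidef)
    (hd : ∀ i, A i i ≤ 1) (i j : Fin m) : A i j ∈ Icc (-1 : ℝ) 1 := by
  have hs := symm_apply hA.isHermitian j i
  rcases eq_or_ne i j with rfl | hij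
  · exact ⟨by linarith [hA.diag_nonneg (i := i)], hd i⟩
  have key : ∀ c : ℝ, 0 ≤ A i i + 2 * c * A i j + c ^ 2 * A j j := by
    intro c
    have := quad_nonneg hA (Pi.single i 1 + c • Pi.single j 1)
    simp only [Matrix.mulVec_add, Matrix.mulVec_smul, add_dotProduct, dotProduct_add,
      smul_dotProduct, dotProduct_smul, Matrix.mulVec_single_one, single_one_dotProduct,
      Matrix.col_apply, smul_eq_mul] at this
    rw [hs] at this
    linarith
  have h1 := key 1
  have h2 := key (-1)
  constructor <;> nlinarith [hd i, hd j]

/-- Each summand is a Schur power of A conjugated by diag(β_p), with a nonnegative coefficient;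
positivity passes to the sum of the quadratic forms. -/
theorem IsMixedEven.posSemidef_xiDeriv {β : ℕ → Fin m → ℝ} (hβ : IsMixedEven β) (r : ℕ)
    {A : Matrix (Fin m) (Fin m) ℝ} (hA : A.PosSemidef) (hA' : ∀ i j, A i j ∈ Icc (-1 : ℝ) 1) :
    (xiDeriv β r A).PosSemidef := by
  have hlt : ∀ i j, |A i j| < 3 / 2 := fun i j => (abs_le.2 (hA' i j)).trans_lt (by norm_num)
  rw [posSemidef_iff_real]
  refine ⟨isHermitian_of_symm fun i j => ?_, fun v => ?_⟩
  · rw [xiDeriv_apply, xiDeriv_apply, xiEntry_comm, symm_apply hA.isHermitian]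
  · rw [dotProduct_mulVec_eq_sum]
    have hsum : HasSum (fun p : ℕ => ∑ i, ∑ j, v i * v j *
        ((p.descFactorial r : ℝ) * (β p i * β p j) * A i j ^ (p - r)))
        (∑ i, ∑ j, v i * v j * xiDeriv β r A i j) :=
      hasSum_sum fun i _ => hasSum_sum fun j _ =>
        ((hβ.summable_xiEntry r i j (hlt i j)).hasSum).mul_left _
    refine hsum.nonneg fun p => ?_
    have := quad_nonneg (posSemidef_map_pow hA (p - r)) (fun i => β p i * v i)
    rw [dotProduct_mulVec_eq_sum] at this
    have h2 := mul_nonneg (Nat.cast_nonneg (α := ℝ) (p.descFactorial r)) this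
    refine h2.trans_eq ?_
    rw [Finset.mul_sum]
    refine Finset.sum_congr rfl fun i _ => ?_
    rw [Finset.mul_sum]
    exact Finset.sum_congr rfl fun j _ => by simp only [Matrix.map_apply]; ring

end Forms

end VectorSpin

namespace VectorSpin

variable {m : ℕ}

/-! ### Frobenius pairing, square roots and definiteness. -/

section Frobenius

variable (A B C : Matrix (Fin m) (Fin m) ℝ) (c : ℝ)

theorem frob_eq_trace : frob A B = (Aᵀ * B).trace := by
  simp only [frob, Matrix.trace, Matrix.diag_apply, Matrix.mul_apply, Matrix.transpose_apply]
  exact Finset.sum_comm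

theorem frob_comm : frob A B = frob B A := by
  simp only [frob, mul_comm]

theorem frob_add_left : frob (A + B) C = frob A C + frob B C := by
  simp only [frob, Matrix.add_apply, add_mul, Finset.sum_add_distrib]

theorem frob_sub_left : frob (A - B) C = frob A C - frob B C := by
  simp only [frob, Matrix.sub_apply, sub_mul, Finset.sum_sub_distrib]

theorem frob_smul_left : frob (c • A) B = c * frob A B := by
  simp only [frob, Matrix.smul_apply, smul_eq_mul, Finset.mul_sum, mul_assoc]

theorem frob_add_right : frob A (B + C) = frob A B + frob A C := by
  rw [frob_comm, frob_add_left, frob_comm B, frob_comm C]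

theorem frob_sub_right : frob A (B - C) = frob A B - frob A C := by
  rw [frob_comm, frob_sub_left, frob_comm B, frob_comm C]

theorem frob_smul_right : frob A (c • B) = c * frob A B := by
  rw [frob_comm, frob_smul_left, frob_comm]

@[simp] theorem frob_zero_right : frob A 0 = 0 := by simp [frob]

@[simp] theorem frob_zero_left : frob 0 A = 0 := by simp [frob]

theorem frob_neg_right : frob A (-B) = -frob A B := by simp [frob]

theorem frob_hadamard_right : frob (A ⊙ B) C = frob (A ⊙ C) B := by
  simp only [frob, Matrix.hadamard_apply]
  exact Finset.sum_congr rfl fun i _ => Finset.sum_congr rfl fun j _ => by ring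

variable {A B C}

theorem frob_conj {P : Matrix (Fin m) (Fin m) ℝ} (hP : P.IsHermitian) :
    frob (P * A * P) B = frob A (P * B * P) := by
  rw [frob_eq_trace, frob_eq_trace, Matrix.transpose_mul, Matrix.transpose_mul, transpose_eq hP,
    ← mul_assoc, ← mul_assoc, mul_assoc P Aᵀ, mul_assoc P, Matrix.trace_mul_comm]
  simp only [mul_assoc]

theorem spectrum_nonneg_of_posSemidef {D : Matrix (Fin m) (Fin m) ℝ} (hD : D.PosSemidef) :
    ∀ y ∈ spectrum ℝ D, 0 ≤ y :=
  fun _ hy => (Matrix.posSemidef_iff_isHermitian_and_spectrum_nonneg.1 hD).2 hy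

theorem isHermitian_psdPow (D : Matrix (Fin m) (Fin m) ℝ) (r : ℝ) : (psdPow D r).IsHermitian :=
  cfc_predicate (p := IsSelfAdjoint) _ D

theorem psdPow_half_mul_self {D : Matrix (Fin m) (Fin m) ℝ} (hD : D.PosSemidef) :
    psdPow D (1 / 2) * psdPow D (1 / 2) = D := by
  have hc : ContinuousOn (fun y : ℝ => y ^ (1 / 2 : ℝ)) (spectrum ℝ D) :=
    continuousOn_id.rpow_const fun y _ => Or.inr (by norm_num)
  have hsa : IsSelfAdjoint D := hD.isHermitian
  rw [psdPow, ← cfc_mul _ _ D hc hc]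
  conv_rhs => rw [← cfc_id ℝ D]
  refine cfc_congr fun y hy => ?_
  have hy0 := spectrum_nonneg_of_posSemidef hD y hy
  simp only [id]
  rw [← Real.sqrt_eq_rpow, Real.mul_self_sqrt hy0]

theorem exists_transpose_mul_self {A : Matrix (Fin m) (Fin m) ℝ} (hA : A.PosSemidef) :
    ∃ B : Matrix (Fin m) (Fin m) ℝ, A = Bᵀ * B := by
  have hs : (psdPow A (1 / 2))ᵀ = psdPow A (1 / 2) := transpose_eq (isHermitian_psdPow A _)
  exact ⟨psdPow A (1 / 2), by rw [hs, psdPow_half_mul_self hA]⟩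

theorem trace_transpose_mul_self_nonneg (A : Matrix (Fin m) (Fin m) ℝ) :
    0 ≤ (Aᵀ * A).trace := by
  rw [← frob_eq_trace]
  exact Finset.sum_nonneg fun i _ => Finset.sum_nonneg fun j _ => mul_self_nonneg _

theorem eq_zero_of_trace_transpose_mul_self {A : Matrix (Fin m) (Fin m) ℝ}
    (h : (Aᵀ * A).trace = 0) : A = 0 := by
  rw [← Matrix.conjTranspose_eq_transpose_of_trivial] at h
  exact Matrix.trace_conjTranspose_mul_self_eq_zero_iff.1 h

theorem posDef_mul_inv {R : Matrix (Fin m) (Fin m) ℝ} (hR : R.PosDef) : R * R⁻¹ = 1 :=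
  Matrix.mul_nonsing_inv R ((Matrix.isUnit_iff_isUnit_det R).1 hR.isUnit)

theorem posDef_inv_mul {R : Matrix (Fin m) (Fin m) ℝ} (hR : R.PosDef) : R⁻¹ * R = 1 :=
  Matrix.nonsing_inv_mul R ((Matrix.isUnit_iff_isUnit_det R).1 hR.isUnit)

theorem eq_zero_of_conj_eq_zero {R G : Matrix (Fin m) (Fin m) ℝ} (hR : R.PosDef)
    (h : R * G * R = 0) : G = 0 := by
  calc G = (R⁻¹ * R) * G * (R * R⁻¹) := by rw [posDef_inv_mul hR, posDef_mul_inv hR]; simp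
    _ = R⁻¹ * (R * G * R) * R⁻¹ := by simp only [mul_assoc]
    _ = 0 := by rw [h]; simp

/-- Cyclicity of the trace. The right side is a squared Frobenius norm, which gives both the sign of
⟨G, RGR⟩ and, for definite R, the case of equality. -/
theorem frob_conj_self_eq {R G C : Matrix (Fin m) (Fin m) ℝ} (hC : R = Cᵀ * C)
    (hG : G.IsHermitian) :
    frob G (R * G * R) = ((C * G * Cᵀ)ᵀ * (C * G * Cᵀ)).trace := by
  rw [frob_eq_trace, hC]
  simp only [Matrix.transpose_mul, Matrix.transpose_transpose, transpose_eq hG]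
  rw [← mul_assoc, ← mul_assoc, Matrix.trace_mul_comm]
  simp only [mul_assoc]

theorem frob_conj_self_nonneg {R G : Matrix (Fin m) (Fin m) ℝ} (hR : R.PosSemidef)
    (hG : G.IsHermitian) : 0 ≤ frob G (R * G * R) := by
  obtain ⟨C, hC⟩ := exists_transpose_mul_self hR
  rw [frob_conj_self_eq hC hG]
  exact trace_transpose_mul_self_nonneg _

theorem eq_zero_of_frob_conj_self {R G : Matrix (Fin m) (Fin m) ℝ} (hR : R.PosDef)
    (hG : G.IsHermitian) (h : frob G (R * G * R) = 0) : G = 0 := by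
  obtain ⟨C, hC⟩ := exists_transpose_mul_self hR.posSemidef
  rw [frob_conj_self_eq hC hG] at h
  have h0 := eq_zero_of_trace_transpose_mul_self h
  refine eq_zero_of_conj_eq_zero hR ?_
  calc R * G * R = Cᵀ * (C * G * Cᵀ) * C := by rw [hC]; simp only [mul_assoc]
    _ = 0 := by rw [h0]; simp

theorem posSemidef_conj {A P : Matrix (Fin m) (Fin m) ℝ} (hA : A.PosSemidef)
    (hP : P.IsHermitian) : (P * A * P).PosSemidef := by
  have := hA.mul_mul_conjTranspose_same P
  rwa [hP.eq] at this

/-- With Y = BᵀB, Trace Y³ is the squared norm of BY; if BY = 0 then YᵀY = 0 and Y = 0. -/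
theorem trace_pow_three_pos {Y : Matrix (Fin m) (Fin m) ℝ} (hY : Y.PosSemidef) (h0 : Y ≠ 0) :
    0 < (Y * Y * Y).trace := by
  obtain ⟨B, hB⟩ := exists_transpose_mul_self hY
  have hs := transpose_eq hY.isHermitian
  have h1 : Y * Y * Y = (B * Y)ᵀ * (B * Y) := by
    rw [Matrix.transpose_mul, hs, mul_assoc, mul_assoc, ← mul_assoc Bᵀ B Y, ← hB]
  rw [h1]
  refine (trace_transpose_mul_self_nonneg _).lt_of_ne fun h => h0 ?_
  have h2 := eq_zero_of_trace_transpose_mul_self h.symm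
  have h3 : Yᵀ * Y = 0 := by
    rw [hs]; nth_rw 1 [hB]; rw [mul_assoc, h2, mul_zero]
  exact eq_zero_of_trace_transpose_mul_self (by rw [h3, Matrix.trace_zero])

end Frobenius

/-! ### The 3/2 power in the denominator. -/

section Powers

variable {D P X : Matrix (Fin m) (Fin m) ℝ}

theorem psdPow_three_halves_mul_self (hD : D.PosSemidef) :
    psdPow (D * D) (3 / 2) = D * D * D := by
  have hsa : IsSelfAdjoint D := hD.isHermitian
  have h2 : cfc (fun y : ℝ => y ^ 2) D = D * D := by
    rw [cfc_pow_id (R := ℝ) D 2, sq]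
  have h3 : cfc (fun y : ℝ => y ^ 3) D = D * D * D := by
    rw [cfc_pow_id (R := ℝ) D 3, pow_succ, sq]
  rw [psdPow, ← h3, ← h2, ← cfc_comp' (fun y : ℝ => y ^ (3 / 2 : ℝ)) (fun y : ℝ => y ^ 2) D
    (by
      refine ContinuousOn.rpow_const continuousOn_id fun y _ => Or.inr (by norm_num))
    (by fun_prop)]
  refine cfc_congr fun y hy => ?_
  have hy0 := spectrum_nonneg_of_posSemidef hD y hy
  rw [← Real.rpow_natCast y 2, ← Real.rpow_mul hy0, ← Real.rpow_natCast y 3]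
  norm_num

/-- With S = D^{1/2}, S(PDP)S = (SPS)², so the 3/2 power is (SPS)³ and cyclicity moves the outer S
around. If SPS = 0, then BS = 0 where P = BᵀB, hence S = 0 and D = 0. -/
theorem trace_psdPow_conj (hD : D.PosSemidef) (hP : P.PosDef) (hD0 : D ≠ 0) (hX : X = P * D * P) :
    0 < (psdPow (psdPow D (1 / 2) * X * psdPow D (1 / 2)) (3 / 2)).trace ∧
    (psdPow (psdPow D (1 / 2) * X * psdPow D (1 / 2)) (3 / 2)).trace =
      (P * D * P * D * P * D).trace := by
  set S := psdPow D (1 / 2) with hS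
  have hSS : S * S = D := psdPow_half_mul_self hD
  have hSh : S.IsHermitian := isHermitian_psdPow D _
  have hY : (S * P * S).PosSemidef := posSemidef_conj hP.posSemidef hSh
  have hYY : S * X * S = (S * P * S) * (S * P * S) := by
    rw [hX, ← hSS]; simp only [mul_assoc]
  rw [hYY, psdPow_three_halves_mul_self hY]
  constructor
  · refine trace_pow_three_pos hY fun h0 => hD0 ?_
    obtain ⟨B, hB⟩ := exists_transpose_mul_self hP.posSemidef
    have h1 : (B * S)ᵀ * (B * S) = 0 := by
      rw [Matrix.transpose_mul, transpose_eq hSh, mul_assoc, ← mul_assoc Bᵀ, ← hB, ← mul_assoc, h0]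
    have h2 := eq_zero_of_trace_transpose_mul_self (by rw [h1, Matrix.trace_zero])
    have h3 : P * S = 0 := by rw [hB, mul_assoc, h2, mul_zero]
    have h4 : S = 0 := by
      rw [← one_mul S, ← posDef_inv_mul hP, mul_assoc, h3, mul_zero]
    rw [← hSS, h4, zero_mul]
  · have : S * P * S * (S * P * S) * (S * P * S) = S * (P * D * P * D * P * S) := by
      rw [← hSS]; simp only [mul_assoc]
    rw [this, Matrix.trace_mul_comm]
    congr 1
    rw [← hSS]; simp only [mul_assoc]

end Powers

/-! ### Entrywise calculus of matrix paths. -/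

section Derivatives

/-- Entrywise derivative of a matrix-valued function within a set. -/
def HasMatDeriv (F : ℝ → Matrix (Fin m) (Fin m) ℝ) (F' : Matrix (Fin m) (Fin m) ℝ)
    (s : Set ℝ) (t : ℝ) : Prop :=
  ∀ i j, HasDerivWithinAt (fun y => F y i j) (F' i j) s t

variable {F K : ℝ → Matrix (Fin m) (Fin m) ℝ} {F' K' : Matrix (Fin m) (Fin m) ℝ}
  {s : Set ℝ} {t : ℝ}

theorem HasMatDeriv.continuousWithinAt (hF : HasMatDeriv F F' s t) :
    ContinuousWithinAt F s t :=
  continuousWithinAt_pi.2 fun i => continuousWithinAt_pi.2 fun j => (hF i j).continuousWithinAt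

theorem HasMatDeriv.mono {s' : Set ℝ} (hF : HasMatDeriv F F' s t) (h : s' ⊆ s) :
    HasMatDeriv F F' s' t := fun i j => (hF i j).mono h

theorem HasMatDeriv.add (hF : HasMatDeriv F F' s t) (hK : HasMatDeriv K K' s t) :
    HasMatDeriv (fun y => F y + K y) (F' + K') s t := fun i j => (hF i j).add (hK i j)

theorem HasMatDeriv.sub (hF : HasMatDeriv F F' s t) (hK : HasMatDeriv K K' s t) :
    HasMatDeriv (fun y => F y - K y) (F' - K') s t := fun i j => (hF i j).sub (hK i j)

theorem HasMatDeriv.const_smul (c : ℝ) (hF : HasMatDeriv F F' s t) :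
    HasMatDeriv (fun y => c • F y) (c • F') s t := fun i j => (hF i j).const_mul c

theorem HasMatDeriv.mul (hF : HasMatDeriv F F' s t) (hK : HasMatDeriv K K' s t) :
    HasMatDeriv (fun y => F y * K y) (F' * K t + F t * K') s t := by
  intro i j
  simp only [Matrix.mul_apply, Matrix.add_apply, ← Finset.sum_add_distrib]
  exact HasDerivWithinAt.fun_sum fun k _ => (hF i k).mul (hK k j)

theorem HasMatDeriv.frob (hF : HasMatDeriv F F' s t) (hK : HasMatDeriv K K' s t) :
    HasDerivWithinAt (fun y => frob (F y) (K y)) (frob F' (K t) + frob (F t) K') s t := by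
  simp only [VectorSpin.frob, ← Finset.sum_add_distrib]
  exact HasDerivWithinAt.fun_sum fun i _ => HasDerivWithinAt.fun_sum fun j _ =>
    (hF i j).mul (hK i j)

theorem continuousAt_matrix_inv' {A : Matrix (Fin m) (Fin m) ℝ} (hA : IsUnit A.det) :
    ContinuousAt (fun B : Matrix (Fin m) (Fin m) ℝ => B⁻¹) A :=
  continuousAt_matrix_inv A (by
    rw [Ring.inverse_eq_inv']
    exact continuousAt_inv₀ hA.ne_zero)

/-- The resolvent identity A⁻¹ - B⁻¹ = -A⁻¹(A - B)B⁻¹ applied to difference quotients, with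
continuity of inversion in the limit. -/
theorem HasMatDeriv.inv (hF : HasMatDeriv F F' s t) (ht : t ∈ s)
    (hu : ∀ y ∈ s, IsUnit (F y).det) :
    HasMatDeriv (fun y => (F y)⁻¹) (-((F t)⁻¹ * F' * (F t)⁻¹)) s t := by
  have hc : ContinuousWithinAt (fun y => (F y)⁻¹) s t :=
    (continuousAt_matrix_inv' (hu t ht)).comp_continuousWithinAt hF.continuousWithinAt
  have hsl : Filter.Tendsto (fun y => (Matrix.of fun i j => slope (fun z => F z i j) t y :
      Matrix (Fin m) (Fin m) ℝ)) (nhdsWithin t (s \ {t})) (nhds F') :=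
    tendsto_pi_nhds.2 fun i => tendsto_pi_nhds.2 fun j =>
      hasDerivWithinAt_iff_tendsto_slope.1 (hF i j)
  have hc' := hc.mono_left (nhdsWithin_mono t (sdiff_subset (t := {t})))
  have hlim := ((hc'.mul hsl).mul (tendsto_const_nhds (x := (F t)⁻¹))).neg
  intro i j
  rw [hasDerivWithinAt_iff_tendsto_slope]
  have hij := tendsto_pi_nhds.1 (tendsto_pi_nhds.1 hlim i) j
  refine hij.congr' ?_
  filter_upwards [self_mem_nhdsWithin] with y hy
  have e1 : (F y)⁻¹ - (F t)⁻¹ = -((F y)⁻¹ * (F y - F t) * (F t)⁻¹) := by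
    rw [mul_sub, sub_mul, Matrix.nonsing_inv_mul _ (hu y hy.1), mul_assoc,
      Matrix.mul_nonsing_inv _ (hu t ht)]
    simp
  have e2 : (Matrix.of fun i j => slope (fun z => F z i j) t y : Matrix (Fin m) (Fin m) ℝ)
      = (y - t)⁻¹ • (F y - F t) := by
    ext i j; simp [slope_def_field, div_eq_inv_mul]
  rw [e2, slope_def_field, ← Matrix.sub_apply, e1]
  simp [div_eq_inv_mul]

end Derivatives

end VectorSpin

namespace VectorSpin

variable {m : ℕ} {μ : Measure ℝ}

/-! ### The distribution function x and its measure μ. -/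

section OrderMeasure

/-- There is no mass below 0, so x agrees with the distribution function on the whole line, which
supplies monotonicity and right continuity. -/
theorem IsOrderMeasure.orderParam_eq_cdf (hμ : IsOrderMeasure m μ) :
    orderParam μ = ProbabilityTheory.cdf μ := by
  have := hμ.isProbabilityMeasure
  ext t
  rw [ProbabilityTheory.cdf_eq_real, orderParam]
  refine measureReal_congr ?_
  have h0 : ∀ᵐ s ∂μ, s ∈ Icc (0 : ℝ) m := mem_ae_iff.2 hμ.compl_eq_zero
  filter_upwards [h0] with s hs
  exact propext ⟨fun h => h.2, fun h => ⟨hs.1, h⟩⟩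

theorem IsOrderMeasure.monotone (hμ : IsOrderMeasure m μ) : Monotone (orderParam μ) := by
  rw [hμ.orderParam_eq_cdf]; exact ProbabilityTheory.monotone_cdf μ

theorem orderParam_nonneg (μ : Measure ℝ) (t : ℝ) : 0 ≤ orderParam μ t := measureReal_nonneg

theorem IsOrderMeasure.le_one (hμ : IsOrderMeasure m μ) (t : ℝ) : orderParam μ t ≤ 1 := by
  rw [hμ.orderParam_eq_cdf]; exact ProbabilityTheory.cdf_le_one μ t

theorem IsOrderMeasure.continuousWithinAt (hμ : IsOrderMeasure m μ) (t : ℝ) :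
    ContinuousWithinAt (orderParam μ) (Ici t) t := by
  rw [hμ.orderParam_eq_cdf]; exact (ProbabilityTheory.cdf μ).right_continuous t

theorem IsOrderMeasure.orderParam_top (hμ : IsOrderMeasure m μ) : orderParam μ m = 1 := by
  have := hμ.isProbabilityMeasure
  have h0 : ∀ᵐ s ∂μ, s ∈ Icc (0 : ℝ) m := mem_ae_iff.2 hμ.compl_eq_zero
  have h1 : Icc (0 : ℝ) m =ᵐ[μ] univ := by
    filter_upwards [h0] with s hs
    exact propext ⟨fun _ => trivial, fun _ => hs⟩
  rw [orderParam, measureReal_congr h1, probReal_univ]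

theorem IsOrderMeasure.exists_lt (hμ : IsOrderMeasure m μ) {T : ℝ} (hT : topPoint m μ < T) :
    ∃ s ∈ Icc (0 : ℝ) m, s < T ∧ orderParam μ s = 1 := by
  have hne : {t | t ∈ Icc (0 : ℝ) m ∧ orderParam μ t = 1}.Nonempty :=
    ⟨(m : ℝ), ⟨Nat.cast_nonneg m, le_rfl⟩, hμ.orderParam_top⟩
  obtain ⟨s, hs, hsT⟩ := exists_lt_of_csInf_lt hne hT
  exact ⟨s, hs.1, hsT, hs.2⟩

theorem topPoint_nonneg (m : ℕ) (μ : Measure ℝ) : 0 ≤ topPoint m μ :=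
  Real.sInf_nonneg fun _ ht => ht.1.1

theorem IsOrderMeasure.orderParam_eq_one (hμ : IsOrderMeasure m μ) {T t : ℝ}
    (hT : topPoint m μ < T) (ht : T ≤ t) : orderParam μ t = 1 := by
  obtain ⟨s, -, hsT, hs⟩ := hμ.exists_lt hT
  exact le_antisymm (hμ.le_one t) (hs ▸ hμ.monotone (hsT.le.trans ht))

theorem IsOrderMeasure.ae_mem_Icc (hμ : IsOrderMeasure m μ) {s : ℝ} (hs : orderParam μ s = 1) :
    ∀ᵐ t ∂μ, t ∈ Icc 0 s := by
  have := hμ.isProbabilityMeasure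
  change Icc 0 s ∈ ae μ
  rw [mem_ae_iff, prob_compl_eq_zero_iff measurableSet_Icc]
  rw [orderParam, measureReal_def] at hs
  rw [← ENNReal.ofReal_toReal (measure_ne_top μ (Icc 0 s)), hs, ENNReal.ofReal_one]

theorem IsOrderMeasure.ae_pos (hμ : IsOrderMeasure m μ) : ∀ᵐ t ∂μ, 0 < t := by
  have := hμ.isProbabilityMeasure
  have h0 := hμ.orderParam_zero
  rw [orderParam, measureReal_eq_zero_iff, Icc_self] at h0
  have h1 : ∀ᵐ t ∂μ, t ≠ 0 := by
    rw [ae_iff]; simpa using h0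
  filter_upwards [hμ.ae_mem_Icc hμ.orderParam_top, h1] with t ht ht'
  exact ht.1.lt_of_ne' ht'

theorem IsOrderMeasure.ae_mem_Ioo (hμ : IsOrderMeasure m μ) {T : ℝ} (hT : topPoint m μ < T) :
    ∀ᵐ t ∂μ, t ∈ Ioo 0 T := by
  obtain ⟨s, -, hsT, hs⟩ := hμ.exists_lt hT
  filter_upwards [hμ.ae_mem_Icc hs, hμ.ae_pos] with t ht ht'
  exact ⟨ht', ht.2.trans_lt hsT⟩

theorem IsOrderMeasure.support_subset (hμ : IsOrderMeasure m μ) :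
    μ.support ⊆ Icc 0 (topPoint m μ) := by
  intro u hu
  have key : ∀ T, topPoint m μ < T → u ∈ Icc 0 T := fun T hT => by
    obtain ⟨s, -, hsT, hs⟩ := hμ.exists_lt hT
    have := Measure.support_subset_of_isClosed isClosed_Icc (hμ.ae_mem_Icc hs) hu
    exact ⟨this.1, this.2.trans hsT.le⟩
  exact ⟨(key _ (lt_add_one _)).1, le_of_forall_gt_imp_ge_of_dense fun T hT => (key T hT).2⟩

theorem IsOrderMeasure.integrable_of_continuousOn (hμ : IsOrderMeasure m μ) {s : ℝ}
    (hs : orderParam μ s = 1) {f : ℝ → ℝ} (hf : ContinuousOn f (Icc 0 s)) : Integrable f μ := by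
  have := hμ.isProbabilityMeasure
  have h := hf.integrableOn_compact (μ := μ) isCompact_Icc
  rwa [IntegrableOn, Measure.restrict_eq_self_of_ae_mem (hμ.ae_mem_Icc hs)] at h

theorem IsOrderMeasure.intervalIntegrable_mul (hμ : IsOrderMeasure m μ) {f : ℝ → ℝ} {s T : ℝ}
    (hf : ContinuousOn f (uIcc s T)) :
    IntervalIntegrable (fun t => orderParam μ t * f t) volume s T :=
  (hμ.monotone.intervalIntegrable (a := s) (b := T)).mul_continuousOn hf

/-- Integration by parts against the distribution function. -/
theorem IsOrderMeasure.integral_orderParam_mul (hμ : IsOrderMeasure m μ) {T : ℝ} (hT0 : 0 ≤ T)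
    (hT : orderParam μ T = 1) {f f' : ℝ → ℝ} (hf : ContinuousOn f (Icc 0 T))
    (hf' : ContinuousOn f' (Icc 0 T))
    (hd : ∀ t ∈ Ico 0 T, HasDerivWithinAt f (f' t) (Ici t) t) :
    ∫ t in 0..T, orderParam μ t * f' t = f T - ∫ s, f s ∂μ := by
  have := hμ.isProbabilityMeasure
  have hftc : ∀ s ∈ Icc 0 T, ∫ t in s..T, f' t = f T - f s := fun s hs => by
    refine intervalIntegral.integral_eq_sub_of_hasDeriv_right
      (hf.mono (by rw [uIcc_of_le hs.2]; exact Icc_subset_Icc_left hs.1)) (fun t ht => ?_)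
      (hf'.mono (by rw [uIcc_of_le hs.2]; exact Icc_subset_Icc_left hs.1)).intervalIntegrable
    rw [min_eq_left hs.2, max_eq_right hs.2] at ht
    exact (hd t ⟨hs.1.trans ht.1.le, ht.2⟩).mono Ioi_subset_Ici_self
  have hint : Integrable f' (volume.restrict (Ioc 0 T)) :=
    (hf'.integrableOn_Icc (μ := volume)).mono_set Ioc_subset_Icc_self
  have hmeas : MeasurableSet {q : ℝ × ℝ | q.2 ≤ q.1} := measurableSet_le measurable_snd measurable_fst
  have hI : Integrable (Function.uncurry fun t s => (Iic t).indicator (fun _ => f' t) s)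
      ((volume.restrict (Ioc 0 T)).prod μ) :=
    ((hint.comp_fst μ).indicator hmeas).congr (Filter.Eventually.of_forall fun q => rfl)
  have hx : ∀ t, ∫ s, (Iic t).indicator (fun _ => f' t) s ∂μ = orderParam μ t * f' t := fun t => by
    rw [integral_indicator_const _ measurableSet_Iic, smul_eq_mul, hμ.orderParam_eq_cdf,
      ProbabilityTheory.cdf_eq_real]
  rw [intervalIntegral.integral_of_le hT0]
  simp_rw [← hx]
  rw [integral_integral_swap hI]
  -- Fubini reduces the claim to the inner integral. There is no mass at 0, so s > 0 almost surely
  -- and (0,T] ∩ [s,∞) is exactly [s,T].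
  have hinner : ∀ᵐ s ∂μ, ∫ t in Ioc 0 T, (Iic t).indicator (fun _ => f' t) s = f T - f s := by
    filter_upwards [hμ.ae_pos, hμ.ae_mem_Icc hT] with s hs0 hs
    have hc : ∫ t in Ioc s T, f' t = ∫ t in Icc s T, f' t := integral_Icc_eq_integral_Ioc.symm
    rw [← hftc s hs, intervalIntegral.integral_of_le hs.2, hc]
    have : ∀ t, (Iic t).indicator (fun _ => f' t) s = (Ici s).indicator f' t := fun t => by
      simp only [indicator, mem_Iic, mem_Ici]
    simp_rw [this]
    rw [setIntegral_indicator measurableSet_Ici]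
    congr 2
    ext t
    simp only [mem_inter_iff, mem_Ioc, mem_Ici, mem_Icc]
    exact ⟨fun h => ⟨h.2, h.1.2⟩, fun h => ⟨⟨hs0.trans_le h.1, h.2⟩, h.1⟩⟩
  rw [integral_congr_ae hinner, integral_sub (integrable_const _)
    (hμ.integrable_of_continuousOn hT hf)]
  simp

end OrderMeasure

end VectorSpin

namespace VectorSpin

variable {m : ℕ} {μ κ : Measure ℝ} {Q : Matrix (Fin m) (Fin m) ℝ}
  {Φ : ℝ → Matrix (Fin m) (Fin m) ℝ}

/-! ### Monotone matrix paths. -/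

section Path

theorem IsPath.hasMatDeriv (hΦ : IsPath Q κ Φ) {t : ℝ} (ht : t ∈ Icc (0 : ℝ) m) :
    HasMatDeriv Φ (pathDeriv Φ t) (Icc (0 : ℝ) m) t := fun i j =>
  (hΦ.differentiable i j t ht).hasDerivWithinAt

theorem IsPath.hasMatDeriv_right (hΦ : IsPath Q κ Φ) {t : ℝ} (ht : t ∈ Ico (0 : ℝ) m) :
    HasMatDeriv Φ (pathDeriv Φ t) (Ici t) t := fun i j =>
  (hΦ.hasMatDeriv ⟨ht.1, ht.2.le⟩ i j).mono_of_mem_nhdsWithin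
    (Filter.mem_of_superset (Icc_mem_nhdsGE ht.2) (Icc_subset_Icc_left ht.1))

theorem IsPath.continuousOn (hΦ : IsPath Q κ Φ) : ContinuousOn Φ (Icc (0 : ℝ) m) := fun _ ht =>
  (hΦ.hasMatDeriv ht).continuousWithinAt

theorem IsPath.continuousOn_pathDeriv (hΦ : IsPath Q κ Φ) :
    ContinuousOn (pathDeriv Φ) (Icc (0 : ℝ) m) := by
  obtain ⟨K, hK⟩ := hΦ.lipschitz_deriv
  exact continuousOn_pi.2 fun i => continuousOn_pi.2 fun j => (hK i j).continuousOn

theorem continuousOn_apply {s : Set ℝ} {F : ℝ → Matrix (Fin m) (Fin m) ℝ}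
    (hF : ContinuousOn F s) (i j : Fin m) : ContinuousOn (fun t => F t i j) s :=
  continuousOn_pi.1 (continuousOn_pi.1 hF i) j

theorem continuousOn_frob {X : Type*} [TopologicalSpace X] {s : Set X}
    {F K : X → Matrix (Fin m) (Fin m) ℝ}
    (hF : ContinuousOn F s) (hK : ContinuousOn K s) :
    ContinuousOn (fun t => frob (F t) (K t)) s :=
  continuousOn_finsetSum _ fun i _ => continuousOn_finsetSum _ fun j _ =>
    (continuousOn_pi.1 (continuousOn_pi.1 hF i) j).mul
      (continuousOn_pi.1 (continuousOn_pi.1 hK i) j)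

theorem HasMatDeriv.quad {F : ℝ → Matrix (Fin m) (Fin m) ℝ} {F' : Matrix (Fin m) (Fin m) ℝ}
    {s : Set ℝ} {t : ℝ} (hF : HasMatDeriv F F' s t) (v : Fin m → ℝ) :
    HasDerivWithinAt (fun y => v ⬝ᵥ F y *ᵥ v) (v ⬝ᵥ F' *ᵥ v) s t := by
  simp only [dotProduct_mulVec_eq_sum]
  exact HasDerivWithinAt.fun_sum fun i _ => HasDerivWithinAt.fun_sum fun j _ =>
    (hF i j).const_mul _

theorem posSemidef_sub_of_quad_mono {F : ℝ → Matrix (Fin m) (Fin m) ℝ} {s t : ℝ}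
    (hs : (F s).IsHermitian) (ht : (F t).IsHermitian)
    (h : ∀ v : Fin m → ℝ, v ⬝ᵥ F s *ᵥ v ≤ v ⬝ᵥ F t *ᵥ v) : (F t - F s).PosSemidef := by
  rw [posSemidef_iff_real]
  refine ⟨ht.sub hs, fun v => ?_⟩
  rw [Matrix.sub_mulVec, dotProduct_sub]
  linarith [h v]

theorem IsPath.posSemidef_pathDeriv (hΦ : IsPath Q κ Φ) (hm : (0 : ℝ) < m) {t : ℝ}
    (ht : t ∈ Icc (0 : ℝ) m) : (pathDeriv Φ t).PosSemidef := by
  rw [posSemidef_iff_real]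
  have hu : UniqueDiffWithinAt ℝ (Icc (0 : ℝ) m) t := uniqueDiffOn_Icc hm t ht
  refine ⟨isHermitian_of_symm fun i j => ?_, fun v => ?_⟩
  · refine hu.eq_deriv _ (hΦ.hasMatDeriv ht i j) ((hΦ.hasMatDeriv ht j i).congr (fun s hs => ?_) ?_)
    · exact symm_apply (hΦ.posSemidef s hs).isHermitian i j
    · exact symm_apply (hΦ.posSemidef t ht).isHermitian i j
  · rw [← ((hΦ.hasMatDeriv ht).quad v).derivWithin hu]
    refine MonotoneOn.derivWithin_nonneg fun s hs s' hs' hss' => ?_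
    have := quad_nonneg (hΦ.monotone s hs s' hs' hss') v
    rw [Matrix.sub_mulVec, dotProduct_sub] at this
    linarith

theorem IsPath.apply_mem (hΦ : IsPath Q κ Φ) (hQ : IsConstraint Q) {t : ℝ}
    (ht : t ∈ Icc (0 : ℝ) m) (i j : Fin m) : Φ t i j ∈ Icc (-1 : ℝ) 1 := by
  refine abs_apply_le_of_diag_le (hΦ.posSemidef t ht) (fun i => ?_) i j
  have hmem : (m : ℝ) ∈ Icc (0 : ℝ) m := ⟨Nat.cast_nonneg m, le_rfl⟩
  have := (hΦ.monotone t ht m hmem ht.2).diag_nonneg (i := i)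
  rw [Matrix.sub_apply, hΦ.top, hQ.diag i] at this
  linarith

end Path

/-! ### The weighted tail Φ̂. -/

section HatPath

theorem intervalIntegrable_sum {f : Fin m → ℝ → ℝ} {s t : ℝ}
    (hf : ∀ i, IntervalIntegrable (f i) volume s t) :
    IntervalIntegrable (fun y => ∑ i, f i y) volume s t := by
  have h := IntervalIntegrable.sum Finset.univ fun i _ => hf i
  have e : (∑ i, f i) = fun y => ∑ i, f i y := by ext y; simp
  rwa [e] at h

theorem IsPath.intervalIntegrable (hΦ : IsPath Q κ Φ) (hμ : IsOrderMeasure m μ) (i j : Fin m)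
    {s t : ℝ} (hs : s ∈ Icc (0 : ℝ) m) (ht : t ∈ Icc (0 : ℝ) m) :
    IntervalIntegrable (fun y => orderParam μ y * pathDeriv Φ y i j) volume s t :=
  hμ.intervalIntegrable_mul
    ((continuousOn_apply hΦ.continuousOn_pathDeriv i j).mono (uIcc_subset_Icc hs ht))

/-- Since x is merely right-continuous, only a right derivative is available; this is why most
derivatives below are taken within `Ici t`. -/
theorem IsPath.hasMatDeriv_hatPath (hΦ : IsPath Q κ Φ) (hμ : IsOrderMeasure m μ) {t : ℝ}
    (ht : t ∈ Ico (0 : ℝ) m) :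
    HasMatDeriv (hatPath μ Φ) (-(orderParam μ t • pathDeriv Φ t)) (Ici t) t := by
  intro i j
  have hm : (m : ℝ) ∈ Icc (0 : ℝ) m := ⟨ht.1.trans ht.2.le, le_rfl⟩
  have hnhds : Icc (0 : ℝ) m ∈ nhdsWithin t (Ici t) :=
    Filter.mem_of_superset (Icc_mem_nhdsGE ht.2) (Icc_subset_Icc_left ht.1)
  have hD : ContinuousWithinAt (fun y => pathDeriv Φ y i j) (Ici t) t :=
    ((continuousOn_apply hΦ.continuousOn_pathDeriv i j) t ⟨ht.1, ht.2.le⟩).mono_of_mem_nhdsWithin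
      hnhds
  have hc : ContinuousWithinAt (fun y => orderParam μ y * pathDeriv Φ y i j) (Ioi t) t :=
    ((hμ.continuousWithinAt t).mul hD).mono Ioi_subset_Ici_self
  have hmeas : StronglyMeasurableAtFilter (fun y => orderParam μ y * pathDeriv Φ y i j)
      (nhdsWithin t (Ioi t)) volume := by
    refine ⟨Icc (0 : ℝ) m, nhdsWithin_mono t Ioi_subset_Ici_self hnhds, ?_⟩
    exact hμ.monotone.measurable.aestronglyMeasurable.mul
      ((continuousOn_apply hΦ.continuousOn_pathDeriv i j).aestronglyMeasurable measurableSet_Icc)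
  have := (intervalIntegral.integral_hasDerivWithinAt_right
    (hΦ.intervalIntegrable hμ i j hm ⟨ht.1, ht.2.le⟩) (s := Ici t) hmeas hc).neg
  refine this.congr_of_eventuallyEq (Filter.Eventually.of_forall fun y => ?_) ?_ <;>
  · simp only [hatPath, Matrix.of_apply, Pi.neg_apply]
    rw [intervalIntegral.integral_symm]

theorem IsPath.continuousOn_hatPath (hΦ : IsPath Q κ Φ) (hμ : IsOrderMeasure m μ) :
    ContinuousOn (hatPath μ Φ) (Icc (0 : ℝ) m) := by
  have h0 : (0 : ℝ) ∈ Icc (0 : ℝ) m := ⟨le_rfl, Nat.cast_nonneg m⟩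
  have hm : (m : ℝ) ∈ Icc (0 : ℝ) m := ⟨Nat.cast_nonneg m, le_rfl⟩
  refine continuousOn_pi.2 fun i => continuousOn_pi.2 fun j => ?_
  have h := intervalIntegral.continuousOn_primitive_interval'
    (hΦ.intervalIntegrable hμ i j h0 hm) (a := (m : ℝ)) right_mem_uIcc
  rw [uIcc_of_le (Nat.cast_nonneg m)] at h
  refine h.neg.congr fun t _ => ?_
  simp only [hatPath, Matrix.of_apply, Pi.neg_apply]
  rw [intervalIntegral.integral_symm]

theorem IsPath.hatPath_sub (hΦ : IsPath Q κ Φ) (hμ : IsOrderMeasure m μ) {s t : ℝ}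
    (hs : s ∈ Icc (0 : ℝ) m) (ht : t ∈ Icc (0 : ℝ) m) (i j : Fin m) :
    hatPath μ Φ s i j - hatPath μ Φ t i j =
      ∫ y in s..t, orderParam μ y * pathDeriv Φ y i j := by
  have hm : (m : ℝ) ∈ Icc (0 : ℝ) m := ⟨Nat.cast_nonneg m, le_rfl⟩
  simp only [hatPath, Matrix.of_apply]
  rw [sub_eq_iff_eq_add, intervalIntegral.integral_add_adjacent_intervals
    (hΦ.intervalIntegrable hμ i j hs ht) (hΦ.intervalIntegrable hμ i j ht hm)]

theorem IsPath.isHermitian_hatPath (hΦ : IsPath Q κ Φ) (hm : (0 : ℝ) < m) {t : ℝ}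
    (ht : t ∈ Icc (0 : ℝ) m) : (hatPath μ Φ t).IsHermitian := by
  refine isHermitian_of_symm fun i j => intervalIntegral.integral_congr fun s hs => ?_
  have hs' : s ∈ Icc (0 : ℝ) m := uIcc_subset_Icc ht ⟨hm.le, le_rfl⟩ hs
  exact congrArg (orderParam μ s * ·)
    (symm_apply (hΦ.posSemidef_pathDeriv hm hs').isHermitian i j)

theorem IsPath.posSemidef_hatPath_sub (hΦ : IsPath Q κ Φ) (hμ : IsOrderMeasure m μ)
    (hm : (0 : ℝ) < m) {s t : ℝ} (hs : s ∈ Icc (0 : ℝ) m) (ht : t ∈ Icc (0 : ℝ) m) (hst : s ≤ t) :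
    (hatPath μ Φ s - hatPath μ Φ t).PosSemidef := by
  rw [posSemidef_iff_real]
  refine ⟨(hΦ.isHermitian_hatPath hm hs).sub (hΦ.isHermitian_hatPath hm ht), fun v => ?_⟩
  have hint := fun i j => (hΦ.intervalIntegrable hμ i j hs ht).const_mul (v i * v j)
  have e : v ⬝ᵥ (hatPath μ Φ s - hatPath μ Φ t) *ᵥ v =
      ∫ y in s..t, ∑ i, ∑ j, v i * v j * (orderParam μ y * pathDeriv Φ y i j) := by
    rw [dotProduct_mulVec_eq_sum, intervalIntegral.integral_finsetSum
      fun i _ => intervalIntegrable_sum fun j => hint i j]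
    refine Finset.sum_congr rfl fun i _ => ?_
    rw [intervalIntegral.integral_finsetSum fun j _ => hint i j]
    refine Finset.sum_congr rfl fun j _ => ?_
    rw [intervalIntegral.integral_const_mul, Matrix.sub_apply, hΦ.hatPath_sub hμ hs ht]
  rw [e]
  refine intervalIntegral.integral_nonneg hst fun y hy => ?_
  have hy' : y ∈ Icc (0 : ℝ) m := ⟨hs.1.trans hy.1, hy.2.trans ht.2⟩
  have h2 := mul_nonneg (orderParam_nonneg μ y) (quad_nonneg (hΦ.posSemidef_pathDeriv hm hy') v)
  rw [dotProduct_mulVec_eq_sum] at h2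
  simp only [Finset.mul_sum] at h2
  refine h2.trans_eq (Finset.sum_congr rfl fun i _ => Finset.sum_congr rfl fun j _ => by ring)

theorem IsPath.hatPath_eq_sub (hΦ : IsPath Q κ Φ) (hμ : IsOrderMeasure m μ) {T : ℝ}
    (hT : topPoint m μ < T) {t : ℝ} (ht : T ≤ t) (htm : t ≤ m) : hatPath μ Φ t = Q - Φ t := by
  have ht0 : 0 ≤ t := (topPoint_nonneg m μ).trans (hT.le.trans ht)
  ext i j
  have e : hatPath μ Φ t i j = ∫ s in t..(m : ℝ), pathDeriv Φ s i j := by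
    refine intervalIntegral.integral_congr fun s hs => ?_
    rw [uIcc_of_le htm] at hs
    rw [hμ.orderParam_eq_one hT (ht.trans hs.1), one_mul]
  have hsub : uIcc t (m : ℝ) ⊆ Icc (0 : ℝ) m := by
    rw [uIcc_of_le htm]; exact Icc_subset_Icc_left ht0
  rw [e, Matrix.sub_apply, ← hΦ.top]
  refine intervalIntegral.integral_eq_sub_of_hasDeriv_right
    ((continuousOn_apply hΦ.continuousOn i j).mono hsub) (fun s hs => ?_)
    ((continuousOn_apply hΦ.continuousOn_pathDeriv i j).mono hsub).intervalIntegrable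
  rw [min_eq_left htm, max_eq_right htm] at hs
  exact ((hΦ.hasMatDeriv_right ⟨ht0.trans hs.1.le, hs.2⟩) i j).mono Ioi_subset_Ici_self

/-- Φ̂ decreases in t and Φ̂(T) = Q - Φ(T), because x = 1 on [T,m]; so Φ̂(t) dominates a definite
matrix. -/
theorem IsPath.posDef_hatPath (hΦ : IsPath Q κ Φ) (hμ : IsOrderMeasure m μ)
    (hm : (0 : ℝ) < m) {T : ℝ} (hT : topPoint m μ < T) (hTm : T ≤ m) (hdet : (Q - Φ T).PosDef)
    {t : ℝ} (ht : t ∈ Icc 0 T) : (hatPath μ Φ t).PosDef := by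
  have h := hΦ.posSemidef_hatPath_sub hμ hm ⟨ht.1, ht.2.trans hTm⟩ ⟨ht.1.trans ht.2, hTm⟩ ht.2
  have := hdet.add_posSemidef h
  rwa [hΦ.hatPath_eq_sub hμ hT le_rfl hTm, add_sub_cancel] at this

end HatPath

/-! ### The inverse of Φ̂ and the response integral. -/

section Resolvent

variable {T : ℝ}

theorem IsPath.continuousOn_inv_hatPath (hΦ : IsPath Q κ Φ) (hμ : IsOrderMeasure m μ)
    (hm : (0 : ℝ) < m) (hT : topPoint m μ < T) (hTm : T ≤ m) (hdet : (Q - Φ T).PosDef) :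
    ContinuousOn (fun t => (hatPath μ Φ t)⁻¹) (Icc 0 T) := fun t ht =>
  (continuousAt_matrix_inv' ((Matrix.isUnit_iff_isUnit_det _).1
    (hΦ.posDef_hatPath hμ hm hT hTm hdet ht).isUnit)).comp_continuousWithinAt
    (((hΦ.continuousOn_hatPath hμ).mono (Icc_subset_Icc_right hTm)) t ht)

theorem IsPath.hasMatDeriv_inv_hatPath (hΦ : IsPath Q κ Φ) (hμ : IsOrderMeasure m μ)
    (hm : (0 : ℝ) < m) (hT : topPoint m μ < T) (hTm : T ≤ m) (hdet : (Q - Φ T).PosDef)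
    {t : ℝ} (ht : t ∈ Ico 0 T) :
    HasMatDeriv (fun t => (hatPath μ Φ t)⁻¹)
      (orderParam μ t • ((hatPath μ Φ t)⁻¹ * pathDeriv Φ t * (hatPath μ Φ t)⁻¹)) (Ici t) t := by
  have h := ((hΦ.hasMatDeriv_hatPath hμ ⟨ht.1, ht.2.trans_le hTm⟩).mono
    (Icc_subset_Ici_self : Icc t T ⊆ Ici t)).inv ⟨le_rfl, ht.2.le⟩ fun y hy =>
      (Matrix.isUnit_iff_isUnit_det _).1
        (hΦ.posDef_hatPath hμ hm hT hTm hdet ⟨ht.1.trans hy.1, hy.2⟩).isUnit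
  intro i j
  refine ((h i j).mono_of_mem_nhdsWithin (Icc_mem_nhdsGE ht.2)).congr_deriv ?_
  simp

/-- `H(t) = ∫_0^t Φ̂⁻¹ Φ' Φ̂⁻¹`. -/
noncomputable def responsePath (μ : Measure ℝ) (Φ : ℝ → Matrix (Fin m) (Fin m) ℝ) (t : ℝ) :
    Matrix (Fin m) (Fin m) ℝ :=
  Matrix.of fun i j =>
    ∫ s in 0..t, ((hatPath μ Φ s)⁻¹ * pathDeriv Φ s * (hatPath μ Φ s)⁻¹) i j

/-- The first variation `ξ'(Φ) + h hᵀ - ∫_0^t Φ̂⁻¹ Φ' Φ̂⁻¹` of the functional. -/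
noncomputable def gradPath (β : ℕ → Fin m → ℝ) (h : Fin m → ℝ) (μ : Measure ℝ)
    (Φ : ℝ → Matrix (Fin m) (Fin m) ℝ) (t : ℝ) : Matrix (Fin m) (Fin m) ℝ :=
  xiDeriv β 1 (Φ t) + Matrix.vecMulVec h h - responsePath μ Φ t

theorem responsePath_zero (μ : Measure ℝ) (Φ : ℝ → Matrix (Fin m) (Fin m) ℝ) :
    responsePath μ Φ 0 = 0 := by
  ext i j; simp [responsePath]

theorem IsPath.continuousOn_responseDeriv (hΦ : IsPath Q κ Φ) (hμ : IsOrderMeasure m μ)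
    (hm : (0 : ℝ) < m) (hT : topPoint m μ < T) (hTm : T ≤ m) (hdet : (Q - Φ T).PosDef) :
    ContinuousOn (fun t => (hatPath μ Φ t)⁻¹ * pathDeriv Φ t * (hatPath μ Φ t)⁻¹) (Icc 0 T) := by
  have h1 := hΦ.continuousOn_inv_hatPath hμ hm hT hTm hdet
  have h2 := hΦ.continuousOn_pathDeriv.mono (Icc_subset_Icc_right hTm)
  exact (h1.mul h2).mul h1

/-- Here x enters only through the integral defining Φ̂, so the integrand is continuous and the
derivative is two-sided within [0,T]. -/
theorem IsPath.hasMatDeriv_responsePath (hΦ : IsPath Q κ Φ) (hμ : IsOrderMeasure m μ)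
    (hm : (0 : ℝ) < m) (hT : topPoint m μ < T) (hTm : T ≤ m) (hdet : (Q - Φ T).PosDef)
    {t : ℝ} (ht : t ∈ Icc 0 T) :
    HasMatDeriv (responsePath μ Φ)
      ((hatPath μ Φ t)⁻¹ * pathDeriv Φ t * (hatPath μ Φ t)⁻¹) (Icc 0 T) t := by
  intro i j
  have hc := continuousOn_apply (hΦ.continuousOn_responseDeriv hμ hm hT hTm hdet) i j
  -- Instance required by the form of the fundamental theorem of calculus within `Icc 0 T`.
  have : Fact (t ∈ Icc 0 T) := ⟨ht⟩
  exact intervalIntegral.integral_hasDerivWithinAt_right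
    (hc.mono (uIcc_subset_Icc ⟨le_rfl, ht.1.trans ht.2⟩ ht)).intervalIntegrable
    (s := Icc 0 T) (t := Icc 0 T)
    ⟨Icc 0 T, self_mem_nhdsWithin, hc.aestronglyMeasurable measurableSet_Icc⟩ (hc t ht)

theorem IsPath.isHermitian_responsePath (hΦ : IsPath Q κ Φ) (hμ : IsOrderMeasure m μ)
    (hm : (0 : ℝ) < m) (hT : topPoint m μ < T) (hTm : T ≤ m) (hdet : (Q - Φ T).PosDef)
    {t : ℝ} (ht : t ∈ Icc 0 T) : (responsePath μ Φ t).IsHermitian := by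
  refine isHermitian_of_symm fun i j => intervalIntegral.integral_congr fun s hs => ?_
  have hs' : s ∈ Icc 0 T := uIcc_subset_Icc ⟨le_rfl, ht.1.trans ht.2⟩ ht hs
  exact symm_apply (posSemidef_conj (hΦ.posSemidef_pathDeriv hm ⟨hs'.1, hs'.2.trans hTm⟩)
    (hΦ.posDef_hatPath hμ hm hT hTm hdet hs').inv.isHermitian).isHermitian i j

end Resolvent

/-! ### The gradient path and its derivative. -/

section Gradient

variable {T : ℝ} {β : ℕ → Fin m → ℝ} {h : Fin m → ℝ}

theorem IsPath.hasMatDeriv_xiDeriv (hΦ : IsPath Q κ Φ) (hβ : IsMixedEven β)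
    (hQ : IsConstraint Q) (r : ℕ) {t : ℝ} (ht : t ∈ Icc (0 : ℝ) m) :
    HasMatDeriv (fun t => xiDeriv β r (Φ t)) (xiDeriv β (r + 1) (Φ t) ⊙ pathDeriv Φ t)
      (Icc (0 : ℝ) m) t := fun i j => by
  have h1 := hβ.hasDerivAt_xiEntry r i j
    ((abs_le.2 (hΦ.apply_mem hQ ht i j)).trans_lt (by norm_num))
  exact h1.comp_hasDerivWithinAt t (hΦ.hasMatDeriv ht i j)

theorem IsPath.hasMatDeriv_gradPath (hΦ : IsPath Q κ Φ) (hμ : IsOrderMeasure m μ)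
    (hβ : IsMixedEven β) (hQ : IsConstraint Q)
    (hm : (0 : ℝ) < m) (hT : topPoint m μ < T) (hTm : T ≤ m) (hdet : (Q - Φ T).PosDef)
    {t : ℝ} (ht : t ∈ Icc 0 T) :
    HasMatDeriv (gradPath β h μ Φ)
      (xiDeriv β 2 (Φ t) ⊙ pathDeriv Φ t -
        (hatPath μ Φ t)⁻¹ * pathDeriv Φ t * (hatPath μ Φ t)⁻¹) (Icc 0 T) t := by
  have h1 := (hΦ.hasMatDeriv_xiDeriv hβ hQ 1 ⟨ht.1, ht.2.trans hTm⟩).mono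
    (Icc_subset_Icc_right hTm)
  have h2 := hΦ.hasMatDeriv_responsePath hμ hm hT hTm hdet ht
  intro i j
  exact ((h1 i j).add_const (Matrix.vecMulVec h h i j)).sub (h2 i j)

theorem IsPath.isHermitian_gradPath (hΦ : IsPath Q κ Φ) (hμ : IsOrderMeasure m μ)
    (hβ : IsMixedEven β) (hQ : IsConstraint Q)
    (hm : (0 : ℝ) < m) (hT : topPoint m μ < T) (hTm : T ≤ m) (hdet : (Q - Φ T).PosDef)
    {t : ℝ} (ht : t ∈ Icc 0 T) : (gradPath β h μ Φ t).IsHermitian := by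
  have ht' : t ∈ Icc (0 : ℝ) m := ⟨ht.1, ht.2.trans hTm⟩
  refine ((hβ.posSemidef_xiDeriv 1 (hΦ.posSemidef t ht')
    (hΦ.apply_mem hQ ht')).isHermitian.add (isHermitian_of_symm fun i j => ?_)).sub
    (hΦ.isHermitian_responsePath hμ hm hT hTm hdet ht)
  simp [Matrix.vecMulVec_apply, mul_comm]

/-- ξ' vanishes at 0 because only p ≥ 2 occurs. The remaining hhᵀ is positive semidefinite, which
gives the perturbed path the right sign at time 0. -/
theorem IsPath.gradPath_zero (hΦ : IsPath Q κ Φ) (hβ : IsMixedEven β) :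
    gradPath β h μ Φ 0 = Matrix.vecMulVec h h := by
  ext i j
  simp [gradPath, responsePath_zero, hΦ.zero, xiDeriv_apply, hβ.xiEntry_one_zero]

end Gradient

end VectorSpin

namespace VectorSpin

variable {m : ℕ} {μ κ : Measure ℝ} {Q : Matrix (Fin m) (Fin m) ℝ}
  {Φ : ℝ → Matrix (Fin m) (Fin m) ℝ}

/-! ### Lipschitz bounds for products and reciprocals. -/

section Lipschitz

variable {s : Set ℝ} {f g : ℝ → ℝ}

theorem exists_lipschitzOnWith_iff :
    (∃ K, LipschitzOnWith K f s) ↔ ∃ K : ℝ, ∀ x ∈ s, ∀ y ∈ s, |f x - f y| ≤ K * |x - y| := by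
  constructor
  · rintro ⟨K, hK⟩
    exact ⟨K, fun x hx y hy => by simpa [Real.dist_eq] using hK.dist_le_mul x hx y hy⟩
  · rintro ⟨K, hK⟩
    refine ⟨K.toNNReal, LipschitzOnWith.of_dist_le_mul fun x hx y hy => ?_⟩
    rw [Real.dist_eq, Real.dist_eq]
    exact (hK x hx y hy).trans
      (mul_le_mul_of_nonneg_right (Real.le_coe_toNNReal K) (abs_nonneg _))

theorem exists_lipschitzOnWith_mul (hs : IsCompact s) (hf : ∃ K, LipschitzOnWith K f s)
    (hg : ∃ K, LipschitzOnWith K g s) : ∃ K, LipschitzOnWith K (fun t => f t * g t) s := by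
  obtain ⟨A, hA⟩ := hs.exists_bound_of_continuousOn hf.choose_spec.continuousOn
  obtain ⟨B, hB⟩ := hs.exists_bound_of_continuousOn hg.choose_spec.continuousOn
  rw [exists_lipschitzOnWith_iff] at *
  obtain ⟨K, hK⟩ := hf
  obtain ⟨L, hL⟩ := hg
  refine ⟨A * L + B * K, fun x hx y hy => ?_⟩
  have h1 := hK x hx y hy
  have h2 := hL x hx y hy
  have h3 : |f x| ≤ A := hA x hx
  have h4 : |g y| ≤ B := hB y hy
  calc |f x * g x - f y * g y| = |f x * (g x - g y) + g y * (f x - f y)| := by ring_nf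
    _ ≤ |f x| * |g x - g y| + |g y| * |f x - f y| := by
        rw [← abs_mul, ← abs_mul]; exact abs_add_le _ _
    _ ≤ A * (L * |x - y|) + B * (K * |x - y|) := by
        gcongr
        · exact (abs_nonneg _).trans h3
        · exact (abs_nonneg _).trans h4
    _ = (A * L + B * K) * |x - y| := by ring

theorem exists_lipschitzOnWith_inv {c : ℝ} (hc : 0 < c) (hcf : ∀ t ∈ s, c ≤ f t)
    (hf : ∃ K, LipschitzOnWith K f s) : ∃ K, LipschitzOnWith K (fun t => (f t)⁻¹) s := by
  rw [exists_lipschitzOnWith_iff] at *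
  obtain ⟨K, hK⟩ := hf
  refine ⟨(c * c)⁻¹ * K, fun x hx y hy => ?_⟩
  have hx' := hc.trans_le (hcf x hx)
  have hy' := hc.trans_le (hcf y hy)
  rw [inv_sub_inv hx'.ne' hy'.ne', abs_div, abs_sub_comm, abs_of_pos (mul_pos hx' hy'),
    div_eq_inv_mul, mul_assoc]
  exact mul_le_mul (inv_anti₀ (mul_pos hc hc) (mul_le_mul (hcf x hx) (hcf y hy) hc.le hx'.le))
    (hK x hx y hy) (abs_nonneg _) (by positivity)

theorem exists_uniform_lipschitz {F : ℝ → Matrix (Fin m) (Fin m) ℝ}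
    (hF : ∀ i j, ∃ K, LipschitzOnWith K (fun t => F t i j) s) :
    ∃ K, ∀ i j, LipschitzOnWith K (fun t => F t i j) s := by
  choose K hK using hF
  refine ⟨∑ i, ∑ j, K i j, fun i j => (hK i j).weaken ?_⟩
  exact (Finset.single_le_sum (f := fun j => K i j) (fun _ _ => zero_le)
    (Finset.mem_univ j)).trans
    (Finset.single_le_sum (f := fun i => ∑ j, K i j) (fun _ _ => zero_le) (Finset.mem_univ i))

end Lipschitz

/-- A time change of `[0,m]` of class `C^{1,1}` with derivative bounded below. -/
structure IsTimeChange (m : ℕ) (τ : ℝ ≃o ℝ) (τ' : ℝ → ℝ) : Prop where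
  pos : (0 : ℝ) < m
  map_zero : τ 0 = 0
  map_top : τ m = m
  hasDeriv : ∀ t ∈ Icc (0 : ℝ) m, HasDerivWithinAt τ (τ' t) (Icc (0 : ℝ) m) t
  bounded_below : ∃ c > 0, ∀ t ∈ Icc (0 : ℝ) m, c ≤ τ' t
  lipschitz : ∃ K, LipschitzOnWith K τ' (Icc (0 : ℝ) m)

/-! ### Reparametrization invariance of the minimization problem. -/

namespace IsTimeChange

variable {τ : ℝ ≃o ℝ} {τ' : ℝ → ℝ}

theorem deriv_pos (hτ : IsTimeChange m τ τ') {t : ℝ} (ht : t ∈ Icc (0 : ℝ) m) : 0 < τ' t := by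
  obtain ⟨c, hc, h⟩ := hτ.bounded_below
  exact hc.trans_le (h t ht)

theorem symm_zero (hτ : IsTimeChange m τ τ') : τ.symm 0 = 0 := by
  rw [OrderIso.symm_apply_eq, hτ.map_zero]

theorem symm_top (hτ : IsTimeChange m τ τ') : τ.symm m = m := by
  rw [OrderIso.symm_apply_eq, hτ.map_top]

theorem mem_iff (hτ : IsTimeChange m τ τ') {t : ℝ} : τ t ∈ Icc (0 : ℝ) m ↔ t ∈ Icc (0 : ℝ) m := by
  have h0 : 0 ≤ τ t ↔ 0 ≤ t := by conv_lhs => rw [← hτ.map_zero, τ.le_iff_le]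
  have h1 : τ t ≤ m ↔ t ≤ m := by conv_lhs => rw [← hτ.map_top, τ.le_iff_le]
  rw [mem_Icc, mem_Icc, h0, h1]

theorem symm_mem (hτ : IsTimeChange m τ τ') {s : ℝ} (hs : s ∈ Icc (0 : ℝ) m) :
    τ.symm s ∈ Icc (0 : ℝ) m := by
  rwa [← hτ.mem_iff, τ.apply_symm_apply]

/-- Slopes of the inverse are reciprocals of slopes of τ, and τ' does not vanish. -/
theorem hasDerivWithinAt_symm (hτ : IsTimeChange m τ τ') {s : ℝ} (hs : s ∈ Icc (0 : ℝ) m) :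
    HasDerivWithinAt τ.symm (τ' (τ.symm s))⁻¹ (Icc (0 : ℝ) m) s := by
  have h1 := hasDerivWithinAt_iff_tendsto_slope.1 (hτ.hasDeriv _ (hτ.symm_mem hs))
  have h2 : Filter.Tendsto τ.symm (nhdsWithin s (Icc (0 : ℝ) m \ {s}))
      (nhdsWithin (τ.symm s) (Icc (0 : ℝ) m \ {τ.symm s})) := by
    refine τ.symm.continuous.continuousWithinAt.tendsto_nhdsWithin fun y hy => ?_
    exact ⟨hτ.symm_mem hy.1, fun h => hy.2 (τ.symm.injective h)⟩
  rw [hasDerivWithinAt_iff_tendsto_slope]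
  refine ((h1.comp h2).inv₀ (hτ.deriv_pos (hτ.symm_mem hs)).ne').congr fun y => ?_
  simp [slope_def_field]

theorem exists_lipschitz_symm (hτ : IsTimeChange m τ τ') :
    ∃ K, LipschitzOnWith K τ.symm (Icc (0 : ℝ) m) := by
  obtain ⟨c, hc, h⟩ := hτ.bounded_below
  refine ⟨Real.toNNReal c⁻¹, (convex_Icc (0 : ℝ) m).lipschitzOnWith_of_nnnorm_hasDerivWithin_le
    (fun s hs => hτ.hasDerivWithinAt_symm hs) fun s hs => ?_⟩
  have hs' := h _ (hτ.symm_mem hs)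
  rw [← NNReal.coe_le_coe, coe_nnnorm, Real.norm_of_nonneg (by
    have := hτ.deriv_pos (hτ.symm_mem hs); positivity), Real.coe_toNNReal _ (by positivity)]
  exact inv_anti₀ hc hs'

theorem pathDeriv_comp_symm (hτ : IsTimeChange m τ τ') (hΦ : IsPath Q κ Φ) {s : ℝ}
    (hs : s ∈ Icc (0 : ℝ) m) :
    pathDeriv (fun y => Φ (τ.symm y)) s = (τ' (τ.symm s))⁻¹ • pathDeriv Φ (τ.symm s) := by
  ext i j
  have h := (hΦ.hasMatDeriv (hτ.symm_mem hs) i j).comp s (hτ.hasDerivWithinAt_symm hs)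
    fun y hy => hτ.symm_mem hy
  rw [pathDeriv, Matrix.of_apply, Matrix.smul_apply, smul_eq_mul, mul_comm]
  exact h.derivWithin (uniqueDiffOn_Icc hτ.pos s hs)

theorem smul_pathDeriv_comp_symm (hτ : IsTimeChange m τ τ') (hΦ : IsPath Q κ Φ) {t : ℝ}
    (ht : t ∈ Icc (0 : ℝ) m) :
    τ' t • pathDeriv (fun y => Φ (τ.symm y)) (τ t) = pathDeriv Φ t := by
  rw [hτ.pathDeriv_comp_symm hΦ (hτ.mem_iff.2 ht), τ.symm_apply_apply, smul_smul,
    mul_inv_cancel₀ (hτ.deriv_pos ht).ne', one_smul]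

theorem map_apply_eq (μ : Measure ℝ) (τ : ℝ ≃o ℝ) (s : Set ℝ) :
    μ.map τ s = μ (τ ⁻¹' s) :=
  τ.toHomeomorph.toMeasurableEquiv.map_apply s

theorem orderParam_map (hτ : IsTimeChange m τ τ') (μ : Measure ℝ) (t : ℝ) :
    orderParam (μ.map τ) (τ t) = orderParam μ t := by
  rw [orderParam, orderParam, measureReal_def, measureReal_def, map_apply_eq, τ.preimage_Icc,
    hτ.symm_zero, τ.symm_apply_apply]

theorem topPoint_map (hτ : IsTimeChange m τ τ') (hμ : IsOrderMeasure m μ) :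
    topPoint m (μ.map τ) = τ (topPoint m μ) := by
  have hset : {t | t ∈ Icc (0 : ℝ) m ∧ orderParam (μ.map τ) t = 1} =
      τ '' {t | t ∈ Icc (0 : ℝ) m ∧ orderParam μ t = 1} := by
    ext s
    constructor
    · rintro ⟨h1, h2⟩
      refine ⟨τ.symm s, ⟨hτ.symm_mem h1, ?_⟩, τ.apply_symm_apply s⟩
      rw [← hτ.orderParam_map, τ.apply_symm_apply, h2]
    · rintro ⟨t, ⟨h1, h2⟩, rfl⟩
      exact ⟨hτ.mem_iff.2 h1, by rw [hτ.orderParam_map, h2]⟩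
  have hne : {t | t ∈ Icc (0 : ℝ) m ∧ orderParam μ t = 1}.Nonempty :=
    ⟨(m : ℝ), ⟨Nat.cast_nonneg m, le_rfl⟩, hμ.orderParam_top⟩
  rw [topPoint, hset, topPoint, τ.map_csInf' hne ⟨0, fun t ht => ht.1.1⟩]

theorem isOrderMeasure_map (hτ : IsTimeChange m τ τ') (hμ : IsOrderMeasure m μ) :
    IsOrderMeasure m (μ.map τ) where
  isProbabilityMeasure := by
    have := hμ.isProbabilityMeasure
    exact Measure.isProbabilityMeasure_map τ.continuous.measurable.aemeasurable
  compl_eq_zero := by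
    rw [map_apply_eq, preimage_compl, τ.preimage_Icc, hτ.symm_zero, hτ.symm_top]
    exact hμ.compl_eq_zero
  orderParam_zero := by
    have h := hτ.orderParam_map μ 0
    rwa [hτ.map_zero, hμ.orderParam_zero] at h

/-- The new derivative is Φ'/τ' composed with τ⁻¹; it stays Lipschitz because τ' is Lipschitz and
bounded below. Choosing τ equal to the trace on the support restores the normalization for the image
measure. -/
theorem isPath_comp_symm (hτ : IsTimeChange m τ τ') (hΦ : IsPath Q κ Φ)
    (htr : ∀ t ∈ μ.support, (Φ t).trace = τ t) :
    IsPath Q (μ.map τ) (fun y => Φ (τ.symm y)) where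
  posSemidef s hs := hΦ.posSemidef _ (hτ.symm_mem hs)
  monotone s hs t ht hst := hΦ.monotone _ (hτ.symm_mem hs) _ (hτ.symm_mem ht)
    (τ.symm.monotone hst)
  zero := by rw [hτ.symm_zero, hΦ.zero]
  top := by rw [hτ.symm_top, hΦ.top]
  differentiable i j s hs :=
    ((hΦ.hasMatDeriv (hτ.symm_mem hs) i j).comp s (hτ.hasDerivWithinAt_symm hs)
      fun y hy => hτ.symm_mem hy).differentiableWithinAt
  lipschitz_deriv := by
    obtain ⟨c, hc, hcτ⟩ := hτ.bounded_below
    obtain ⟨K, hK⟩ := hΦ.lipschitz_deriv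
    obtain ⟨L, hL⟩ := hτ.exists_lipschitz_symm
    obtain ⟨N, hN⟩ := exists_lipschitzOnWith_inv hc hcτ hτ.lipschitz
    have hmaps : MapsTo τ.symm (Icc (0 : ℝ) m) (Icc (0 : ℝ) m) := fun s hs => hτ.symm_mem hs
    refine exists_uniform_lipschitz fun i j => ?_
    obtain ⟨M, hM⟩ := exists_lipschitzOnWith_mul isCompact_Icc ⟨_, hN.comp hL hmaps⟩
      ⟨_, (hK i j).comp hL hmaps⟩
    refine ⟨M, fun s hs t ht => ?_⟩
    have h := hM hs ht
    simp only [hτ.pathDeriv_comp_symm hΦ hs, hτ.pathDeriv_comp_symm hΦ ht]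
    exact h
  trace_eq s hs := by
    have : τ.symm s ∈ μ.support := by
      rw [Measure.mem_support_iff_forall] at hs ⊢
      intro U hU
      have h1 := hs (τ.symm ⁻¹' U) (τ.symm.continuous.continuousAt.preimage_mem_nhds hU)
      rwa [map_apply_eq, ← preimage_comp, show (τ.symm ∘ τ : ℝ → ℝ) = id from by ext; simp,
        preimage_id] at h1
    rw [htr _ this, τ.apply_symm_apply]

theorem isAdmissible (hτ : IsTimeChange m τ τ') (hμ : IsOrderMeasure m μ)
    (hΦ : IsPath Q κ Φ) (htr : ∀ t ∈ μ.support, (Φ t).trace = τ t)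
    (htop : topPoint m μ < m) (hdet : 0 < (Q - Φ (topPoint m μ)).det) :
    IsAdmissible Q (μ.map τ) (fun y => Φ (τ.symm y)) where
  isOrderMeasure := hτ.isOrderMeasure_map hμ
  isPath := hτ.isPath_comp_symm hΦ htr
  topPoint_lt := by
    rw [hτ.topPoint_map hμ]
    conv_rhs => rw [← hτ.map_top]
    exact τ.strictMono htop
  det_pos := by
    rw [hτ.topPoint_map hμ, τ.symm_apply_apply]
    exact hdet

theorem mem_cutoffs (hτ : IsTimeChange m τ τ') (hμ : IsOrderMeasure m μ) {T : ℝ}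
    (hT : T ∈ cutoffs μ Φ) : τ T ∈ cutoffs (μ.map τ) (fun y => Φ (τ.symm y)) := by
  refine ⟨?_, ?_, ?_⟩
  · rw [hτ.topPoint_map hμ]; exact τ.strictMono hT.1
  · conv_rhs => rw [← hτ.map_top]
    exact τ.strictMono hT.2.1
  · simp only [hτ.symm_top, τ.symm_apply_apply]; exact hT.2.2

theorem integral_comp (hτ : IsTimeChange m τ τ') {a b : ℝ} (ha : 0 ≤ a) (hab : a ≤ b)
    (hb : b ≤ m) (g : ℝ → ℝ) :
    ∫ s in τ a..τ b, g s = ∫ t in a..b, τ' t * g (τ t) := by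
  have hsub : Icc a b ⊆ Icc (0 : ℝ) m := Icc_subset_Icc ha hb
  rw [intervalIntegral.integral_of_le (τ.monotone hab), intervalIntegral.integral_of_le hab,
    ← integral_Icc_eq_integral_Ioc, ← integral_Icc_eq_integral_Ioc, ← τ.image_Icc,
    integral_image_eq_integral_abs_deriv_smul measurableSet_Icc
      (fun t ht => (hτ.hasDeriv t (hsub ht)).mono hsub) τ.injective.injOn]
  refine setIntegral_congr_fun measurableSet_Icc fun t ht => ?_
  simp only [smul_eq_mul, abs_of_pos (hτ.deriv_pos (hsub ht))]

/-- x dΦ is a line element: the factor τ' from the substitution cancels the one in the derivative of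
the reparametrized path. -/
theorem hatPath_map (hτ : IsTimeChange m τ τ') (hΦ : IsPath Q κ Φ) {t : ℝ}
    (ht : t ∈ Icc (0 : ℝ) m) :
    hatPath (μ.map τ) (fun y => Φ (τ.symm y)) (τ t) = hatPath μ Φ t := by
  ext i j
  simp only [hatPath, Matrix.of_apply]
  conv_lhs => rw [← hτ.map_top]
  rw [hτ.integral_comp ht.1 ht.2 le_rfl]
  refine intervalIntegral.integral_congr fun s hs => ?_
  rw [uIcc_of_le ht.2] at hs
  have hs' : s ∈ Icc (0 : ℝ) m := ⟨ht.1.trans hs.1, hs.2⟩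
  have e := congrFun (congrFun (hτ.smul_pathDeriv_comp_symm hΦ hs') i) j
  rw [Matrix.smul_apply, smul_eq_mul] at e
  simp only [hτ.orderParam_map]
  rw [← e]
  ring

theorem csFunctional_map (hτ : IsTimeChange m τ τ') (hΦ : IsPath Q κ Φ) {T : ℝ}
    (hT : T ∈ Icc (0 : ℝ) m) (β : ℕ → Fin m → ℝ) (h : Fin m → ℝ) :
    csFunctional β h (μ.map τ) (fun y => Φ (τ.symm y)) (τ T) = csFunctional β h μ Φ T := by
  have e1 : ∫ t in (0 : ℝ)..(m : ℝ), orderParam (μ.map τ) t *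
        frob (xiDeriv β 1 (Φ (τ.symm t)) + Matrix.vecMulVec h h)
          (pathDeriv (fun y => Φ (τ.symm y)) t) =
      ∫ t in (0 : ℝ)..(m : ℝ), orderParam μ t *
        frob (xiDeriv β 1 (Φ t) + Matrix.vecMulVec h h) (pathDeriv Φ t) := by
    conv_lhs => rw [← hτ.map_top, ← hτ.map_zero]
    rw [hτ.integral_comp le_rfl hτ.pos.le le_rfl]
    refine intervalIntegral.integral_congr fun s hs => ?_
    rw [uIcc_of_le hτ.pos.le] at hs
    simp only [hτ.orderParam_map, τ.symm_apply_apply]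
    rw [← hτ.smul_pathDeriv_comp_symm hΦ hs, frob_smul_right]
    ring
  have e2 : ∫ t in (0 : ℝ)..τ T, frob (hatPath (μ.map τ) (fun y => Φ (τ.symm y)) t)⁻¹
        (pathDeriv (fun y => Φ (τ.symm y)) t) =
      ∫ t in (0 : ℝ)..T, frob (hatPath μ Φ t)⁻¹ (pathDeriv Φ t) := by
    conv_lhs => rw [← hτ.map_zero]
    rw [hτ.integral_comp le_rfl hT.1 hT.2]
    refine intervalIntegral.integral_congr fun s hs => ?_
    rw [uIcc_of_le hT.1] at hs
    have hs' : s ∈ Icc (0 : ℝ) m := ⟨hs.1, hs.2.trans hT.2⟩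
    rw [hτ.hatPath_map hΦ hs', ← hτ.smul_pathDeriv_comp_symm hΦ hs', frob_smul_right]
  simp only [csFunctional]
  rw [e1, e2, hτ.symm_top, τ.symm_apply_apply]

end IsTimeChange

end VectorSpin

namespace VectorSpin

variable {m : ℕ} {μ κ κ' : Measure ℝ} {Q : Matrix (Fin m) (Fin m) ℝ}
  {Φ Φ₁ : ℝ → Matrix (Fin m) (Fin m) ℝ}

/-- The convex combination `(1 - ε) Φ + ε Φ₁` of two paths. -/
def mixPath (Φ Φ₁ : ℝ → Matrix (Fin m) (Fin m) ℝ) (ε t : ℝ) : Matrix (Fin m) (Fin m) ℝ :=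
  Φ t + ε • (Φ₁ t - Φ t)

theorem mixPath_eq (Φ Φ₁ : ℝ → Matrix (Fin m) (Fin m) ℝ) (ε t : ℝ) :
    mixPath Φ Φ₁ ε t = (1 - ε) • Φ t + ε • Φ₁ t := by
  rw [mixPath]; module

/-! ### Convex combinations of paths. -/

section Mix

theorem hasMatDeriv_mixPath (hΦ : IsPath Q κ Φ) (hΦ₁ : IsPath Q κ' Φ₁) (ε : ℝ) {t : ℝ}
    (ht : t ∈ Icc (0 : ℝ) m) :
    HasMatDeriv (mixPath Φ Φ₁ ε) (pathDeriv Φ t + ε • (pathDeriv Φ₁ t - pathDeriv Φ t))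
      (Icc (0 : ℝ) m) t :=
  (hΦ.hasMatDeriv ht).add (((hΦ₁.hasMatDeriv ht).sub (hΦ.hasMatDeriv ht)).const_smul ε)

theorem pathDeriv_mixPath (hm : (0 : ℝ) < m) (hΦ : IsPath Q κ Φ) (hΦ₁ : IsPath Q κ' Φ₁) (ε : ℝ)
    {t : ℝ} (ht : t ∈ Icc (0 : ℝ) m) :
    pathDeriv (mixPath Φ Φ₁ ε) t = pathDeriv Φ t + ε • (pathDeriv Φ₁ t - pathDeriv Φ t) := by
  ext i j
  exact (hasMatDeriv_mixPath hΦ hΦ₁ ε ht i j).derivWithin (uniqueDiffOn_Icc hm t ht)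

/-- The trace condition is in general lost. The zero measure has empty support, so it records a path
with no trace condition. -/
theorem isPath_mixPath (hm : (0 : ℝ) < m) (hΦ : IsPath Q κ Φ) (hΦ₁ : IsPath Q κ' Φ₁) {ε : ℝ}
    (hε : ε ∈ Icc (0 : ℝ) 1) : IsPath Q 0 (mixPath Φ Φ₁ ε) where
  posSemidef t ht := by
    rw [mixPath_eq]
    exact ((hΦ.posSemidef t ht).smul (sub_nonneg.2 hε.2)).add ((hΦ₁.posSemidef t ht).smul hε.1)
  monotone s hs t ht hst := by
    have e : mixPath Φ Φ₁ ε t - mixPath Φ Φ₁ ε s =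
        (1 - ε) • (Φ t - Φ s) + ε • (Φ₁ t - Φ₁ s) := by
      rw [mixPath_eq, mixPath_eq]; module
    rw [e]
    exact ((hΦ.monotone s hs t ht hst).smul (sub_nonneg.2 hε.2)).add
      ((hΦ₁.monotone s hs t ht hst).smul hε.1)
  zero := by simp [mixPath, hΦ.zero, hΦ₁.zero]
  top := by simp [mixPath, hΦ.top, hΦ₁.top]
  differentiable i j t ht := (hasMatDeriv_mixPath hΦ hΦ₁ ε ht i j).differentiableWithinAt
  lipschitz_deriv := by
    obtain ⟨K, hK⟩ := hΦ.lipschitz_deriv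
    obtain ⟨L, hL⟩ := hΦ₁.lipschitz_deriv
    refine exists_uniform_lipschitz fun i j => ?_
    obtain ⟨N, hN⟩ := exists_lipschitzOnWith_mul isCompact_Icc
      (f := fun _ => ε) ⟨0, (LipschitzWith.const ε).lipschitzOnWith⟩ ⟨_, (hL i j).sub (hK i j)⟩
    refine ⟨K + N, fun s hs t ht => ?_⟩
    have h := ((hK i j).add hN) hs ht
    simp only [pathDeriv_mixPath hm hΦ hΦ₁ ε hs, pathDeriv_mixPath hm hΦ hΦ₁ ε ht]
    exact h
  trace_eq := by simp

theorem posDef_sub_mixPath (hΦ₁ : IsPath Q κ' Φ₁) {ε t : ℝ} (ht : t ∈ Icc (0 : ℝ) m)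
    (hε : 0 ≤ ε) (hε1 : ε < 1) (h : (Q - Φ t).PosDef) : (Q - mixPath Φ Φ₁ ε t).PosDef := by
  have e : Q - mixPath Φ Φ₁ ε t = (1 - ε) • (Q - Φ t) + ε • (Q - Φ₁ t) := by
    rw [mixPath_eq]; module
  have h1 := hΦ₁.monotone t ht m ⟨ht.1.trans ht.2, le_rfl⟩ ht.2
  rw [hΦ₁.top] at h1
  rw [e]
  exact (h.smul (sub_pos.2 hε1)).add_posSemidef (h1.smul hε)

theorem IsPath.posDef_sub (hΦ : IsPath Q κ Φ) {t : ℝ} (ht : t ∈ Icc (0 : ℝ) m)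
    (hdet : 0 < (Q - Φ t).det) : (Q - Φ t).PosDef := by
  have h1 := hΦ.monotone t ht m ⟨ht.1.trans ht.2, le_rfl⟩ ht.2
  rw [hΦ.top] at h1
  exact h1.posDef_iff_det_ne_zero.2 hdet.ne'

end Mix

/-! ### Minimality against paths without trace normalization. -/

section TimeChange

/-- A small `C^{1,1}` perturbation of the identity vanishing at the endpoints is a time change. -/
theorem exists_timeChange (hm : (0 : ℝ) < m) {e e' : ℝ → ℝ}
    (he : ∀ t ∈ Icc (0 : ℝ) m, HasDerivWithinAt e (e' t) (Icc (0 : ℝ) m) t)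
    (he0 : e 0 = 0) (hem : e m = 0) (hbd : ∀ t ∈ Icc (0 : ℝ) m, |e' t| ≤ 1 / 2)
    (hlip : ∃ K, LipschitzOnWith K e' (Icc (0 : ℝ) m)) :
    ∃ τ : ℝ ≃o ℝ, IsTimeChange m τ (fun t => 1 + e' t) ∧
      ∀ t ∈ Icc (0 : ℝ) m, τ t = t + e t := by
  -- Clamping to [0,m] extends t + e(t) by the identity, so that it becomes an order isomorphism of
  -- the whole line.
  let p : ℝ → ℝ := fun t => max 0 (min t m)
  have hp : ∀ t, p t ∈ Icc (0 : ℝ) m := fun t =>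
    ⟨le_max_left _ _, max_le hm.le (min_le_right _ _)⟩
  have hpid : ∀ t ∈ Icc (0 : ℝ) m, p t = t := fun t ht => by
    simp only [p]; rw [min_eq_left ht.2, max_eq_right ht.1]
  have hplip : ∀ s t, |p t - p s| ≤ |t - s| := fun s t => by
    calc |p t - p s| ≤ max |(0 : ℝ) - 0| |min t (m : ℝ) - min s m| := abs_max_sub_max_le_max _ _ _ _
      _ ≤ |t - s| := by
        rw [sub_self, abs_zero]
        refine max_le (abs_nonneg _) ((abs_min_sub_min_le_max _ _ _ _).trans ?_)
        simp
  have heLip : ∀ s ∈ Icc (0 : ℝ) m, ∀ t ∈ Icc (0 : ℝ) m, |e t - e s| ≤ 1 / 2 * |t - s| :=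
    fun s hs t ht => (convex_Icc (0 : ℝ) m).norm_image_sub_le_of_norm_hasDerivWithin_le he
      (fun x hx => hbd x hx) hs ht
  let f : ℝ → ℝ := fun t => t + e (p t)
  have hfid : ∀ t ∈ Icc (0 : ℝ) m, f t = t + e t := fun t ht => by simp only [f]; rw [hpid t ht]
  have hdiff : ∀ s t, |e (p t) - e (p s)| ≤ 1 / 2 * |t - s| := fun s t =>
    (heLip _ (hp s) _ (hp t)).trans (mul_le_mul_of_nonneg_left (hplip s t) (by norm_num))
  have hmono : StrictMono f := fun s t hst => by
    have h := (abs_le.1 (hdiff s t)).1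
    rw [abs_of_pos (sub_pos.2 hst)] at h
    simp only [f]
    linarith
  have hcont : Continuous f := by
    refine continuous_id.add ?_
    have : LipschitzWith (1 / 2) fun t => e (p t) := LipschitzWith.of_dist_le_mul fun t s => by
      simpa [Real.dist_eq] using hdiff s t
    exact this.continuous
  have htop : ∀ t, (m : ℝ) ≤ t → f t = t := fun t ht => by
    have : p t = m := by simp only [p]; rw [min_eq_right ht, max_eq_right hm.le]
    simp only [f]; rw [this, hem, add_zero]
  have hbot : ∀ t, t ≤ 0 → f t = t := fun t ht => by
    have : p t = 0 := by simp only [p]; rw [min_eq_left (ht.trans hm.le), max_eq_left ht]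
    simp only [f]; rw [this, he0, add_zero]
  have hsurj : Function.Surjective f := by
    refine hcont.surjective ?_ ?_
    · refine Filter.tendsto_id.congr' ?_
      filter_upwards [Filter.eventually_ge_atTop (m : ℝ)] with t ht using (htop t ht).symm
    · refine Filter.tendsto_id.congr' ?_
      filter_upwards [Filter.eventually_le_atBot (0 : ℝ)] with t ht using (hbot t ht).symm
  refine ⟨hmono.orderIsoOfSurjective f hsurj, ⟨hm, hbot 0 le_rfl, htop m le_rfl, fun t ht => ?_,
    ⟨1 / 2, by norm_num, fun t ht => ?_⟩, ?_⟩, hfid⟩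
  · exact ((hasDerivWithinAt_id t _).add (he t ht)).congr (fun s hs => hfid s hs) (hfid t ht)
  · linarith [(abs_le.1 (hbd t ht)).1]
  · obtain ⟨K, hK⟩ := hlip
    exact ⟨_, (LipschitzWith.const (1 : ℝ)).lipschitzOnWith.add hK⟩

theorem HasMatDeriv.trace {F : ℝ → Matrix (Fin m) (Fin m) ℝ} {F' : Matrix (Fin m) (Fin m) ℝ}
    {s : Set ℝ} {t : ℝ} (hF : HasMatDeriv F F' s t) :
    HasDerivWithinAt (fun y => (F y).trace) F'.trace s t :=
  HasDerivWithinAt.fun_sum fun i _ => hF i i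

theorem exists_lipschitzOnWith_sum {s : Set ℝ} {f : Fin m → ℝ → ℝ}
    (hf : ∀ i, ∃ K, LipschitzOnWith K (f i) s) :
    ∃ K, LipschitzOnWith K (fun t => ∑ i, f i t) s := by
  choose K hK using hf
  rw [exists_lipschitzOnWith_iff]
  refine ⟨∑ i, (K i : ℝ), fun x hx y hy => ?_⟩
  rw [← Finset.sum_sub_distrib, Finset.sum_mul]
  refine (Finset.abs_sum_le_sum_abs _ _).trans (Finset.sum_le_sum fun i _ => ?_)
  simpa [Real.dist_eq] using (hK i).dist_le_mul x hx y hy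

theorem IsPath.exists_lipschitz_trace (hΦ : IsPath Q κ Φ) :
    ∃ K, LipschitzOnWith K (fun t => (pathDeriv Φ t).trace) (Icc (0 : ℝ) m) := by
  obtain ⟨K, hK⟩ := hΦ.lipschitz_deriv
  exact exists_lipschitzOnWith_sum fun i => ⟨K, hK i i⟩

/-- Minimality against convex combinations with an arbitrary path, without trace normalization. -/
theorem IsMinimizer.eventually_le_mixPath {β : ℕ → Fin m → ℝ} {h : Fin m → ℝ}
    (hmin : IsMinimizer β h Q μ Φ) (hm : (0 : ℝ) < m) (hΦ₁ : IsPath Q κ Φ₁) {T : ℝ}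
    (hT : T ∈ cutoffs μ Φ) :
    ∀ᶠ ε in nhdsWithin 0 (Ioi 0),
      csFunctional β h μ Φ T ≤ csFunctional β h μ (mixPath Φ Φ₁ ε) T := by
  obtain ⟨⟨hμ, hΦ, htop, hdet⟩, hle⟩ := hmin
  obtain ⟨K, hK⟩ := hΦ₁.exists_lipschitz_trace
  obtain ⟨L, hL⟩ := hΦ.exists_lipschitz_trace
  have hlip := hK.sub hL
  obtain ⟨C, hC⟩ := isCompact_Icc.exists_bound_of_continuousOn hlip.continuousOn
  have hmem : (m : ℝ) ∈ Icc (0 : ℝ) m := ⟨hm.le, le_rfl⟩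
  have hC0 : 0 ≤ C := (norm_nonneg _).trans (hC m hmem)
  have hTmem : T ∈ Icc (0 : ℝ) m := ⟨(topPoint_nonneg m μ).trans hT.1.le, hT.2.1.le⟩
  have htopmem : topPoint m μ ∈ Icc (0 : ℝ) m := ⟨topPoint_nonneg m μ, htop.le⟩
  -- This threshold gives both ε < 1 and |τ' - 1| ≤ εC ≤ 1/2.
  have hpos : (0 : ℝ) < 1 / (2 * (C + 1)) := by positivity
  filter_upwards [Ioo_mem_nhdsGT hpos] with ε hε
  have hε2 : ε * (C + 1) ≤ 1 / 2 := by
    have := (lt_div_iff₀ (by positivity)).1 hε.2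
    linarith
  have hε1 : ε < 1 := by nlinarith [hε.1]
  have hε' : ε ∈ Icc (0 : ℝ) 1 := ⟨hε.1.le, hε1.le⟩
  have hmix := isPath_mixPath hm hΦ hΦ₁ hε'
  -- On supp μ, where Trace Φ(t) = t, τ(t) is the trace of the mixed path; elsewhere the formula is
  -- a smooth enough extension fixing 0 and m.
  obtain ⟨τ, hτ, hτe⟩ := exists_timeChange hm (e := fun t => ε * ((Φ₁ t).trace - (Φ t).trace))
    (e' := fun t => ε * ((pathDeriv Φ₁ t).trace - (pathDeriv Φ t).trace))
    (fun t ht => ((hΦ₁.hasMatDeriv ht).trace.sub (hΦ.hasMatDeriv ht).trace).const_mul ε)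
    (by simp [hΦ.zero, hΦ₁.zero]) (by simp [hΦ.top, hΦ₁.top])
    (fun t ht => by
      rw [abs_mul, abs_of_pos hε.1]
      have h1 : |(pathDeriv Φ₁ t).trace - (pathDeriv Φ t).trace| ≤ C := hC t ht
      nlinarith [hε.1])
    (exists_lipschitzOnWith_mul isCompact_Icc (f := fun _ => ε)
      ⟨0, (LipschitzWith.const ε).lipschitzOnWith⟩ ⟨_, hlip⟩)
  have htr : ∀ t ∈ μ.support, (mixPath Φ Φ₁ ε t).trace = τ t := fun t ht => by
    have ht' := hμ.support_subset ht
    rw [hτe t ⟨ht'.1, ht'.2.trans htop.le⟩, mixPath]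
    simp only [Matrix.trace_add, Matrix.trace_smul, Matrix.trace_sub, smul_eq_mul]
    rw [hΦ.trace_eq t ht]
  have hadm := hτ.isAdmissible hμ hmix htr htop
    (posDef_sub_mixPath hΦ₁ htopmem hε.1.le hε1 (hΦ.posDef_sub htopmem hdet)).det_pos
  have hT' : T ∈ cutoffs μ (mixPath Φ Φ₁ ε) := by
    refine ⟨hT.1, hT.2.1, ?_⟩
    have h1 := hT.2.2
    rw [hΦ.top] at h1
    rw [hmix.top]
    exact (posDef_sub_mixPath hΦ₁ hTmem hε.1.le hε1 (hΦ.posDef_sub hTmem h1)).det_pos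
  have := hle _ _ hadm T hT _ (hτ.mem_cutoffs hμ hT')
  rwa [hτ.csFunctional_map hmix hTmem] at this

end TimeChange

end VectorSpin

namespace VectorSpin

variable {m : ℕ} {μ κ κ' : Measure ℝ} {Q : Matrix (Fin m) (Fin m) ℝ}
  {Φ Φ₁ : ℝ → Matrix (Fin m) (Fin m) ℝ} {β : ℕ → Fin m → ℝ} {h : Fin m → ℝ} {T : ℝ}

/-! ### The energy part of the functional. -/

section Potential

/-- The potential `∑ ξ(A) + ⟨h, A h⟩` whose gradient is `ξ'(A) + h hᵀ`. -/
noncomputable def potential (β : ℕ → Fin m → ℝ) (h : Fin m → ℝ) (A : Matrix (Fin m) (Fin m) ℝ) :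
    ℝ :=
  ∑ i, ∑ j, (xiEntry β 0 i j (A i j) + h i * h j * A i j)

theorem IsMixedEven.hasDerivWithinAt_potential (hβ : IsMixedEven β)
    {F : ℝ → Matrix (Fin m) (Fin m) ℝ} {F' : Matrix (Fin m) (Fin m) ℝ} {s : Set ℝ} {t : ℝ}
    (hF : HasMatDeriv F F' s t) (hlt : ∀ i j, |F t i j| < 3 / 2) :
    HasDerivWithinAt (fun y => potential β h (F y))
      (frob (xiDeriv β 1 (F t) + Matrix.vecMulVec h h) F') s t := by
  refine HasDerivWithinAt.fun_sum fun i _ => HasDerivWithinAt.fun_sum fun j _ => ?_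
  have h1 := (hβ.hasDerivAt_xiEntry 0 i j (hlt i j)).comp_hasDerivWithinAt t (hF i j)
  refine (h1.add ((hF i j).const_mul (h i * h j))).congr_deriv ?_
  rw [Matrix.add_apply, xiDeriv_apply, Matrix.vecMulVec_apply, add_mul]

theorem IsMixedEven.exists_bound_xiEntry (hβ : IsMixedEven β) (r : ℕ) (i j : Fin m) :
    ∃ B, ∀ y, |y| < 3 / 2 → |xiEntry β r i j y| ≤ B := by
  obtain ⟨w, hw, hb⟩ := hβ.exists_summable_bound r i j
  exact ⟨∑' p, w p, fun y hy =>
    tsum_of_norm_bounded hw.hasSum fun p => hb p y (by simpa using hy)⟩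

theorem IsPath.continuousOn_xiDeriv (hΦ : IsPath Q κ Φ) (hβ : IsMixedEven β)
    (hQ : IsConstraint Q) (r : ℕ) :
    ContinuousOn (fun t => xiDeriv β r (Φ t)) (Icc (0 : ℝ) m) := fun _ ht =>
  (hΦ.hasMatDeriv_xiDeriv hβ hQ r ht).continuousWithinAt

/-- The energy integrand is x times the derivative of the potential along Φ. After integration by
parts it depends on the values of Φ only, so its variation needs no derivative of the direction. -/
theorem IsPath.csFunctional_eq (hΦ : IsPath Q κ Φ) (hμ : IsOrderMeasure m μ)
    (hβ : IsMixedEven β) (hQ : IsConstraint Q) (T : ℝ) :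
    2 * csFunctional β h μ Φ T = potential β h Q - (∫ t, potential β h (Φ t) ∂μ)
      + Real.log (Q - Φ T).det + ∫ t in (0 : ℝ)..T, frob (hatPath μ Φ t)⁻¹ (pathDeriv Φ t) := by
  have hlt : ∀ t ∈ Icc (0 : ℝ) m, ∀ i j, |Φ t i j| < 3 / 2 := fun t ht i j =>
    (abs_le.2 (hΦ.apply_mem hQ ht i j)).trans_lt (by norm_num)
  have key := hμ.integral_orderParam_mul (Nat.cast_nonneg m) hμ.orderParam_top
    (f := fun t => potential β h (Φ t))
    (f' := fun t => frob (xiDeriv β 1 (Φ t) + Matrix.vecMulVec h h) (pathDeriv Φ t))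
    (fun t ht => (hβ.hasDerivWithinAt_potential (hΦ.hasMatDeriv ht) (hlt t ht)).continuousWithinAt)
    (continuousOn_frob ((hΦ.continuousOn_xiDeriv hβ hQ 1).add continuousOn_const)
      hΦ.continuousOn_pathDeriv)
    (fun t ht => hβ.hasDerivWithinAt_potential (hΦ.hasMatDeriv_right ht)
      (hlt t ⟨ht.1, ht.2.le⟩))
  rw [csFunctional, key, hΦ.top]
  ring

theorem hasDerivAt_integral_potential (hΦ : IsPath Q κ Φ) (hΦ₁ : IsPath Q κ' Φ₁)
    (hμ : IsOrderMeasure m μ) (hβ : IsMixedEven β) (hQ : IsConstraint Q) :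
    HasDerivAt (fun ε => ∫ t, potential β h (mixPath Φ Φ₁ ε t) ∂μ)
      (∫ t, frob (xiDeriv β 1 (Φ t) + Matrix.vecMulVec h h) (Φ₁ t - Φ t) ∂μ) 0 := by
  have := hμ.isProbabilityMeasure
  have hmem : ∀ᵐ t ∂μ, t ∈ Icc (0 : ℝ) m := hμ.ae_mem_Icc hμ.orderParam_top
  have hδ : ∀ t ∈ Icc (0 : ℝ) m, ∀ i j, |(Φ₁ t - Φ t) i j| ≤ 2 := fun t ht i j => by
    have h1 := hΦ.apply_mem hQ ht i j
    have h2 := hΦ₁.apply_mem hQ ht i j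
    rw [Matrix.sub_apply, abs_le]
    constructor <;> linarith [h1.1, h1.2, h2.1, h2.2]
  -- Entries of Φ are at most 1 and those of Φ₁ - Φ at most 2 in absolute value, so |ε| < 1/4 keeps
  -- the mixture strictly within radius 3/2.
  have hlt : ∀ ε ∈ Metric.ball (0 : ℝ) (1 / 4), ∀ t ∈ Icc (0 : ℝ) m, ∀ i j,
      |mixPath Φ Φ₁ ε t i j| < 3 / 2 := fun ε hε t ht i j => by
    have hε' : |ε| < 1 / 4 := by simpa using hε
    have h1 := abs_le.2 (hΦ.apply_mem hQ ht i j)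
    have h2 := hδ t ht i j
    rw [mixPath, Matrix.add_apply, Matrix.smul_apply, smul_eq_mul]
    have h3 : |ε * (Φ₁ t - Φ t) i j| ≤ |ε| * 2 := by
      rw [abs_mul]; exact mul_le_mul_of_nonneg_left h2 (abs_nonneg _)
    exact (abs_add_le _ _).trans_lt (by linarith)
  have hcont : ∀ ε ∈ Metric.ball (0 : ℝ) (1 / 4),
      ContinuousOn (fun t => potential β h (mixPath Φ Φ₁ ε t)) (Icc (0 : ℝ) m) :=
    fun ε hε t ht => (hβ.hasDerivWithinAt_potential (hasMatDeriv_mixPath hΦ hΦ₁ ε ht)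
      (hlt ε hε t ht)).continuousWithinAt
  have h0 : (0 : ℝ) ∈ Metric.ball (0 : ℝ) (1 / 4) := by simp
  have hmix0 : ∀ t, mixPath Φ Φ₁ 0 t = Φ t := fun t => by simp [mixPath]
  choose B hB using hβ.exists_bound_xiEntry 1
  have hF'c : ContinuousOn
      (fun t => frob (xiDeriv β 1 (Φ t) + Matrix.vecMulVec h h) (Φ₁ t - Φ t)) (Icc (0 : ℝ) m) :=
    continuousOn_frob ((hΦ.continuousOn_xiDeriv hβ hQ 1).add continuousOn_const)
      (hΦ₁.continuousOn.sub hΦ.continuousOn)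
  have key := hasDerivAt_integral_of_dominated_loc_of_deriv_le (μ := μ)
    (F := fun ε t => potential β h (mixPath Φ Φ₁ ε t))
    (F' := fun ε t => frob (xiDeriv β 1 (mixPath Φ Φ₁ ε t) + Matrix.vecMulVec h h)
      (Φ₁ t - Φ t)) (x₀ := 0) (bound := fun _ => ∑ i, ∑ j, (B i j + |h i * h j|) * 2)
    (Metric.ball_mem_nhds (0 : ℝ) (by norm_num : (0 : ℝ) < 1 / 4))
    (by
      filter_upwards [Metric.ball_mem_nhds (0 : ℝ) (by norm_num : (0 : ℝ) < 1 / 4)] with ε hε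
      exact (hμ.integrable_of_continuousOn hμ.orderParam_top (hcont ε hε)).aestronglyMeasurable)
    (hμ.integrable_of_continuousOn hμ.orderParam_top (hcont 0 h0))
    (by
      simp only [hmix0]
      exact (hμ.integrable_of_continuousOn hμ.orderParam_top hF'c).aestronglyMeasurable)
    (by
      filter_upwards [hmem] with t ht ε hε
      refine (Finset.abs_sum_le_sum_abs _ _).trans (Finset.sum_le_sum fun i _ => ?_)
      refine (Finset.abs_sum_le_sum_abs _ _).trans (Finset.sum_le_sum fun j _ => ?_)
      rw [abs_mul, Matrix.add_apply, xiDeriv_apply, Matrix.vecMulVec_apply]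
      have hb := hB i j _ (hlt ε hε t ht i j)
      refine mul_le_mul ((abs_add_le _ _).trans (by linarith)) (hδ t ht i j) (abs_nonneg _) ?_
      linarith [abs_nonneg (xiEntry β 1 i j (mixPath Φ Φ₁ ε t i j)), abs_nonneg (h i * h j)])
    (integrable_const _)
    (by
      filter_upwards [hmem] with t ht ε hε
      rw [← hasDerivWithinAt_univ]
      refine hβ.hasDerivWithinAt_potential (F := fun ε => mixPath Φ Φ₁ ε t) (fun i j => ?_)
        (hlt ε hε t ht)
      have := (((hasDerivAt_id ε).mul_const ((Φ₁ t - Φ t) i j)).const_add (Φ t i j))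
      rw [one_mul] at this
      exact this.hasDerivWithinAt)
  simpa only [hmix0] using key.2

end Potential

/-! ### Derivative of log det. -/

section LogDet

theorem hasDerivAt_det_one_add_smul (M : Matrix (Fin m) (Fin m) ℝ) :
    HasDerivAt (fun ε : ℝ => (1 + ε • M).det) M.trace 0 := by
  set q := (1 + (Polynomial.X : Polynomial ℝ) • M.map Polynomial.C).det.divX.divX with hq
  have e : (fun ε : ℝ => (1 + ε • M).det) = fun ε => 1 + M.trace * ε + q.eval ε * ε ^ 2 :=
    funext fun ε => Matrix.det_one_add_smul ε M
  rw [e]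
  have h1 := (((hasDerivAt_id (0 : ℝ)).const_mul M.trace).const_add 1).add
    ((q.hasDerivAt 0).mul (hasDerivAt_pow 2 (0 : ℝ)))
  refine h1.congr_deriv ?_
  simp

theorem hasDerivAt_log_det {A : Matrix (Fin m) (Fin m) ℝ} (hA : A.PosDef)
    (B : Matrix (Fin m) (Fin m) ℝ) :
    HasDerivAt (fun ε : ℝ => Real.log (A + ε • B).det) (frob A⁻¹ B) 0 := by
  have e : ∀ ε : ℝ, (A + ε • B).det = A.det * (1 + ε • (A⁻¹ * B)).det := fun ε => by
    rw [← Matrix.det_mul, mul_add, mul_one, Matrix.mul_smul, ← mul_assoc, posDef_mul_inv hA,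
      one_mul]
  simp only [e]
  have h1 := ((hasDerivAt_det_one_add_smul (A⁻¹ * B)).const_mul A.det).log
    (by simpa using hA.det_pos.ne')
  refine h1.congr_deriv ?_
  rw [zero_smul, add_zero, Matrix.det_one, mul_one, mul_div_cancel_left₀ _ hA.det_pos.ne',
    frob_eq_trace, transpose_eq hA.inv.isHermitian]

end LogDet

/-! ### Expansion of the resolvent integral. -/

section Entropy

theorem hatPath_mixPath (hm : (0 : ℝ) < m) (hΦ : IsPath Q κ Φ) (hΦ₁ : IsPath Q κ' Φ₁)
    (hμ : IsOrderMeasure m μ) (ε : ℝ) {t : ℝ} (ht : t ∈ Icc (0 : ℝ) m) :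
    hatPath μ (mixPath Φ Φ₁ ε) t =
      hatPath μ Φ t + ε • (hatPath μ Φ₁ t - hatPath μ Φ t) := by
  have hmem : (m : ℝ) ∈ Icc (0 : ℝ) m := ⟨hm.le, le_rfl⟩
  ext i j
  simp only [hatPath, Matrix.of_apply, Matrix.add_apply, Matrix.smul_apply, Matrix.sub_apply,
    smul_eq_mul]
  rw [← intervalIntegral.integral_sub (hΦ₁.intervalIntegrable hμ i j ht hmem)
      (hΦ.intervalIntegrable hμ i j ht hmem), ← intervalIntegral.integral_const_mul,
    ← intervalIntegral.integral_add (hΦ.intervalIntegrable hμ i j ht hmem)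
      (((hΦ₁.intervalIntegrable hμ i j ht hmem).sub
        (hΦ.intervalIntegrable hμ i j ht hmem)).const_mul ε)]
  refine intervalIntegral.integral_congr fun s hs => ?_
  have hs' := uIcc_subset_Icc ht hmem hs
  simp only [pathDeriv_mixPath hm hΦ hΦ₁ ε hs', Matrix.add_apply, Matrix.smul_apply,
    Matrix.sub_apply, smul_eq_mul]
  ring

/-- The left and the right resolvent identity, one substituted into the other. The expansion is
exact, so its remainder can be bounded uniformly in t and ε. -/
theorem inv_add_smul_expand {A B : Matrix (Fin m) (Fin m) ℝ} {ε : ℝ} (hA : A.PosDef)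
    (hε : (A + ε • B).PosDef) :
    (A + ε • B)⁻¹ = A⁻¹ - ε • (A⁻¹ * B * A⁻¹) +
      ε ^ 2 • (A⁻¹ * B * (A + ε • B)⁻¹ * B * A⁻¹) := by
  set N := (A + ε • B)⁻¹ with hN
  have h1 : N = A⁻¹ - ε • (A⁻¹ * B * N) := by
    have : A⁻¹ * (A + ε • B) * N = A⁻¹ := by
      rw [mul_assoc, hN, posDef_mul_inv hε, mul_one]
    rw [mul_add, posDef_inv_mul hA, add_mul, one_mul, Matrix.mul_smul, Matrix.smul_mul] at this
    exact eq_sub_of_add_eq this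
  have h2 : N = A⁻¹ - ε • (N * B * A⁻¹) := by
    have : N * ((A + ε • B) * A⁻¹) = A⁻¹ := by
      rw [← mul_assoc, hN, posDef_inv_mul hε, one_mul]
    rw [add_mul, posDef_mul_inv hA, mul_add, mul_one, Matrix.smul_mul, Matrix.mul_smul,
      ← mul_assoc] at this
    exact eq_sub_of_add_eq this
  calc N = A⁻¹ - ε • (A⁻¹ * B * N) := h1
    _ = A⁻¹ - ε • (A⁻¹ * B * (A⁻¹ - ε • (N * B * A⁻¹))) := by rw [← h2]
    _ = _ := by
      rw [mul_sub, Matrix.mul_smul, smul_sub, smul_smul, ← sq]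
      simp only [mul_assoc]
      abel

/-- Derivative in `ε` of `∫_0^T ⟨R_ε⁻¹, D_ε⟩` for affine families `R_ε`, `D_ε`. -/
theorem tendsto_slope_integral_frob_inv {R ρ D δ : ℝ → Matrix (Fin m) (Fin m) ℝ} (hT : 0 ≤ T)
    (hR : ContinuousOn R (Icc 0 T)) (hρ : ContinuousOn ρ (Icc 0 T))
    (hD : ContinuousOn D (Icc 0 T)) (hδ : ContinuousOn δ (Icc 0 T))
    (hpos : ∀ ε ∈ Icc (0 : ℝ) (1 / 2), ∀ t ∈ Icc 0 T, (R t + ε • ρ t).PosDef) :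
    Filter.Tendsto (fun ε => ((∫ t in (0 : ℝ)..T, frob (R t + ε • ρ t)⁻¹ (D t + ε • δ t)) -
        ∫ t in (0 : ℝ)..T, frob (R t)⁻¹ (D t)) / ε) (nhdsWithin 0 (Ioi 0))
      (nhds (∫ t in (0 : ℝ)..T, (frob (R t)⁻¹ (δ t) - frob ((R t)⁻¹ * ρ t * (R t)⁻¹) (D t)))) := by
  have h0 : (0 : ℝ) ∈ Icc (0 : ℝ) (1 / 2) := ⟨le_rfl, by norm_num⟩
  have hR0 : ∀ t ∈ Icc 0 T, (R t).PosDef := fun t ht => by simpa using hpos 0 h0 t ht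
  have hfst : ContinuousOn (fun q : ℝ × ℝ => q.1) (Icc (0 : ℝ) (1 / 2) ×ˢ Icc 0 T) :=
    continuousOn_fst
  have hcomp : ∀ {F : ℝ → Matrix (Fin m) (Fin m) ℝ}, ContinuousOn F (Icc 0 T) →
      ContinuousOn (fun q : ℝ × ℝ => F q.2) (Icc (0 : ℝ) (1 / 2) ×ˢ Icc 0 T) := fun hF =>
    hF.comp continuousOn_snd fun q hq => hq.2
  have hinv : ContinuousOn (fun q : ℝ × ℝ => (R q.2 + q.1 • ρ q.2)⁻¹)
      (Icc (0 : ℝ) (1 / 2) ×ˢ Icc 0 T) := fun q hq => by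
    have hc : ContinuousWithinAt (fun q : ℝ × ℝ => R q.2 + q.1 • ρ q.2)
        (Icc (0 : ℝ) (1 / 2) ×ˢ Icc 0 T) q := ((hcomp hR).add (hfst.smul (hcomp hρ))) q hq
    exact ContinuousAt.comp_continuousWithinAt (f := fun q : ℝ × ℝ => R q.2 + q.1 • ρ q.2)
      (continuousAt_matrix_inv' ((Matrix.isUnit_iff_isUnit_det _).1
        (hpos q.1 hq.1 q.2 hq.2).isUnit)) hc
  have hP : ContinuousOn (fun t => (R t)⁻¹) (Icc 0 T) := fun t ht =>
    (continuousAt_matrix_inv' ((Matrix.isUnit_iff_isUnit_det _).1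
      (hR0 t ht).isUnit)).comp_continuousWithinAt (hR t ht)
  -- The coefficient of ε² in the integrand. It is continuous on a compact rectangle, hence bounded,
  -- so no differentiation under the integral is needed.
  let r : ℝ × ℝ → ℝ := fun q =>
    frob ((R q.2)⁻¹ * ρ q.2 * (R q.2 + q.1 • ρ q.2)⁻¹ * ρ q.2 * (R q.2)⁻¹) (D q.2 + q.1 • δ q.2) -
      frob ((R q.2)⁻¹ * ρ q.2 * (R q.2)⁻¹) (δ q.2)
  have hr : ContinuousOn r (Icc (0 : ℝ) (1 / 2) ×ˢ Icc 0 T) :=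
    (continuousOn_frob (((((hcomp hP).mul (hcomp hρ)).mul hinv).mul (hcomp hρ)).mul (hcomp hP))
      ((hcomp hD).add (hfst.smul (hcomp hδ)))).sub
      (continuousOn_frob (((hcomp hP).mul (hcomp hρ)).mul (hcomp hP)) (hcomp hδ))
  obtain ⟨B, hB⟩ := (isCompact_Icc.prod isCompact_Icc).exists_bound_of_continuousOn hr
  have hI : uIcc 0 T = Icc 0 T := uIcc_of_le hT
  have hc0 : ContinuousOn (fun t => frob (R t)⁻¹ (D t)) (uIcc 0 T) := by
    rw [hI]; exact continuousOn_frob hP hD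
  have hc1 : ContinuousOn (fun t => frob (R t)⁻¹ (δ t) -
      frob ((R t)⁻¹ * ρ t * (R t)⁻¹) (D t)) (uIcc 0 T) := by
    rw [hI]
    exact (continuousOn_frob hP hδ).sub (continuousOn_frob ((hP.mul hρ).mul hP) hD)
  have hcr : ∀ ε ∈ Icc (0 : ℝ) (1 / 2), ContinuousOn (fun t => r (ε, t)) (uIcc 0 T) :=
    fun ε hε => by
      rw [hI]
      exact hr.comp (continuousOn_const.prodMk continuousOn_id) fun t ht => ⟨hε, ht⟩
  have hexp : ∀ ε ∈ Ioc (0 : ℝ) (1 / 2),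
      ((∫ t in (0 : ℝ)..T, frob (R t + ε • ρ t)⁻¹ (D t + ε • δ t)) -
        ∫ t in (0 : ℝ)..T, frob (R t)⁻¹ (D t)) / ε =
      (∫ t in (0 : ℝ)..T, (frob (R t)⁻¹ (δ t) - frob ((R t)⁻¹ * ρ t * (R t)⁻¹) (D t))) +
        ε * ∫ t in (0 : ℝ)..T, r (ε, t) := fun ε hε => by
    have hε' : ε ∈ Icc (0 : ℝ) (1 / 2) := ⟨hε.1.le, hε.2⟩
    have e : ∫ t in (0 : ℝ)..T, frob (R t + ε • ρ t)⁻¹ (D t + ε • δ t) =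
        ∫ t in (0 : ℝ)..T, (frob (R t)⁻¹ (D t) + (ε * (frob (R t)⁻¹ (δ t) -
          frob ((R t)⁻¹ * ρ t * (R t)⁻¹) (D t)) + ε ^ 2 * r (ε, t))) := by
      refine intervalIntegral.integral_congr fun t ht => ?_
      rw [hI] at ht
      simp only [r]
      have hx := inv_add_smul_expand (hR0 t ht) (hpos ε hε' t ht)
      -- The remainder term itself contains N; it is frozen as Z before N is replaced by its
      -- expansion.
      generalize hN : (R t + ε • ρ t)⁻¹ = N at hx ⊢
      generalize (R t)⁻¹ * ρ t * N * ρ t * (R t)⁻¹ = Z at hx ⊢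
      rw [hx]
      simp only [frob_add_left, frob_sub_left, frob_add_right, frob_smul_left, frob_smul_right]
      ring
    rw [e, intervalIntegral.integral_add hc0.intervalIntegrable
      ((hc1.intervalIntegrable.const_mul ε).add ((hcr ε hε').intervalIntegrable.const_mul _)),
      intervalIntegral.integral_add (hc1.intervalIntegrable.const_mul ε)
        ((hcr ε hε').intervalIntegrable.const_mul _), intervalIntegral.integral_const_mul,
      intervalIntegral.integral_const_mul]
    have := hε.1.ne'
    field_simp
    ring
  have hsmall : Filter.Tendsto (fun ε : ℝ => ε * ∫ t in (0 : ℝ)..T, r (ε, t))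
      (nhdsWithin 0 (Ioi 0)) (nhds 0) := by
    have hlim : Filter.Tendsto (fun ε : ℝ => ε * (B * T)) (nhdsWithin 0 (Ioi 0)) (nhds 0) := by
      have : Filter.Tendsto (fun ε : ℝ => ε * (B * T)) (nhds 0) (nhds (0 * (B * T))) :=
        Filter.tendsto_id.mul_const _
      rw [zero_mul] at this
      exact this.mono_left nhdsWithin_le_nhds
    refine squeeze_zero_norm' ?_ hlim
    filter_upwards [Ioo_mem_nhdsGT (by norm_num : (0 : ℝ) < 1 / 2)] with ε hε
    rw [norm_mul, Real.norm_of_nonneg hε.1.le]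
    refine mul_le_mul_of_nonneg_left ?_ hε.1.le
    have := intervalIntegral.norm_integral_le_of_norm_le_const (a := (0 : ℝ)) (b := T)
      (f := fun t => r (ε, t)) (C := B) fun t ht => by
        rw [uIoc_of_le hT] at ht
        exact hB (ε, t) ⟨⟨hε.1.le, hε.2.le⟩, ht.1.le, ht.2⟩
    rwa [sub_zero, abs_of_nonneg hT] at this
  have hfin := (tendsto_const_nhds (x := ∫ t in (0 : ℝ)..T, (frob (R t)⁻¹ (δ t) -
    frob ((R t)⁻¹ * ρ t * (R t)⁻¹) (D t))) (f := nhdsWithin (0 : ℝ) (Ioi 0))).add hsmall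
  rw [add_zero] at hfin
  refine hfin.congr' ?_
  filter_upwards [Ioo_mem_nhdsGT (by norm_num : (0 : ℝ) < 1 / 2)] with ε hε
  exact (hexp ε ⟨hε.1, hε.2.le⟩).symm

end Entropy

/-! ### The first variation. -/

section Variation

/-- The first variation of the entropy part, as an integral against the order measure. -/
theorem entropy_variation_eq (hΦ : IsPath Q κ Φ) (hΦ₁ : IsPath Q κ' Φ₁) (hμ : IsOrderMeasure m μ)
    (hm : (0 : ℝ) < m) (hT : topPoint m μ < T) (hTm : T < m) (hdet : (Q - Φ T).PosDef) :
    (∫ t in (0 : ℝ)..T, (frob (hatPath μ Φ t)⁻¹ (pathDeriv Φ₁ t - pathDeriv Φ t) -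
        frob ((hatPath μ Φ t)⁻¹ * (hatPath μ Φ₁ t - hatPath μ Φ t) * (hatPath μ Φ t)⁻¹)
          (pathDeriv Φ t))) =
      frob (hatPath μ Φ T)⁻¹ (Φ₁ T - Φ T) + ∫ t, frob (responsePath μ Φ t) (Φ₁ t - Φ t) ∂μ := by
  have hT0 : 0 ≤ T := (topPoint_nonneg m μ).trans hT.le
  have hI : uIcc 0 T = Icc 0 T := uIcc_of_le hT0
  have hsub : Icc 0 T ⊆ Icc (0 : ℝ) m := Icc_subset_Icc_right hTm.le
  set P : ℝ → Matrix (Fin m) (Fin m) ℝ := fun t => (hatPath μ Φ t)⁻¹ with hP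
  set D := pathDeriv Φ
  set H := responsePath μ Φ
  set δ : ℝ → Matrix (Fin m) (Fin m) ℝ := fun t => Φ₁ t - Φ t
  set δ' : ℝ → Matrix (Fin m) (Fin m) ℝ := fun t => pathDeriv Φ₁ t - pathDeriv Φ t
  set ρ : ℝ → Matrix (Fin m) (Fin m) ℝ := fun t => hatPath μ Φ₁ t - hatPath μ Φ t
  have hPc : ContinuousOn P (Icc 0 T) := hΦ.continuousOn_inv_hatPath hμ hm hT hTm.le hdet
  have hEc : ContinuousOn (fun t => P t * D t * P t) (Icc 0 T) :=
    hΦ.continuousOn_responseDeriv hμ hm hT hTm.le hdet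
  have hHc : ContinuousOn H (Icc 0 T) := fun t ht =>
    (hΦ.hasMatDeriv_responsePath hμ hm hT hTm.le hdet ht).continuousWithinAt
  have hδc : ContinuousOn δ (Icc 0 T) := (hΦ₁.continuousOn.sub hΦ.continuousOn).mono hsub
  have hδ'c : ContinuousOn δ' (Icc 0 T) :=
    (hΦ₁.continuousOn_pathDeriv.sub hΦ.continuousOn_pathDeriv).mono hsub
  have hρc : ContinuousOn ρ (Icc 0 T) :=
    ((hΦ₁.continuousOn_hatPath hμ).sub (hΦ.continuousOn_hatPath hμ)).mono hsub
  have hPd : ∀ t ∈ Ico 0 T, HasMatDeriv P (orderParam μ t • (P t * D t * P t)) (Ici t) t :=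
    fun t ht => hΦ.hasMatDeriv_inv_hatPath hμ hm hT hTm.le hdet ht
  have hHd : ∀ t ∈ Ico 0 T, HasMatDeriv H (P t * D t * P t) (Ici t) t := fun t ht i j =>
    (hΦ.hasMatDeriv_responsePath hμ hm hT hTm.le hdet ⟨ht.1, ht.2.le⟩ i j).mono_of_mem_nhdsWithin
      (Filter.mem_of_superset (Icc_mem_nhdsGE ht.2) (Icc_subset_Icc_left ht.1))
  have hδd : ∀ t ∈ Ico 0 T, HasMatDeriv δ (δ' t) (Ici t) t := fun t ht =>
    (hΦ₁.hasMatDeriv_right ⟨ht.1, ht.2.trans hTm⟩).sub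
      (hΦ.hasMatDeriv_right ⟨ht.1, ht.2.trans hTm⟩)
  have hρd : ∀ t ∈ Ico 0 T, HasMatDeriv ρ (-(orderParam μ t • δ' t)) (Ici t) t := fun t ht => by
    have h1 := (hΦ₁.hasMatDeriv_hatPath hμ ⟨ht.1, ht.2.trans hTm⟩).sub
      (hΦ.hasMatDeriv_hatPath hμ ⟨ht.1, ht.2.trans hTm⟩)
    have e : -(orderParam μ t • δ' t) = -(orderParam μ t • pathDeriv Φ₁ t) -
        -(orderParam μ t • pathDeriv Φ t) := by simp only [δ']; module
    rw [e]; exact h1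
  have hparts := hμ.integral_orderParam_mul hT0 (hμ.orderParam_eq_one hT le_rfl)
    (f := fun t => frob (H t) (δ t))
    (f' := fun t => frob (P t * D t * P t) (δ t) + frob (H t) (δ' t))
    (continuousOn_frob hHc hδc) ((continuousOn_frob hEc hδc).add (continuousOn_frob hHc hδ'c))
    (fun t ht => (hHd t ht).frob (hδd t ht))
  have hc1 : ContinuousOn (fun t => frob (P t) (δ' t) - frob (P t * D t * P t) (ρ t))
      (uIcc 0 T) := by
    rw [hI]; exact (continuousOn_frob hPc hδ'c).sub (continuousOn_frob hEc hρc)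
  have hi2 : IntervalIntegrable (fun t => orderParam μ t *
      (frob (P t * D t * P t) (δ t) + frob (H t) (δ' t))) volume 0 T :=
    hμ.intervalIntegrable_mul (by
      rw [hI]; exact (continuousOn_frob hEc hδc).add (continuousOn_frob hHc hδ'c))
  -- Differentiating ⟨P,δ⟩ - ⟨H,ρ⟩, with P' = xPDP, H' = PDP and ρ' = -xδ', gives the wanted
  -- integrand plus x·⟨H,δ⟩', and the latter integrates to a μ-integral by `hparts`.
  have hftc := intervalIntegral.integral_eq_sub_of_hasDeriv_right (a := 0) (b := T)
    (f := fun t => frob (P t) (δ t) - frob (H t) (ρ t))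
    (f' := fun t => (frob (P t) (δ' t) - frob (P t * D t * P t) (ρ t)) +
      orderParam μ t * (frob (P t * D t * P t) (δ t) + frob (H t) (δ' t)))
    (by rw [hI]; exact (continuousOn_frob hPc hδc).sub (continuousOn_frob hHc hρc))
    (fun t ht => by
      rw [min_eq_left hT0, max_eq_right hT0] at ht
      have ht' : t ∈ Ico 0 T := ⟨ht.1.le, ht.2⟩
      refine ((((hPd t ht').frob (hδd t ht')).sub ((hHd t ht').frob (hρd t ht'))).congr_deriv
        ?_).mono Ioi_subset_Ici_self
      rw [frob_smul_left, frob_neg_right, frob_smul_right]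
      ring)
    (hc1.intervalIntegrable.add hi2)
  rw [intervalIntegral.integral_add hc1.intervalIntegrable hi2, hparts] at hftc
  have hδ0 : δ 0 = 0 := by simp [δ, hΦ.zero, hΦ₁.zero]
  have hH0 : H 0 = 0 := responsePath_zero μ Φ
  have hρT : ρ T = -δ T := by
    simp only [ρ, δ]
    rw [hΦ.hatPath_eq_sub hμ hT le_rfl hTm.le, hΦ₁.hatPath_eq_sub hμ hT le_rfl hTm.le]
    abel
  rw [hδ0, hH0, hρT, frob_neg_right] at hftc
  simp only [frob_zero_left, frob_zero_right] at hftc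
  have hcongr : ∫ t in (0 : ℝ)..T, (frob (P t) (δ' t) - frob (P t * ρ t * P t) (D t)) =
      ∫ t in (0 : ℝ)..T, (frob (P t) (δ' t) - frob (P t * D t * P t) (ρ t)) := by
    refine intervalIntegral.integral_congr fun t ht => ?_
    rw [hI] at ht
    have hh := (hΦ.posDef_hatPath hμ hm hT hTm.le hdet ht).inv.isHermitian
    simp only [P]
    rw [frob_conj hh, frob_comm (ρ t)]
  rw [hcongr]
  linarith

/-- The boundary term at T from log det cancels the one in `entropy_variation_eq`, since Φ̂(T) = Q -
Φ(T); only integrals against μ remain. -/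
theorem tendsto_slope_csFunctional (hΦ : IsPath Q κ Φ) (hΦ₁ : IsPath Q κ' Φ₁) (hμ : IsOrderMeasure m μ)
    (hm : (0 : ℝ) < m) (hT : topPoint m μ < T) (hTm : T < m) (hdet : (Q - Φ T).PosDef)
    (hβ : IsMixedEven β) (hQ : IsConstraint Q) :
    Filter.Tendsto (fun ε => (2 * csFunctional β h μ (mixPath Φ Φ₁ ε) T -
        2 * csFunctional β h μ Φ T) / ε) (nhdsWithin 0 (Ioi 0))
      (nhds (-∫ t, frob (gradPath β h μ Φ t) (Φ₁ t - Φ t) ∂μ)) := by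
  have hT0 : 0 ≤ T := (topPoint_nonneg m μ).trans hT.le
  have hTmem : T ∈ Icc (0 : ℝ) m := ⟨hT0, hTm.le⟩
  have hsub : Icc 0 T ⊆ Icc (0 : ℝ) m := Icc_subset_Icc_right hTm.le
  have hRT := hΦ.hatPath_eq_sub hμ hT le_rfl hTm.le
  have hslope : ∀ {f : ℝ → ℝ} {f' : ℝ}, HasDerivAt f f' 0 →
      Filter.Tendsto (fun ε => (f ε - f 0) / ε) (nhdsWithin 0 (Ioi 0)) (nhds f') := fun hf => by
    refine ((hasDerivWithinAt_iff_tendsto_slope' (by simp)).1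
      (hf.hasDerivWithinAt (s := Ioi 0))).congr fun ε => ?_
    rw [slope_def_field, sub_zero]
  have h1 := hslope (hasDerivAt_integral_potential (h := h) hΦ hΦ₁ hμ hβ hQ)
  have h2 := hslope (hasDerivAt_log_det hdet (-(Φ₁ T - Φ T)))
  have h3 := tendsto_slope_integral_frob_inv (R := hatPath μ Φ)
    (ρ := fun t => hatPath μ Φ₁ t - hatPath μ Φ t) (D := pathDeriv Φ)
    (δ := fun t => pathDeriv Φ₁ t - pathDeriv Φ t) hT0
    ((hΦ.continuousOn_hatPath hμ).mono hsub)
    (((hΦ₁.continuousOn_hatPath hμ).sub (hΦ.continuousOn_hatPath hμ)).mono hsub)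
    (hΦ.continuousOn_pathDeriv.mono hsub)
    ((hΦ₁.continuousOn_pathDeriv.sub hΦ.continuousOn_pathDeriv).mono hsub)
    (fun ε hε t ht => by
      have hε1 : ε ∈ Icc (0 : ℝ) 1 := ⟨hε.1, hε.2.trans (by norm_num)⟩
      rw [← hatPath_mixPath hm hΦ hΦ₁ hμ ε (hsub ht)]
      exact (isPath_mixPath hm hΦ hΦ₁ hε1).posDef_hatPath hμ hm hT hTm.le
        (posDef_sub_mixPath hΦ₁ hTmem hε.1 (hε.2.trans_lt (by norm_num)) hdet) ht)
  rw [entropy_variation_eq hΦ hΦ₁ hμ hm hT hTm hdet] at h3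
  have hsum := (h1.neg.add h2).add h3
  have hlim : -(∫ t, frob (xiDeriv β 1 (Φ t) + Matrix.vecMulVec h h) (Φ₁ t - Φ t) ∂μ) +
      frob (Q - Φ T)⁻¹ (-(Φ₁ T - Φ T)) + (frob (hatPath μ Φ T)⁻¹ (Φ₁ T - Φ T) +
        ∫ t, frob (responsePath μ Φ t) (Φ₁ t - Φ t) ∂μ) =
      -∫ t, frob (gradPath β h μ Φ t) (Φ₁ t - Φ t) ∂μ := by
    have hHc : ContinuousOn (responsePath μ Φ) (Icc 0 T) := fun t ht =>
      (hΦ.hasMatDeriv_responsePath hμ hm hT hTm.le hdet ht).continuousWithinAt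
    have hδc : ContinuousOn (fun t => Φ₁ t - Φ t) (Icc 0 T) :=
      (hΦ₁.continuousOn.sub hΦ.continuousOn).mono hsub
    have hone := hμ.orderParam_eq_one hT le_rfl
    have hi1 : Integrable (fun t =>
        frob (xiDeriv β 1 (Φ t) + Matrix.vecMulVec h h) (Φ₁ t - Φ t)) μ :=
      hμ.integrable_of_continuousOn hone (continuousOn_frob
      (((hΦ.continuousOn_xiDeriv hβ hQ 1).mono hsub).add
        (continuousOn_const (c := Matrix.vecMulVec h h))) hδc)
    have hi2 := hμ.integrable_of_continuousOn hone (continuousOn_frob hHc hδc)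
    simp only [gradPath, frob_sub_left]
    rw [integral_sub hi1 hi2, hRT, frob_neg_right]
    ring
  rw [hlim] at hsum
  refine hsum.congr' ?_
  filter_upwards [Ioo_mem_nhdsGT (by norm_num : (0 : ℝ) < 1)] with ε hε
  have hmix := isPath_mixPath hm hΦ hΦ₁ ⟨hε.1.le, hε.2.le⟩
  have hmix0 : ∀ t, mixPath Φ Φ₁ 0 t = Φ t := fun t => by simp [mixPath]
  have e1 : Q - mixPath Φ Φ₁ ε T = Q - Φ T + ε • -(Φ₁ T - Φ T) := by rw [mixPath]; module
  have e2 : ∫ t in (0 : ℝ)..T, frob (hatPath μ (mixPath Φ Φ₁ ε) t)⁻¹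
        (pathDeriv (mixPath Φ Φ₁ ε) t) =
      ∫ t in (0 : ℝ)..T, frob (hatPath μ Φ t + ε • (hatPath μ Φ₁ t - hatPath μ Φ t))⁻¹
        (pathDeriv Φ t + ε • (pathDeriv Φ₁ t - pathDeriv Φ t)) := by
    refine intervalIntegral.integral_congr fun t ht => ?_
    rw [uIcc_of_le hT0] at ht
    rw [hatPath_mixPath hm hΦ hΦ₁ hμ ε (hsub ht), pathDeriv_mixPath hm hΦ hΦ₁ ε (hsub ht)]
  rw [hmix.csFunctional_eq hμ hβ hQ, hΦ.csFunctional_eq hμ hβ hQ, e1, e2]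
  simp only [hmix0, zero_smul, add_zero]
  ring

end Variation

theorem IsMinimizer.variation_nonpos (hmin : IsMinimizer β h Q μ Φ) (hm : (0 : ℝ) < m)
    (hβ : IsMixedEven β) (hQ : IsConstraint Q) (hΦ₁ : IsPath Q κ Φ₁) (hT : T ∈ cutoffs μ Φ) :
    ∫ t, frob (gradPath β h μ Φ t) (Φ₁ t - Φ t) ∂μ ≤ 0 := by
  have hΦ := hmin.1.isPath
  have hdet : (Q - Φ T).PosDef := by
    refine hΦ.posDef_sub ⟨(topPoint_nonneg m μ).trans hT.1.le, hT.2.1.le⟩ ?_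
    have := hT.2.2
    rwa [hΦ.top] at this
  have h1 := tendsto_slope_csFunctional (h := h) hΦ hΦ₁ hmin.1.isOrderMeasure hm hT.1 hT.2.1
    hdet hβ hQ
  have h2 : 0 ≤ -∫ t, frob (gradPath β h μ Φ t) (Φ₁ t - Φ t) ∂μ := by
    refine ge_of_tendsto h1 ?_
    filter_upwards [hmin.eventually_le_mixPath hm hΦ₁ hT, self_mem_nhdsWithin] with ε hε hpos
    exact div_nonneg (by linarith) (le_of_lt hpos)
  linarith

end VectorSpin

namespace VectorSpin

variable {m : ℕ} {μ κ : Measure ℝ} {Q : Matrix (Fin m) (Fin m) ℝ}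
  {Φ Ψ : ℝ → Matrix (Fin m) (Fin m) ℝ} {β : ℕ → Fin m → ℝ} {h : Fin m → ℝ} {T : ℝ}

/-! ### Smoothing monotone paths with jumps. -/

section Mollify

/-- Entrywise convolution of `Ψ` with a bump function, delayed by its radius. -/
noncomputable def mollify (φ : ContDiffBump (0 : ℝ)) (Ψ : ℝ → Matrix (Fin m) (Fin m) ℝ) (t : ℝ) :
    Matrix (Fin m) (Fin m) ℝ :=
  Matrix.of fun i j => convolution (φ.normed volume) (fun s => Ψ s i j)
    (ContinuousLinearMap.lsmul ℝ ℝ) volume (t - φ.rOut)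

theorem monotone_quad (hmono : ∀ s t, s ≤ t → (Ψ t - Ψ s).PosSemidef) (v : Fin m → ℝ) :
    Monotone fun t => v ⬝ᵥ Ψ t *ᵥ v := fun s t hst => by
  have := quad_nonneg (hmono s t hst) v
  rw [Matrix.sub_mulVec, dotProduct_sub] at this
  simp only
  linarith

theorem apply_eq_polarization {A : Matrix (Fin m) (Fin m) ℝ} (hA : A.IsHermitian) (i j : Fin m) :
    A i j = 1 / 2 * ((Pi.single i 1 + Pi.single j 1) ⬝ᵥ A *ᵥ (Pi.single i 1 + Pi.single j 1)
      - Pi.single i 1 ⬝ᵥ A *ᵥ Pi.single i 1 - Pi.single j 1 ⬝ᵥ A *ᵥ Pi.single j 1) := by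
  simp only [Matrix.mulVec_add, add_dotProduct, dotProduct_add, Matrix.mulVec_single_one,
    single_one_dotProduct, Matrix.col_apply]
  rw [symm_apply hA j i]
  ring

/-- By polarization each entry is a combination of monotone functions. -/
theorem locallyIntegrable_apply (hherm : ∀ t, (Ψ t).IsHermitian)
    (hmono : ∀ s t, s ≤ t → (Ψ t - Ψ s).PosSemidef) (i j : Fin m) :
    LocallyIntegrable (fun t => Ψ t i j) volume := by
  have h := fun v => (monotone_quad hmono v).locallyIntegrable (μ := volume)
  have e : (fun t => Ψ t i j) = fun t => (1 / 2 : ℝ) • ((Pi.single i 1 + Pi.single j 1) ⬝ᵥ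
      Ψ t *ᵥ (Pi.single i 1 + Pi.single j 1) - Pi.single i 1 ⬝ᵥ Ψ t *ᵥ Pi.single i 1
      - Pi.single j 1 ⬝ᵥ Ψ t *ᵥ Pi.single j 1) := by
    ext t
    exact apply_eq_polarization (hherm t) i j
  rw [e]
  exact (((h _).sub (h _)).sub (h _)).smul (1 / 2 : ℝ)

theorem convolution_eq_of_const {φ : ContDiffBump (0 : ℝ)} {g : ℝ → ℝ} {c x : ℝ}
    (hg : ∀ y, |y - x| ≤ φ.rOut → g y = c) :
    convolution (φ.normed volume) g (ContinuousLinearMap.lsmul ℝ ℝ) volume x = c := by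
  rw [convolution_def]
  have : ∀ s, (ContinuousLinearMap.lsmul ℝ ℝ) (φ.normed volume s) (g (x - s)) =
      φ.normed volume s * c := fun s => by
    rw [ContinuousLinearMap.lsmul_apply, smul_eq_mul]
    by_cases hs : |s| ≤ φ.rOut
    · rw [hg (x - s) (by simpa using hs)]
    · have : φ.normed volume s = 0 := by
        refine image_eq_zero_of_notMem_tsupport fun hs' => hs ?_
        rw [φ.tsupport_normed_eq] at hs'
        simpa using hs'
      rw [this, zero_mul, zero_mul]
  simp_rw [this]
  rw [integral_mul_const, φ.integral_normed, one_mul]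

variable (φ : ContDiffBump (0 : ℝ))

theorem contDiff_mollify (hherm : ∀ t, (Ψ t).IsHermitian)
    (hmono : ∀ s t, s ≤ t → (Ψ t - Ψ s).PosSemidef) (i j : Fin m) :
    ContDiff ℝ 2 fun t => mollify φ Ψ t i j := by
  have h1 := φ.hasCompactSupport_normed (μ := volume).contDiff_convolution_left
    (ContinuousLinearMap.lsmul ℝ ℝ) (n := 2) φ.contDiff_normed
    (locallyIntegrable_apply hherm hmono i j)
  exact h1.comp (contDiff_id.sub contDiff_const)

theorem quad_mollify (hherm : ∀ t, (Ψ t).IsHermitian)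
    (hmono : ∀ s t, s ≤ t → (Ψ t - Ψ s).PosSemidef) (v : Fin m → ℝ) (t : ℝ) :
    Integrable (fun s => φ.normed volume s * (v ⬝ᵥ Ψ (t - φ.rOut - s) *ᵥ v)) ∧
    v ⬝ᵥ mollify φ Ψ t *ᵥ v =
      ∫ s, φ.normed volume s * (v ⬝ᵥ Ψ (t - φ.rOut - s) *ᵥ v) := by
  have hint : ∀ i j, Integrable fun s =>
      v i * v j * (φ.normed volume s * Ψ (t - φ.rOut - s) i j) := fun i j =>
    (φ.hasCompactSupport_normed (μ := volume).convolutionExists_left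
      (ContinuousLinearMap.lsmul ℝ ℝ) φ.continuous_normed
      (locallyIntegrable_apply hherm hmono i j) (t - φ.rOut)).const_mul (v i * v j)
  have e : (fun s => φ.normed volume s * (v ⬝ᵥ Ψ (t - φ.rOut - s) *ᵥ v)) = fun s =>
      ∑ i, ∑ j, v i * v j * (φ.normed volume s * Ψ (t - φ.rOut - s) i j) := by
    ext s
    rw [dotProduct_mulVec_eq_sum, Finset.mul_sum]
    refine Finset.sum_congr rfl fun i _ => ?_
    rw [Finset.mul_sum]
    exact Finset.sum_congr rfl fun j _ => by ring
  rw [e]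
  refine ⟨integrable_finsetSum _ fun i _ => integrable_finsetSum _ fun j _ => hint i j, ?_⟩
  rw [integral_finsetSum _ fun i _ => integrable_finsetSum _ fun j _ => hint i j,
    dotProduct_mulVec_eq_sum]
  refine Finset.sum_congr rfl fun i _ => ?_
  rw [integral_finsetSum _ fun j _ => hint i j]
  refine Finset.sum_congr rfl fun j _ => ?_
  rw [integral_const_mul]
  rfl

theorem isHermitian_mollify (hherm : ∀ t, (Ψ t).IsHermitian) (t : ℝ) :
    (mollify φ Ψ t).IsHermitian := by
  refine isHermitian_of_symm fun i j => ?_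
  have e : (fun s => Ψ s i j) = fun s => Ψ s j i := funext fun s => symm_apply (hherm s) i j
  simp only [mollify, Matrix.of_apply, e]

theorem posSemidef_mollify_sub (hherm : ∀ t, (Ψ t).IsHermitian)
    (hmono : ∀ s t, s ≤ t → (Ψ t - Ψ s).PosSemidef) {s t : ℝ} (hst : s ≤ t) :
    (mollify φ Ψ t - mollify φ Ψ s).PosSemidef := by
  refine posSemidef_sub_of_quad_mono (isHermitian_mollify φ hherm s)
    (isHermitian_mollify φ hherm t) fun v => ?_
  obtain ⟨hi, e⟩ := quad_mollify φ hherm hmono v s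
  obtain ⟨hi', e'⟩ := quad_mollify φ hherm hmono v t
  rw [e, e']
  refine integral_mono hi hi' fun y => mul_le_mul_of_nonneg_left ?_ (φ.nonneg_normed y)
  exact monotone_quad hmono v (by linarith)

/-- The delayed mollification at t averages over [t - 2r, t], with r the outer radius. At t = 0 it
sees only times where Ψ = 0, and at t = m only times after T, where Ψ = Q. Monotonicity survives
averaging of quadratic forms, and C² smoothness gives a Lipschitz derivative. -/
theorem isPath_mollify (hm : (0 : ℝ) < m) (hherm : ∀ t, (Ψ t).IsHermitian)
    (hmono : ∀ s t, s ≤ t → (Ψ t - Ψ s).PosSemidef) (h0 : ∀ t ≤ 0, Ψ t = 0)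
    (hQ : ∀ t, T ≤ t → Ψ t = Q) (hφ : 2 * φ.rOut ≤ m - T) : IsPath Q 0 (mollify φ Ψ) := by
  have hzero : mollify φ Ψ 0 = 0 := by
    ext i j
    rw [mollify, Matrix.of_apply]
    refine convolution_eq_of_const fun y hy => ?_
    rw [h0 y (by linarith [(abs_le.1 hy).2])]
  have htop : mollify φ Ψ m = Q := by
    ext i j
    rw [mollify, Matrix.of_apply]
    refine convolution_eq_of_const fun y hy => ?_
    rw [hQ y (by linarith [(abs_le.1 hy).1])]
  have hd : ∀ i j, Differentiable ℝ fun t => mollify φ Ψ t i j := fun i j =>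
    (contDiff_mollify φ hherm hmono i j).differentiable (by norm_num)
  refine ⟨fun t ht => ?_, fun s _ t _ hst => posSemidef_mollify_sub φ hherm hmono hst, hzero, htop,
    fun i j => (hd i j).differentiableOn, exists_uniform_lipschitz fun i j => ?_, by simp⟩
  · simpa [hzero] using posSemidef_mollify_sub φ hherm hmono ht.1
  · have hC1 : ContDiff ℝ 1 (deriv fun t => mollify φ Ψ t i j) :=
      ((contDiff_succ_iff_deriv (n := 1)).1 (by
        have := contDiff_mollify φ hherm hmono i j
        rwa [one_add_one_eq_two])).2.2
    obtain ⟨B, hB⟩ := (isCompact_Icc (a := (0 : ℝ)) (b := (m : ℝ))).exists_bound_of_continuousOn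
      (hC1.continuous_deriv le_rfl).continuousOn
    have hlip := (convex_Icc (0 : ℝ) m).lipschitzOnWith_of_nnnorm_deriv_le
      (f := deriv fun t => mollify φ Ψ t i j) (C := B.toNNReal)
      (fun t _ => hC1.differentiable (by norm_num) t) fun t ht => by
        rw [← NNReal.coe_le_coe, coe_nnnorm]
        exact (hB t ht).trans (Real.le_coe_toNNReal B)
    refine ⟨B.toNNReal, fun s hs t ht => ?_⟩
    · have e : ∀ y ∈ Icc (0 : ℝ) m, pathDeriv (mollify φ Ψ) y i j =
          deriv (fun t => mollify φ Ψ t i j) y := fun y hy =>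
        (hd i j y).hasDerivAt.hasDerivWithinAt.derivWithin (uniqueDiffOn_Icc hm y hy)
      simp only [e s hs, e t ht]
      exact hlip hs ht

/-- The first variation is nonpositive also towards monotone paths with jumps at `0` and `T`. -/
theorem IsMinimizer.variation_nonpos_of_monotone (hmin : IsMinimizer β h Q μ Φ)
    (hm : (0 : ℝ) < m) (hβ : IsMixedEven β) (hQ : IsConstraint Q) (hT : T ∈ cutoffs μ Φ)
    (hherm : ∀ t, (Ψ t).IsHermitian)
    (hmono : ∀ s t, s ≤ t → (Ψ t - Ψ s).PosSemidef) (h0 : ∀ t ≤ 0, Ψ t = 0)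
    (htop : ∀ t, T ≤ t → Ψ t = Q) (hcont : ∀ t ∈ Ioo 0 T, ContinuousAt Ψ t) :
    ∫ t, frob (gradPath β h μ Φ t) (Ψ t - Φ t) ∂μ ≤ 0 := by
  have hΦ := hmin.1.isPath
  have hμ := hmin.1.isOrderMeasure
  have hTm : T < m := hT.2.1
  have hT0 : 0 ≤ T := (topPoint_nonneg m μ).trans hT.1.le
  have hsub : Icc 0 T ⊆ Icc (0 : ℝ) m := Icc_subset_Icc_right hTm.le
  have hdet : (Q - Φ T).PosDef := by
    refine hΦ.posDef_sub ⟨hT0, hTm.le⟩ ?_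
    have := hT.2.2
    rwa [hΦ.top] at this
  -- Radii tending to 0 and small enough that the averages at time m see only [T,m].
  let r : ℕ → ℝ := fun n => (m - T) / 2 * (1 / ((n : ℝ) + 1))
  have hr : ∀ n, 0 < r n := fun n => by
    have : 0 < (m : ℝ) - T := sub_pos.2 hTm
    positivity
  have hr1 : ∀ n, 2 * r n ≤ m - T := fun n => by
    have h1 : 1 / ((n : ℝ) + 1) ≤ 1 := by
      rw [div_le_one (by positivity)]; linarith [Nat.cast_nonneg (α := ℝ) n]
    have h2 : 0 < (m : ℝ) - T := sub_pos.2 hTm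
    simp only [r]
    nlinarith
  have hr0 : Filter.Tendsto r Filter.atTop (nhds 0) := by
    have := (tendsto_one_div_add_atTop_nhds_zero_nat (𝕜 := ℝ)).const_mul (((m : ℝ) - T) / 2)
    rwa [mul_zero] at this
  let φ : ℕ → ContDiffBump (0 : ℝ) := fun n => ⟨r n / 2, r n, half_pos (hr n), half_lt_self (hr n)⟩
  have hpath : ∀ n, IsPath Q 0 (mollify (φ n) Ψ) := fun n =>
    isPath_mollify (φ n) hm hherm hmono h0 htop (hr1 n)
  have hone := hμ.orderParam_eq_one hT.1 le_rfl
  have hGc : ContinuousOn (gradPath β h μ Φ) (Icc 0 T) := fun t ht =>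
    (hΦ.hasMatDeriv_gradPath hμ hβ hQ hm hT.1 hTm.le hdet ht).continuousWithinAt
  have hlim := tendsto_integral_of_dominated_convergence (μ := μ)
    (F := fun n t => frob (gradPath β h μ Φ t) (mollify (φ n) Ψ t - Φ t))
    (f := fun t => frob (gradPath β h μ Φ t) (Ψ t - Φ t))
    (fun t => ∑ i, ∑ j, |gradPath β h μ Φ t i j| * 2)
    (fun n => (hμ.integrable_of_continuousOn hone (continuousOn_frob hGc
      (((hpath n).continuousOn.sub hΦ.continuousOn).mono hsub))).aestronglyMeasurable)
    (hμ.integrable_of_continuousOn hone (continuousOn_finsetSum _ fun i _ =>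
      continuousOn_finsetSum _ fun j _ => (continuousOn_apply hGc i j).abs.mul_const 2))
    (fun n => by
      filter_upwards [hμ.ae_mem_Icc hμ.orderParam_top] with t ht
      refine (Finset.abs_sum_le_sum_abs _ _).trans (Finset.sum_le_sum fun i _ => ?_)
      refine (Finset.abs_sum_le_sum_abs _ _).trans (Finset.sum_le_sum fun j _ => ?_)
      rw [abs_mul]
      refine mul_le_mul_of_nonneg_left ?_ (abs_nonneg _)
      have h1 := hΦ.apply_mem hQ ht i j
      have h2 := (hpath n).apply_mem hQ ht i j
      rw [Matrix.sub_apply, abs_le]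
      constructor <;> linarith [h1.1, h1.2, h2.1, h2.2])
    (by
      -- The jumps at 0 and T are invisible: μ is carried by the open interval, where Ψ is
      -- continuous.
      filter_upwards [hμ.ae_mem_Ioo hT.1] with t ht
      refine tendsto_finsetSum _ fun i _ => tendsto_finsetSum _ fun j _ => ?_
      refine Filter.Tendsto.const_mul _ (Filter.Tendsto.sub_const ?_ _)
      have hc : ContinuousAt (fun s => Ψ s i j) t :=
        continuousAt_pi.1 (continuousAt_pi.1 (hcont t ht) i) j
      refine ContDiffBump.convolution_tendsto_right (φ := φ) (g := fun _ s => Ψ s i j)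
        (k := fun n => t - r n) (x₀ := t) hr0
        (Filter.Eventually.of_forall fun _ =>
          (locallyIntegrable_apply hherm hmono i j).aestronglyMeasurable)
        (hc.tendsto.comp Filter.tendsto_snd) ?_
      simpa using hr0.const_sub t)
  exact le_of_tendsto hlim (Filter.Eventually.of_forall fun n =>
    hmin.variation_nonpos hm hβ hQ (hpath n) hT)

end Mollify

end VectorSpin

namespace VectorSpin

variable {m : ℕ} {μ κ : Measure ℝ} {Q : Matrix (Fin m) (Fin m) ℝ}
  {Φ Ψ : ℝ → Matrix (Fin m) (Fin m) ℝ} {β : ℕ → Fin m → ℝ} {h : Fin m → ℝ} {T : ℝ}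

/-! ### Bounds for quadratic forms. -/

section QuadraticForms

theorem abs_quad_le {M : Matrix (Fin m) (Fin m) ℝ} {B : ℝ} (hB : ∀ i j, |M i j| ≤ B)
    (v : Fin m → ℝ) : |v ⬝ᵥ M *ᵥ v| ≤ B * m * (v ⬝ᵥ v) := by
  rw [dotProduct_mulVec_eq_sum]
  have h1 : ∀ i j, |v i * v j * M i j| ≤ B * ((v i * v i + v j * v j) / 2) := fun i j => by
    have hB0 : 0 ≤ B := (abs_nonneg _).trans (hB i j)
    have hv : |v i * v j| ≤ (v i * v i + v j * v j) / 2 := by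
      rw [abs_le]; constructor <;> nlinarith [sq_nonneg (v i + v j), sq_nonneg (v i - v j)]
    rw [abs_mul, mul_comm]
    exact mul_le_mul (hB i j) hv (abs_nonneg _) hB0
  calc |∑ i, ∑ j, v i * v j * M i j| ≤ ∑ i, ∑ j, B * ((v i * v i + v j * v j) / 2) :=
        (Finset.abs_sum_le_sum_abs _ _).trans (Finset.sum_le_sum fun i _ =>
          (Finset.abs_sum_le_sum_abs _ _).trans (Finset.sum_le_sum fun j _ => h1 i j))
    _ = B * m * (v ⬝ᵥ v) := by
        simp only [dotProduct, ← Finset.mul_sum, ← Finset.sum_div, Finset.sum_add_distrib,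
          Finset.sum_const, Finset.card_univ, Fintype.card_fin, nsmul_eq_mul]
        simp only [mul_left_comm _ (m : ℝ) _, ← Finset.mul_sum]
        ring

theorem exists_abs_apply_le (M : Matrix (Fin m) (Fin m) ℝ) : ∃ B, ∀ i j, |M i j| ≤ B :=
  ⟨∑ i, ∑ j, |M i j|, fun i j =>
    (Finset.single_le_sum (f := fun j => |M i j|) (fun _ _ => abs_nonneg _)
      (Finset.mem_univ j)).trans (Finset.single_le_sum (f := fun i => ∑ j, |M i j|)
      (fun _ _ => Finset.sum_nonneg fun _ _ => abs_nonneg _) (Finset.mem_univ i))⟩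

theorem quad_smul_sub {M : Matrix (Fin m) (Fin m) ℝ} (hM : M.IsHermitian) (v w : Fin m → ℝ)
    (c : ℝ) : (v - c • w) ⬝ᵥ M *ᵥ (v - c • w) =
      v ⬝ᵥ M *ᵥ v - 2 * c * (v ⬝ᵥ M *ᵥ w) + c ^ 2 * (w ⬝ᵥ M *ᵥ w) := by
  have hs : w ⬝ᵥ M *ᵥ v = v ⬝ᵥ M *ᵥ w := by
    rw [Matrix.dotProduct_mulVec, dotProduct_comm, ← Matrix.mulVec_transpose, transpose_eq hM]
  simp only [Matrix.mulVec_sub, Matrix.mulVec_smul, sub_dotProduct, dotProduct_sub,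
    smul_dotProduct, dotProduct_smul, smul_eq_mul, hs]
  ring

/-- If b bounds the form of A⁻¹, nonnegativity of A at v - b⁻¹A⁻¹v gives A ≥ b⁻¹, without
eigenvalues. -/
theorem exists_pos_le_quad {A : Matrix (Fin m) (Fin m) ℝ} (hA : A.PosDef) :
    ∃ c > 0, ∀ v : Fin m → ℝ, c * (v ⬝ᵥ v) ≤ v ⬝ᵥ A *ᵥ v := by
  obtain ⟨B, hB⟩ := exists_abs_apply_le A⁻¹
  let b := |B| * m + 1
  have hb : 0 < b := by positivity
  refine ⟨b⁻¹, inv_pos.2 hb, fun v => ?_⟩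
  have hvv : 0 ≤ v ⬝ᵥ v := Finset.sum_nonneg fun i _ => mul_self_nonneg _
  have h1 := quad_nonneg hA.posSemidef (v - b⁻¹ • (A⁻¹ *ᵥ v))
  rw [quad_smul_sub hA.isHermitian, Matrix.mulVec_mulVec, posDef_mul_inv hA, Matrix.one_mulVec,
    dotProduct_comm (A⁻¹ *ᵥ v)] at h1
  have h2 := (le_abs_self _).trans (abs_quad_le hB v)
  have h3 : v ⬝ᵥ A⁻¹ *ᵥ v ≤ b * (v ⬝ᵥ v) := by
    refine h2.trans (mul_le_mul_of_nonneg_right ?_ hvv)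
    have := mul_le_mul_of_nonneg_right (le_abs_self B) (Nat.cast_nonneg (α := ℝ) m)
    simp only [b]; linarith
  have h4 : b⁻¹ ^ 2 * (v ⬝ᵥ A⁻¹ *ᵥ v) ≤ b⁻¹ * (v ⬝ᵥ v) := by
    calc b⁻¹ ^ 2 * (v ⬝ᵥ A⁻¹ *ᵥ v) ≤ b⁻¹ ^ 2 * (b * (v ⬝ᵥ v)) := by gcongr
      _ = b⁻¹ * (v ⬝ᵥ v) := by field_simp
  linarith

theorem quad_conj {R G : Matrix (Fin m) (Fin m) ℝ} (hR : R.IsHermitian) (v : Fin m → ℝ) :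
    v ⬝ᵥ (R * G * R) *ᵥ v = (R *ᵥ v) ⬝ᵥ G *ᵥ (R *ᵥ v) := by
  rw [← Matrix.mulVec_mulVec, ← Matrix.mulVec_mulVec, Matrix.dotProduct_mulVec v R,
    ← Matrix.mulVec_transpose, transpose_eq hR]

theorem quad_mul_symm {D G R : Matrix (Fin m) (Fin m) ℝ} (hD : D.IsHermitian)
    (hG : G.IsHermitian) (hR : R.IsHermitian) (v : Fin m → ℝ) :
    v ⬝ᵥ (R * G * D) *ᵥ v = v ⬝ᵥ (D * G * R) *ᵥ v := by
  have e : (R * G * D) = (D * G * R)ᵀ := by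
    rw [Matrix.transpose_mul, Matrix.transpose_mul, transpose_eq hD, transpose_eq hG,
      transpose_eq hR, mul_assoc]
  rw [e, Matrix.mulVec_transpose, dotProduct_comm, ← Matrix.dotProduct_mulVec]

/-- The derivative of `Φ + ε R G R + ε² C t` is a nonnegative form when `C` dominates
`2 R G Φ' G R`. -/
theorem quad_step_nonneg {D E G R : Matrix (Fin m) (Fin m) ℝ} (hD : D.PosSemidef)
    (hE : E.PosSemidef) (hG : G.IsHermitian) (hR : R.PosDef) {x ε C : ℝ} (hx : x ∈ Icc (0 : ℝ) 1)
    (hε : ε ∈ Icc (0 : ℝ) (1 / 2)) (v : Fin m → ℝ)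
    (hC : 2 * (v ⬝ᵥ (R * (G * D * G) * R) *ᵥ v) ≤ C * (v ⬝ᵥ v)) :
    0 ≤ v ⬝ᵥ (D + ε • ((-(x • D) * G + R * (E - R⁻¹ * D * R⁻¹)) * R + R * G * -(x • D)) +
      (ε ^ 2 * C) • (1 : Matrix (Fin m) (Fin m) ℝ)) *ᵥ v := by
  have hRh := hR.isHermitian
  set w := (G * R) *ᵥ v with hw
  have e0 : (-(x • D) * G + R * (E - R⁻¹ * D * R⁻¹)) * R + R * G * -(x • D) =
      R * E * R - D - x • (D * G * R + R * G * D) := by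
    have h1 : R * (E - R⁻¹ * D * R⁻¹) * R = R * E * R - D := by
      calc R * (E - R⁻¹ * D * R⁻¹) * R = R * E * R - (R * R⁻¹) * D * (R⁻¹ * R) := by
            simp only [mul_sub, sub_mul, mul_assoc]
        _ = R * E * R - D := by rw [posDef_mul_inv hR, posDef_inv_mul hR]; simp
    rw [add_mul, h1]
    simp only [neg_mul, mul_neg, Matrix.smul_mul, Matrix.mul_smul, smul_add]
    abel
  have e1 : v ⬝ᵥ (D * G * R) *ᵥ v = v ⬝ᵥ D *ᵥ w := by
    rw [hw, Matrix.mulVec_mulVec, mul_assoc]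
  have e2 : v ⬝ᵥ (R * (G * D * G) * R) *ᵥ v = w ⬝ᵥ D *ᵥ w := by
    rw [quad_conj hRh, quad_conj hG, hw, ← Matrix.mulVec_mulVec]
  have e3 := quad_conj (G := E) hRh v
  have h3 := quad_nonneg hE (R *ᵥ v)
  have hww := quad_nonneg hD w
  have hvv := quad_nonneg hD v
  -- Half of this square turns the cross term -2εx⟨v,Dw⟩ into at most ½⟨v,Dv⟩ + 2ε²x²⟨w,Dw⟩. The
  -- first part is covered by (1-ε)D as ε ≤ 1/2, the second by ε²C as x ≤ 1.
  have hsq := quad_nonneg hD (v - (2 * ε * x) • w)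
  rw [quad_smul_sub hD.isHermitian] at hsq
  rw [e0]
  simp only [Matrix.add_mulVec, Matrix.sub_mulVec, Matrix.smul_mulVec, dotProduct_add,
    dotProduct_sub, dotProduct_smul, smul_eq_mul, Matrix.one_mulVec]
  rw [e3, quad_mul_symm hD.isHermitian hG hRh, e1]
  rw [e2] at hC
  have hx2 : x ^ 2 ≤ 1 := by nlinarith [hx.1, hx.2]
  have h4 : 0 ≤ ε ^ 2 * (C * (v ⬝ᵥ v) - 2 * (w ⬝ᵥ D *ᵥ w)) :=
    mul_nonneg (sq_nonneg _) (by linarith)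
  have h5 : 0 ≤ ε ^ 2 * ((1 - x ^ 2) * (w ⬝ᵥ D *ᵥ w)) :=
    mul_nonneg (sq_nonneg _) (mul_nonneg (by linarith) hww)
  have h6 := mul_nonneg hε.1 h3
  have h7 := mul_nonneg (sub_nonneg.2 hε.2) hvv
  nlinarith

end QuadraticForms

/-! ### The Euler–Lagrange equation. -/

section Stationarity

theorem image_le_of_deriv_right_nonneg {f f' : ℝ → ℝ} {a b : ℝ} (hab : a ≤ b)
    (hf : ContinuousOn f (Icc a b)) (hd : ∀ t ∈ Ico a b, HasDerivWithinAt f (f' t) (Ici t) t)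
    (hn : ∀ t ∈ Ico a b, 0 ≤ f' t) : f a ≤ f b :=
  image_le_of_deriv_right_le_deriv_boundary (f := fun _ => f a) (f' := fun _ => 0)
    continuousOn_const (fun _ _ => hasDerivWithinAt_const _ _ _) le_rfl hf hd hn ⟨hab, le_rfl⟩

/-- The perturbation `Φ + ε Φ̂ G Φ̂ + ε² C t` of a path in the direction of its gradient `G`. -/
noncomputable def perturbPath (β : ℕ → Fin m → ℝ) (h : Fin m → ℝ) (μ : Measure ℝ)
    (Φ : ℝ → Matrix (Fin m) (Fin m) ℝ) (C ε t : ℝ) : Matrix (Fin m) (Fin m) ℝ :=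
  Φ t + ε • (hatPath μ Φ t * gradPath β h μ Φ t * hatPath μ Φ t) + (ε ^ 2 * C * t) • 1

theorem isHermitian_smul {A : Matrix (Fin m) (Fin m) ℝ} (hA : A.IsHermitian) (c : ℝ) :
    (c • A).IsHermitian :=
  isHermitian_of_symm fun i j => by rw [Matrix.smul_apply, Matrix.smul_apply, symm_apply hA]

theorem isHermitian_conj {A R : Matrix (Fin m) (Fin m) ℝ} (hA : A.IsHermitian)
    (hR : R.IsHermitian) : (R * A * R).IsHermitian := by
  have := Matrix.isHermitian_mul_mul_conjTranspose R hA
  rwa [hR.eq] at this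

theorem IsPath.continuousOn_gradPath (hΦ : IsPath Q κ Φ) (hμ : IsOrderMeasure m μ)
    (hβ : IsMixedEven β) (hQ : IsConstraint Q)
    (hm : (0 : ℝ) < m) (hT : topPoint m μ < T) (hTm : T ≤ m) (hdet : (Q - Φ T).PosDef) :
    ContinuousOn (gradPath β h μ Φ) (Icc 0 T) := fun _ ht =>
  (hΦ.hasMatDeriv_gradPath hμ hβ hQ hm hT hTm hdet ht).continuousWithinAt

theorem IsPath.continuousOn_conj_gradPath (hΦ : IsPath Q κ Φ) (hμ : IsOrderMeasure m μ)
    (hβ : IsMixedEven β) (hQ : IsConstraint Q)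
    (hm : (0 : ℝ) < m) (hT : topPoint m μ < T) (hTm : T ≤ m) (hdet : (Q - Φ T).PosDef) :
    ContinuousOn (fun t => hatPath μ Φ t * gradPath β h μ Φ t * hatPath μ Φ t) (Icc 0 T) := by
  have hRc := (hΦ.continuousOn_hatPath hμ).mono (Icc_subset_Icc_right hTm)
  exact (hRc.mul (hΦ.continuousOn_gradPath hμ hβ hQ hm hT hTm hdet)).mul hRc

theorem IsPath.isHermitian_perturbPath (hΦ : IsPath Q κ Φ) (hμ : IsOrderMeasure m μ)
    (hβ : IsMixedEven β) (hQ : IsConstraint Q)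
    (hm : (0 : ℝ) < m) (hT : topPoint m μ < T) (hTm : T ≤ m) (hdet : (Q - Φ T).PosDef)
    (C ε : ℝ) {t : ℝ} (ht : t ∈ Icc 0 T) : (perturbPath β h μ Φ C ε t).IsHermitian :=
  ((hΦ.posSemidef t ⟨ht.1, ht.2.trans hTm⟩).isHermitian.add (isHermitian_smul (isHermitian_conj
    (hΦ.isHermitian_gradPath hμ hβ hQ hm hT hTm hdet ht)
    (hΦ.posDef_hatPath hμ hm hT hTm hdet ht).isHermitian) ε)).add
    (isHermitian_smul Matrix.isHermitian_one _)

theorem IsPath.continuousOn_perturbPath (hΦ : IsPath Q κ Φ) (hμ : IsOrderMeasure m μ)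
    (hβ : IsMixedEven β) (hQ : IsConstraint Q)
    (hm : (0 : ℝ) < m) (hT : topPoint m μ < T) (hTm : T ≤ m) (hdet : (Q - Φ T).PosDef)
    (C ε : ℝ) : ContinuousOn (perturbPath β h μ Φ C ε) (Icc 0 T) := by
  have h1 := (hΦ.continuousOn_conj_gradPath (h := h) hμ hβ hQ hm hT hTm hdet).const_smul ε
  have h2 : ContinuousOn (fun t : ℝ => (ε ^ 2 * C * t) • (1 : Matrix (Fin m) (Fin m) ℝ))
      (Icc 0 T) := by fun_prop
  exact ((hΦ.continuousOn.mono (Icc_subset_Icc_right hTm)).add h1).add h2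

theorem IsPath.hasMatDeriv_perturbPath (hΦ : IsPath Q κ Φ) (hμ : IsOrderMeasure m μ)
    (hβ : IsMixedEven β) (hQ : IsConstraint Q)
    (hm : (0 : ℝ) < m) (hT : topPoint m μ < T) (hTm : T ≤ m) (hdet : (Q - Φ T).PosDef)
    (C ε : ℝ) {t : ℝ} (ht : t ∈ Ico 0 T) :
    HasMatDeriv (perturbPath β h μ Φ C ε)
      (pathDeriv Φ t + ε • ((-(orderParam μ t • pathDeriv Φ t) * gradPath β h μ Φ t +
        hatPath μ Φ t * (xiDeriv β 2 (Φ t) ⊙ pathDeriv Φ t -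
          (hatPath μ Φ t)⁻¹ * pathDeriv Φ t * (hatPath μ Φ t)⁻¹)) * hatPath μ Φ t +
        hatPath μ Φ t * gradPath β h μ Φ t * -(orderParam μ t • pathDeriv Φ t)) +
        (ε ^ 2 * C) • 1) (Ici t) t := by
  have htm : t ∈ Ico (0 : ℝ) m := ⟨ht.1, ht.2.trans_le hTm⟩
  have h1 := hΦ.hasMatDeriv_right htm
  have h2 := hΦ.hasMatDeriv_hatPath hμ htm
  have h3 : HasMatDeriv (gradPath β h μ Φ) (xiDeriv β 2 (Φ t) ⊙ pathDeriv Φ t -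
      (hatPath μ Φ t)⁻¹ * pathDeriv Φ t * (hatPath μ Φ t)⁻¹) (Ici t) t :=
    fun i j => (hΦ.hasMatDeriv_gradPath hμ hβ hQ hm hT hTm hdet ⟨ht.1, ht.2.le⟩
      i j).mono_of_mem_nhdsWithin
      (Filter.mem_of_superset (Icc_mem_nhdsGE ht.2) (Icc_subset_Icc_left ht.1))
  have h4 : HasMatDeriv (fun y : ℝ => (ε ^ 2 * C * y) • (1 : Matrix (Fin m) (Fin m) ℝ))
      ((ε ^ 2 * C) • 1) (Ici t) t := fun i j => by
    have := (((hasDerivWithinAt_id t (Ici t)).const_mul (ε ^ 2 * C)).mul_const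
      ((1 : Matrix (Fin m) (Fin m) ℝ) i j))
    rw [mul_one] at this
    exact this
  exact (h1.add (((h2.mul h3).mul h2).const_smul ε)).add h4

/-- C must not depend on ε or t: it comes from a bound on the entries of RGDGR over the compact
[0,T]. A nonnegative right derivative of each quadratic form then suffices. -/
theorem IsPath.exists_perturbPath_monotone (hΦ : IsPath Q κ Φ) (hμ : IsOrderMeasure m μ)
    (hβ : IsMixedEven β) (hQ : IsConstraint Q) (h : Fin m → ℝ)
    (hm : (0 : ℝ) < m) (hT : topPoint m μ < T) (hTm : T ≤ m) (hdet : (Q - Φ T).PosDef) :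
    ∃ C, ∀ ε ∈ Icc (0 : ℝ) (1 / 2), ∀ s t, 0 ≤ s → s ≤ t → t ≤ T →
      (perturbPath β h μ Φ C ε t - perturbPath β h μ Φ C ε s).PosSemidef := by
  have hsub : Icc 0 T ⊆ Icc (0 : ℝ) m := Icc_subset_Icc_right hTm
  have hRc := (hΦ.continuousOn_hatPath hμ).mono hsub
  have hDc := hΦ.continuousOn_pathDeriv.mono hsub
  have hGc := hΦ.continuousOn_gradPath (h := h) hμ hβ hQ hm hT hTm hdet
  obtain ⟨B, hB⟩ : ∃ B, ∀ t ∈ Icc 0 T, ∀ i j, |(hatPath μ Φ t *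
      (gradPath β h μ Φ t * pathDeriv Φ t * gradPath β h μ Φ t) * hatPath μ Φ t) i j| ≤ B := by
    have hb : ∀ i j, ∃ B, ∀ t ∈ Icc 0 T, |(hatPath μ Φ t *
        (gradPath β h μ Φ t * pathDeriv Φ t * gradPath β h μ Φ t) * hatPath μ Φ t) i j| ≤ B :=
      fun i j => isCompact_Icc.exists_bound_of_continuousOn
        (continuousOn_apply ((hRc.mul ((hGc.mul hDc).mul hGc)).mul hRc) i j)
    choose B hB using hb
    obtain ⟨B', hB'⟩ := exists_abs_apply_le (Matrix.of B)
    exact ⟨B', fun t ht i j => (hB i j t ht).trans ((le_abs_self _).trans (hB' i j))⟩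
  -- Entries bounded by B give a form bounded by B·m, and `quad_step_nonneg` asks for twice that.
  refine ⟨2 * (B * m), fun ε hε s t hs hst ht => ?_⟩
  refine posSemidef_sub_of_quad_mono
    (hΦ.isHermitian_perturbPath hμ hβ hQ hm hT hTm hdet _ ε ⟨hs, hst.trans ht⟩)
    (hΦ.isHermitian_perturbPath hμ hβ hQ hm hT hTm hdet _ ε ⟨hs.trans hst, ht⟩) fun v => ?_
  refine image_le_of_deriv_right_nonneg
    (f := fun y => v ⬝ᵥ perturbPath β h μ Φ (2 * (B * m)) ε y *ᵥ v) hst ?_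
    (fun y hy => (hΦ.hasMatDeriv_perturbPath hμ hβ hQ hm hT hTm hdet _ ε
      ⟨hs.trans hy.1, hy.2.trans_le ht⟩).quad v) fun y hy => ?_
  · have hc := (hΦ.continuousOn_perturbPath (h := h) hμ hβ hQ hm hT hTm hdet (2 * (B * m)) ε).mono
      (Icc_subset_Icc hs ht)
    simp only [dotProduct_mulVec_eq_sum]
    exact continuousOn_finsetSum _ fun i _ => continuousOn_finsetSum _ fun j _ =>
      continuousOn_const.mul (continuousOn_apply hc i j)
  · have hy' : y ∈ Icc 0 T := ⟨hs.trans hy.1, hy.2.le.trans ht⟩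
    have hD := hΦ.posSemidef_pathDeriv hm (hsub hy')
    have hE := (hβ.posSemidef_xiDeriv 2 (hΦ.posSemidef y (hsub hy'))
      (hΦ.apply_mem hQ (hsub hy'))).hadamard hD
    refine quad_step_nonneg hD hE (hΦ.isHermitian_gradPath hμ hβ hQ hm hT hTm hdet hy')
      (hΦ.posDef_hatPath hμ hm hT hTm hdet hy') ⟨orderParam_nonneg μ y, hμ.le_one y⟩ hε v ?_
    have := (le_abs_self _).trans (abs_quad_le (hB y hy') v)
    linarith

theorem IsPath.posSemidef_perturbPath_zero (hΦ : IsPath Q κ Φ) (hβ : IsMixedEven β)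
    (hm : (0 : ℝ) < m) (C : ℝ) {ε : ℝ} (hε : 0 ≤ ε) :
    (perturbPath β h μ Φ C ε 0).PosSemidef := by
  have e : perturbPath β h μ Φ C ε 0 =
      ε • (hatPath μ Φ 0 * Matrix.vecMulVec h h * hatPath μ Φ 0) := by
    rw [perturbPath, hΦ.gradPath_zero hβ, hΦ.zero, mul_zero, zero_smul, add_zero, zero_add]
  rw [e]
  refine (posSemidef_conj ?_ (hΦ.isHermitian_hatPath hm ⟨le_rfl, hm.le⟩)).smul hε
  have := Matrix.posSemidef_vecMulVec_self_star (R := ℝ) h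
  rwa [star_trivial] at this

/-- A dominates a positive multiple of the identity, while the perturbation is O(ε). With A = Q -
Φ(T) this keeps the perturbed path below Q at T. -/
theorem eventually_posSemidef_sub {A W : Matrix (Fin m) (Fin m) ℝ} (hA : A.PosDef)
    (hW : W.IsHermitian) (K : ℝ) :
    ∀ᶠ ε in nhdsWithin (0 : ℝ) (Ioi 0), (A - ε • W - (ε ^ 2 * K) • 1).PosSemidef := by
  obtain ⟨c, hc, hcA⟩ := exists_pos_le_quad hA
  obtain ⟨B, hB⟩ := exists_abs_apply_le W
  let L := |B * m| + |K|
  have hL0 : 0 ≤ L := by positivity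
  have hpos : 0 < min 1 (c / (L + 1)) := lt_min one_pos (by positivity)
  filter_upwards [Ioo_mem_nhdsGT hpos] with ε hε
  have hε1 : ε < 1 := hε.2.trans_le (min_le_left _ _)
  have hε2 : ε * (L + 1) < c :=
    (lt_div_iff₀ (by positivity)).1 (hε.2.trans_le (min_le_right _ _))
  rw [posSemidef_iff_real]
  refine ⟨(hA.isHermitian.sub (isHermitian_smul hW _)).sub
    (isHermitian_smul Matrix.isHermitian_one _), fun v => ?_⟩
  have hvv : 0 ≤ v ⬝ᵥ v := Finset.sum_nonneg fun i _ => mul_self_nonneg _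
  have h1 := hcA v
  have h2 := (le_abs_self _).trans (abs_quad_le hB v)
  simp only [Matrix.sub_mulVec, Matrix.smul_mulVec, dotProduct_sub, dotProduct_smul,
    smul_eq_mul, Matrix.one_mulVec]
  have h3 : ε * (v ⬝ᵥ W *ᵥ v) ≤ ε * (|B * m| * (v ⬝ᵥ v)) :=
    mul_le_mul_of_nonneg_left (h2.trans (mul_le_mul_of_nonneg_right (le_abs_self _) hvv)) hε.1.le
  have h4 : ε ^ 2 * K * (v ⬝ᵥ v) ≤ ε * (|K| * (v ⬝ᵥ v)) := by
    have h5 : ε ^ 2 * K ≤ ε * |K| :=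
      (mul_le_mul_of_nonneg_left (le_abs_self _) (sq_nonneg _)).trans
        (mul_le_mul_of_nonneg_right (by nlinarith [hε.1]) (abs_nonneg _))
    rw [← mul_assoc ε]
    exact mul_le_mul_of_nonneg_right h5 hvv
  have h6 : ε * (L + 1) * (v ⬝ᵥ v) ≤ c * (v ⬝ᵥ v) := mul_le_mul_of_nonneg_right hε2.le hvv
  have h7 : 0 ≤ ε * (v ⬝ᵥ v) := mul_nonneg hε.1.le hvv
  have h8 : ε * (L + 1) * (v ⬝ᵥ v) =
      ε * (|B * m| * (v ⬝ᵥ v)) + ε * (|K| * (v ⬝ᵥ v)) + ε * (v ⬝ᵥ v) := by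
    simp only [L]; ring
  linarith

/-- The path `F` on `(0,T)`, completed by `0` on the left and by `Q` on the right. -/
noncomputable def completePath (Q : Matrix (Fin m) (Fin m) ℝ) (T : ℝ)
    (F : ℝ → Matrix (Fin m) (Fin m) ℝ) (t : ℝ) : Matrix (Fin m) (Fin m) ℝ :=
  if t ≤ 0 then 0 else if T ≤ t then Q else F t

theorem completePath_of_nonpos {F : ℝ → Matrix (Fin m) (Fin m) ℝ} {t : ℝ} (ht : t ≤ 0) :
    completePath Q T F t = 0 := if_pos ht

theorem completePath_of_ge {F : ℝ → Matrix (Fin m) (Fin m) ℝ} {t : ℝ} (hT : 0 < T) (ht : T ≤ t) :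
    completePath Q T F t = Q := by
  rw [completePath, if_neg (not_le.2 (hT.trans_le ht)), if_pos ht]

theorem completePath_of_mem {F : ℝ → Matrix (Fin m) (Fin m) ℝ} {t : ℝ} (ht : t ∈ Ioo 0 T) :
    completePath Q T F t = F t := by
  rw [completePath, if_neg (not_le.2 ht.1), if_neg (not_le.2 ht.2)]

theorem posSemidef_completePath_sub {F : ℝ → Matrix (Fin m) (Fin m) ℝ} (hT : 0 < T)
    (hQ : Q.PosSemidef) (h0 : (F 0).PosSemidef)
    (hF : ∀ s t, 0 ≤ s → s ≤ t → t ≤ T → (F t - F s).PosSemidef)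
    (hFQ : (Q - F T).PosSemidef) {s t : ℝ} (hst : s ≤ t) :
    (completePath Q T F t - completePath Q T F s).PosSemidef := by
  have hFpos : ∀ t ∈ Ioo 0 T, (F t).PosSemidef := fun t ht => by
    have := (hF 0 t le_rfl ht.1.le ht.2.le).add h0
    rwa [sub_add_cancel] at this
  have hFle : ∀ t ∈ Ioo 0 T, (Q - F t).PosSemidef := fun t ht => by
    have := hFQ.add (hF t T ht.1.le ht.2.le le_rfl)
    rwa [sub_add_sub_cancel] at this
  rcases le_or_gt s 0 with hs | hs
  · rw [completePath_of_nonpos hs, sub_zero]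
    rcases le_or_gt t 0 with ht | ht
    · rw [completePath_of_nonpos ht]; exact Matrix.PosSemidef.zero
    rcases le_or_gt T t with ht' | ht'
    · rwa [completePath_of_ge hT ht']
    · rw [completePath_of_mem ⟨ht, ht'⟩]; exact hFpos t ⟨ht, ht'⟩
  rcases le_or_gt T t with ht' | ht'
  · rw [completePath_of_ge hT ht']
    rcases le_or_gt T s with hs' | hs'
    · rw [completePath_of_ge hT hs', sub_self]; exact Matrix.PosSemidef.zero
    · rw [completePath_of_mem ⟨hs, hs'⟩]; exact hFle s ⟨hs, hs'⟩
  · rw [completePath_of_mem ⟨hs, hst.trans_lt ht'⟩, completePath_of_mem ⟨hs.trans_le hst, ht'⟩]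
    exact hF s t hs.le hst ht'.le

/-- At a minimizer the gradient, weighted by `Φ̂`, has nonpositive, hence zero, mean square. -/
theorem IsMinimizer.integral_frob_gradPath_nonpos (hmin : IsMinimizer β h Q μ Φ)
    (hm : (0 : ℝ) < m) (hβ : IsMixedEven β) (hQ : IsConstraint Q) (hT : T ∈ cutoffs μ Φ) :
    ∫ t, frob (gradPath β h μ Φ t) (hatPath μ Φ t * gradPath β h μ Φ t * hatPath μ Φ t) ∂μ ≤ 0 := by
  have hΦ := hmin.1.isPath
  have hμ := hmin.1.isOrderMeasure
  have hTm : T < m := hT.2.1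
  have hTpos : 0 < T := (topPoint_nonneg m μ).trans_lt hT.1
  have hTmem : T ∈ Icc 0 T := ⟨hTpos.le, le_rfl⟩
  have hdet : (Q - Φ T).PosDef := by
    refine hΦ.posDef_sub ⟨hTpos.le, hTm.le⟩ ?_
    have := hT.2.2
    rwa [hΦ.top] at this
  obtain ⟨C, hC⟩ := hΦ.exists_perturbPath_monotone hμ hβ hQ h hm hT.1 hTm.le hdet
  set W : ℝ → Matrix (Fin m) (Fin m) ℝ := fun t =>
    hatPath μ Φ t * gradPath β h μ Φ t * hatPath μ Φ t with hW
  have hGc := hΦ.continuousOn_gradPath (h := h) hμ hβ hQ hm hT.1 hTm.le hdet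
  have hWc : ContinuousOn W (Icc 0 T) :=
    hΦ.continuousOn_conj_gradPath hμ hβ hQ hm hT.1 hTm.le hdet
  have hone := hμ.orderParam_eq_one hT.1 le_rfl
  have hi1 := hμ.integrable_of_continuousOn hone (continuousOn_frob hGc hWc)
  have hi2 := hμ.integrable_of_continuousOn hone
    (f := fun t => C * t * (frob (gradPath β h μ Φ t) 1))
    ((continuousOn_const.mul continuousOn_id).mul (continuousOn_frob hGc continuousOn_const))
  have hlim : Filter.Tendsto (fun ε : ℝ => (∫ t, frob (gradPath β h μ Φ t) (W t) ∂μ) +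
      ε * ∫ t, C * t * frob (gradPath β h μ Φ t) 1 ∂μ) (nhdsWithin 0 (Ioi 0))
      (nhds ((∫ t, frob (gradPath β h μ Φ t) (W t) ∂μ) +
        0 * ∫ t, C * t * frob (gradPath β h μ Φ t) 1 ∂μ)) :=
    (tendsto_const_nhds.add (Filter.tendsto_id.mul_const _)).mono_left nhdsWithin_le_nhds
  rw [zero_mul, add_zero] at hlim
  have hWT : (W T).IsHermitian := isHermitian_conj
    (hΦ.isHermitian_gradPath hμ hβ hQ hm hT.1 hTm.le hdet hTmem)
    (hΦ.posDef_hatPath hμ hm hT.1 hTm.le hdet hTmem).isHermitian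
  refine le_of_tendsto hlim ?_
  filter_upwards [Ioo_mem_nhdsGT (by norm_num : (0 : ℝ) < 1 / 2),
    eventually_posSemidef_sub hdet hWT (C * T)] with ε hε hεT
  have hFc := hΦ.continuousOn_perturbPath (h := h) hμ hβ hQ hm hT.1 hTm.le hdet C ε
  have hFQ : (Q - perturbPath β h μ Φ C ε T).PosSemidef := by
    have e : Q - perturbPath β h μ Φ C ε T = Q - Φ T - ε • W T - (ε ^ 2 * (C * T)) • 1 := by
      rw [perturbPath, ← mul_assoc]; abel
    rwa [e]
  have hvar := hmin.variation_nonpos_of_monotone hm hβ hQ hT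
    (Ψ := completePath Q T (perturbPath β h μ Φ C ε))
    (fun t => by
      rcases le_or_gt t 0 with ht | ht
      · rw [completePath_of_nonpos ht]; exact Matrix.isHermitian_zero
      rcases le_or_gt T t with ht' | ht'
      · rw [completePath_of_ge hTpos ht']; exact hQ.posSemidef.isHermitian
      · rw [completePath_of_mem ⟨ht, ht'⟩]
        exact hΦ.isHermitian_perturbPath hμ hβ hQ hm hT.1 hTm.le hdet C ε ⟨ht.le, ht'.le⟩)
    (fun s t hst => posSemidef_completePath_sub hTpos hQ.posSemidef
      (hΦ.posSemidef_perturbPath_zero hβ hm C hε.1.le) (hC ε ⟨hε.1.le, hε.2.le⟩) hFQ hst)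
    (fun t ht => completePath_of_nonpos ht) (fun t ht => completePath_of_ge hTpos ht)
    (fun t ht => by
      have hev : completePath Q T (perturbPath β h μ Φ C ε) =ᶠ[nhds t]
          perturbPath β h μ Φ C ε := by
        filter_upwards [isOpen_Ioo.mem_nhds ht] with y hy using completePath_of_mem hy
      exact (hFc.continuousAt (Icc_mem_nhds ht.1 ht.2)).congr hev.symm)
  -- On (0,T) the direction is εW + ε²Ct·1, so one factor ε can be divided out; the remaining ε-term
  -- vanishes in the limit.
  have e : ∫ t, frob (gradPath β h μ Φ t)
        (completePath Q T (perturbPath β h μ Φ C ε) t - Φ t) ∂μ =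
      ε * ((∫ t, frob (gradPath β h μ Φ t) (W t) ∂μ) +
        ε * ∫ t, C * t * frob (gradPath β h μ Φ t) 1 ∂μ) := by
    rw [← integral_const_mul ε (fun t => C * t * frob (gradPath β h μ Φ t) 1),
      ← integral_add hi1 (hi2.const_mul ε), ← integral_const_mul]
    refine integral_congr_ae ?_
    filter_upwards [hμ.ae_mem_Ioo hT.1] with t ht
    have e' : completePath Q T (perturbPath β h μ Φ C ε) t - Φ t =
        ε • W t + (ε ^ 2 * C * t) • 1 := by
      rw [completePath_of_mem ht, perturbPath]; abel
    rw [e', frob_add_right, frob_smul_right, frob_smul_right]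
    ring
  rw [e] at hvar
  exact nonpos_of_mul_nonpos_right hvar hε.1

/-- The Euler–Lagrange equation: the gradient vanishes on the support of the order measure. -/
theorem IsMinimizer.gradPath_eq_zero (hmin : IsMinimizer β h Q μ Φ)
    (hm : (0 : ℝ) < m) (hβ : IsMixedEven β) (hQ : IsConstraint Q) (hT : T ∈ cutoffs μ Φ)
    {u : ℝ} (hu : u ∈ μ.support) : gradPath β h μ Φ u = 0 := by
  have hΦ := hmin.1.isPath
  have hμ := hmin.1.isOrderMeasure
  have hTm : T < m := hT.2.1
  have hT0 : 0 ≤ T := (topPoint_nonneg m μ).trans hT.1.le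
  have hsub : Icc 0 T ⊆ Icc (0 : ℝ) m := Icc_subset_Icc_right hTm.le
  have hdet : (Q - Φ T).PosDef := by
    refine hΦ.posDef_sub ⟨hT0, hTm.le⟩ ?_
    have := hT.2.2
    rwa [hΦ.top] at this
  have hRpos : ∀ t ∈ Icc 0 T, (hatPath μ Φ t).PosDef := fun t ht =>
    hΦ.posDef_hatPath hμ hm hT.1 hTm.le hdet ht
  have hGh : ∀ t ∈ Icc 0 T, (gradPath β h μ Φ t).IsHermitian := fun t ht =>
    hΦ.isHermitian_gradPath hμ hβ hQ hm hT.1 hTm.le hdet ht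
  have hRc : ContinuousOn (hatPath μ Φ) (Icc 0 T) := (hΦ.continuousOn_hatPath hμ).mono hsub
  have hGc : ContinuousOn (gradPath β h μ Φ) (Icc 0 T) := fun t ht =>
    (hΦ.hasMatDeriv_gradPath hμ hβ hQ hm hT.1 hTm.le hdet ht).continuousWithinAt
  set f : ℝ → ℝ := fun t =>
    frob (gradPath β h μ Φ t) (hatPath μ Φ t * gradPath β h μ Φ t * hatPath μ Φ t) with hf
  have hfc : ContinuousOn f (Icc 0 T) := continuousOn_frob hGc ((hRc.mul hGc).mul hRc)
  have hone := hμ.orderParam_eq_one hT.1 le_rfl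
  have hmem := hμ.ae_mem_Icc hone
  have hnn : 0 ≤ᵐ[μ] f := by
    filter_upwards [hmem] with t ht
    exact frob_conj_self_nonneg (hRpos t ht).posSemidef (hGh t ht)
  have hzero : f =ᵐ[μ] 0 := (integral_eq_zero_iff_of_nonneg_ae hnn
    (hμ.integrable_of_continuousOn hone hfc)).1
    (le_antisymm (hmin.integral_frob_gradPath_nonpos hm hβ hQ hT) (integral_nonneg_of_ae hnn))
  -- The zero set of the continuous f in [0,T] is closed and has full measure, hence contains the
  -- support.
  have hclosed : IsClosed (Icc 0 T ∩ f ⁻¹' {0}) :=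
    hfc.preimage_isClosed_of_isClosed isClosed_Icc isClosed_singleton
  have hu' := Measure.support_subset_of_isClosed hclosed
    (by filter_upwards [hmem, hzero] with t ht hz using ⟨ht, hz⟩) hu
  exact eq_zero_of_frob_conj_self (hRpos u hu'.1) (hGh u hu'.1) hu'.2

end Stationarity

end VectorSpin

/-! ### Differentiating the Euler–Lagrange equation on (a,b). -/

namespace VectorSpin

variable {m : ℕ} {μ : Measure ℝ} {Q : Matrix (Fin m) (Fin m) ℝ}
  {Φ : ℝ → Matrix (Fin m) (Fin m) ℝ} {β : ℕ → Fin m → ℝ} {h : Fin m → ℝ} {T : ℝ}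

theorem hasMatDeriv_const (M : Matrix (Fin m) (Fin m) ℝ) (s : Set ℝ) (t : ℝ) :
    HasMatDeriv (fun _ => M) 0 s t := fun _ _ => hasDerivWithinAt_const _ _ _

theorem HasMatDeriv.hadamard_const {F : ℝ → Matrix (Fin m) (Fin m) ℝ}
    {F' : Matrix (Fin m) (Fin m) ℝ} {s : Set ℝ} {t : ℝ} (hF : HasMatDeriv F F' s t)
    (M : Matrix (Fin m) (Fin m) ℝ) : HasMatDeriv (fun y => F y ⊙ M) (F' ⊙ M) s t :=
  fun i j => (hF i j).mul_const (M i j)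

/-- A product rule that never differentiates D: divide by t - u, use right continuity of D and the
right derivative of W. -/
theorem frob_deriv_eq_zero {D W : ℝ → Matrix (Fin m) (Fin m) ℝ} {W' : Matrix (Fin m) (Fin m) ℝ}
    {u b : ℝ} (hub : u < b) (hD : ContinuousWithinAt D (Ici u) u)
    (hW : HasMatDeriv W W' (Ici u) u) (h0 : ∀ t ∈ Ioo u b, frob (D t) (W t - W u) = 0) :
    frob (D u) W' = 0 := by
  have hD' : Filter.Tendsto D (nhdsWithin u (Ioi u)) (nhds (D u)) :=
    hD.mono_left (nhdsWithin_mono u Ioi_subset_Ici_self)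
  have hlim : Filter.Tendsto (fun t => ∑ i, ∑ j, D t i j * slope (fun y => W y i j) u t)
      (nhdsWithin u (Ioi u)) (nhds (∑ i, ∑ j, D u i j * W' i j)) :=
    tendsto_finsetSum _ fun i _ => tendsto_finsetSum _ fun j _ =>
      (tendsto_pi_nhds.1 (tendsto_pi_nhds.1 hD' i) j).mul
        ((hasDerivWithinAt_iff_tendsto_slope' self_notMem_Ioi).1
          ((hW i j).mono Ioi_subset_Ici_self))
  refine tendsto_nhds_unique hlim (tendsto_const_nhds.congr' ?_)
  filter_upwards [Ioo_mem_nhdsGT hub] with t ht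
  have h1 : ∑ i, ∑ j, D t i j * slope (fun y => W y i j) u t =
      (t - u)⁻¹ * frob (D t) (W t - W u) := by
    simp only [frob, slope_def_field, Finset.mul_sum, Matrix.sub_apply]
    exact Finset.sum_congr rfl fun i _ => Finset.sum_congr rfl fun j _ => by ring
  rw [h1, h0 t ht, mul_zero]

/-- The determinant is continuous and positive at t_x, so it stays positive just to the right. -/
theorem IsAdmissible.exists_mem_cutoffs (hadm : IsAdmissible Q μ Φ) :
    ∃ T, T ∈ cutoffs μ Φ := by
  have h0 := topPoint_nonneg m μ
  have hc : ContinuousWithinAt (fun t => (Q - Φ t).det) (Icc (0 : ℝ) m) (topPoint m μ) :=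
    (Continuous.matrix_det continuous_id).continuousAt.comp_continuousWithinAt
      (continuousWithinAt_const.sub
        (hadm.isPath.continuousOn _ ⟨h0, hadm.topPoint_lt.le⟩))
  have hc' := hc.mono_of_mem_nhdsWithin (s := Ioi (topPoint m μ)) (Filter.mem_of_superset
    (Ioo_mem_nhdsGT hadm.topPoint_lt) fun t ht => ⟨h0.trans ht.1.le, ht.2.le⟩)
  obtain ⟨T, hT1, hT2⟩ := ((hc'.eventually (lt_mem_nhds hadm.det_pos)).and
    (Ioo_mem_nhdsGT hadm.topPoint_lt)).exists
  exact ⟨T, hT2.1, hT2.2, by rw [hadm.isPath.top]; exact hT1⟩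

theorem IsMinimizer.xiDeriv_hadamard_eq (hmin : IsMinimizer β h Q μ Φ) (hβ : IsMixedEven β)
    (hQ : IsConstraint Q) (hm : (0 : ℝ) < m) (hT : T ∈ cutoffs μ Φ) {a b : ℝ}
    (hsupp : Ioo a b ⊆ μ.support) {t : ℝ} (ht : t ∈ Ioo a b) :
    xiDeriv β 2 (Φ t) ⊙ pathDeriv Φ t =
      (hatPath μ Φ t)⁻¹ * pathDeriv Φ t * (hatPath μ Φ t)⁻¹ := by
  obtain ⟨⟨hμ, hΦ, -, -⟩, -⟩ := id hmin
  have hle : ∀ s ∈ Ioo a b, s ∈ Icc 0 T := fun s hs =>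
    ⟨(hμ.support_subset (hsupp hs)).1, (hμ.support_subset (hsupp hs)).2.trans hT.1.le⟩
  have hdet : (Q - Φ T).PosDef := hΦ.posDef_sub
    ⟨(hle t ht).1.trans (hle t ht).2, hT.2.1.le⟩ (by rw [← hΦ.top]; exact hT.2.2)
  have hd := (hΦ.hasMatDeriv_gradPath (h := h) hμ hβ hQ hm hT.1 hT.2.1.le hdet (hle t ht)).mono hle
  refine sub_eq_zero.1 (Matrix.ext fun i j => ?_)
  refine (isOpen_Ioo.uniqueDiffWithinAt ht).eq_deriv _ (hd i j)
    ((hasDerivWithinAt_const t (Ioo a b) (0 : ℝ)).congr (fun s hs => ?_) ?_)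
  · rw [hmin.gradPath_eq_zero hm hβ hQ hT (hsupp hs)]; rfl
  · rw [hmin.gradPath_eq_zero hm hβ hQ hT (hsupp ht)]; rfl

theorem IsPath.trace_pathDeriv_eq_one (hΦ : IsPath Q μ Φ) {a b : ℝ}
    (hab : Ioo a b ⊆ Icc (0 : ℝ) m) (hsupp : Ioo a b ⊆ μ.support) {u : ℝ} (hu : u ∈ Ioo a b) :
    (pathDeriv Φ u).trace = 1 :=
  (isOpen_Ioo.uniqueDiffWithinAt hu).eq_deriv _ ((hΦ.hasMatDeriv (hab hu)).mono hab).trace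
    ((hasDerivWithinAt_id u (Ioo a b)).congr (fun s hs => hΦ.trace_eq s (hsupp hs))
      (hΦ.trace_eq u (hsupp hu)))

theorem IsMinimizer.frob_xiDeriv_three (hmin : IsMinimizer β h Q μ Φ) (hβ : IsMixedEven β)
    (hQ : IsConstraint Q) (hm : (0 : ℝ) < m) (hT : T ∈ cutoffs μ Φ) {a b : ℝ}
    (hsupp : Ioo a b ⊆ μ.support) {u : ℝ} (hu : u ∈ Ioo a b) :
    frob (xiDeriv β 3 (Φ u)) ((pathDeriv Φ u).map fun y => y ^ 3) =
      2 * orderParam μ u * ((hatPath μ Φ u)⁻¹ * pathDeriv Φ u * (hatPath μ Φ u)⁻¹ *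
        pathDeriv Φ u * (hatPath μ Φ u)⁻¹ * pathDeriv Φ u).trace := by
  obtain ⟨⟨hμ, hΦ, -, -⟩, -⟩ := id hmin
  have hlt : ∀ s ∈ Ioo a b, s ∈ Ico 0 T := fun s hs =>
    ⟨(hμ.support_subset (hsupp hs)).1, (hμ.support_subset (hsupp hs)).2.trans_lt hT.1⟩
  have hdet : (Q - Φ T).PosDef := hΦ.posDef_sub
    ⟨(hlt u hu).1.trans (hlt u hu).2.le, hT.2.1.le⟩ (by rw [← hΦ.top]; exact hT.2.2)
  have hum : u ∈ Ico (0 : ℝ) m := ⟨(hlt u hu).1, (hlt u hu).2.trans hT.2.1⟩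
  have hnhds : Icc (0 : ℝ) m ∈ nhdsWithin u (Ici u) :=
    Filter.mem_of_superset (Icc_mem_nhdsGE hum.2) (Icc_subset_Icc_left hum.1)
  set D := pathDeriv Φ u with hD
  set P := (hatPath μ Φ u)⁻¹ with hP
  have hDh : Dᵀ = D := transpose_eq (hΦ.posSemidef_pathDeriv hm ⟨hum.1, hum.2.le⟩).isHermitian
  have hPh : ∀ t ∈ Ioo a b, ((hatPath μ Φ t)⁻¹).IsHermitian := fun t ht =>
    (hΦ.posDef_hatPath hμ hm hT.1 hT.2.1.le hdet ⟨(hlt t ht).1, (hlt t ht).2.le⟩).inv.isHermitian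
  have hPd := hΦ.hasMatDeriv_inv_hatPath hμ hm hT.1 hT.2.1.le hdet (hlt u hu)
  have hξd : HasMatDeriv (fun t => xiDeriv β 2 (Φ t)) (xiDeriv β 3 (Φ u) ⊙ D) (Ici u) u :=
    fun i j => (hΦ.hasMatDeriv_xiDeriv hβ hQ 2 ⟨hum.1, hum.2.le⟩ i j).mono_of_mem_nhdsWithin hnhds
  have hW := ((hPd.mul (hasMatDeriv_const D _ _)).mul hPd).sub (hξd.hadamard_const D)
  have key := frob_deriv_eq_zero hu.2
    ((hΦ.continuousOn_pathDeriv u ⟨hum.1, hum.2.le⟩).mono_of_mem_nhdsWithin hnhds) hW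
    -- Conjugation by P(t) and the entrywise product with ξ''(Φ(t)) are self-adjoint, so ⟨D(t),
    -- P(t)D(u)P(t)⟩ = ⟨ξ''(Φ(t))⊙D(t), D(u)⟩ = ⟨D(t), ξ''(Φ(t))⊙D(u)⟩ by the first-order equation
    -- at t; the equation at u gives W(u) = 0.
    fun t ht => by
      have ht' : t ∈ Ioo a b := ⟨hu.1.trans ht.1, ht.2⟩
      have e1 := hmin.xiDeriv_hadamard_eq hβ hQ hm hT hsupp ht'
      have e2 := hmin.xiDeriv_hadamard_eq hβ hQ hm hT hsupp hu
      simp only [frob_sub_right]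
      rw [← frob_conj (hPh t ht'), ← frob_conj (hPh u hu), ← e1,
        frob_comm _ (xiDeriv β 2 (Φ t) ⊙ D), frob_hadamard_right, sub_self,
        frob_conj (hPh u hu), ← e2, frob_comm, sub_self, sub_self]
  have hcube : frob D ((xiDeriv β 3 (Φ u) ⊙ D) ⊙ D) =
      frob (xiDeriv β 3 (Φ u)) (D.map fun y => y ^ 3) := by
    simp only [frob, Matrix.hadamard_apply, Matrix.map_apply]
    exact Finset.sum_congr rfl fun i _ => Finset.sum_congr rfl fun j _ => by ring
  have htr : frob D (P * D * P * D * P) = (P * D * P * D * P * D).trace := by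
    rw [frob_eq_trace, hDh, Matrix.trace_mul_comm]
  rw [frob_sub_right, hcube] at key
  simp only [mul_zero, add_zero, smul_mul_assoc, mul_smul_comm, frob_add_right, frob_smul_right,
    ← hD, ← hP, ← mul_assoc, htr] at key
  linarith

end VectorSpin

theorem mainTheorem8 (m : ℕ) (β : ℕ → Fin m → ℝ) (hβ : VectorSpin.IsMixedEven β)
    (h : Fin m → ℝ) (Q : Matrix (Fin m) (Fin m) ℝ) (hQ : VectorSpin.IsConstraint Q)
    (μ : Measure ℝ) (Φ : ℝ → Matrix (Fin m) (Fin m) ℝ)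
    (hmin : VectorSpin.IsMinimizer β h Q μ Φ)
    (a b : ℝ) (ha : 0 ≤ a) (hab : a < b) (hb : b < m) (hsupp : Ioo a b ⊆ μ.support)
    (u : ℝ) (hu : u ∈ Ioo a b) :
    0 < (VectorSpin.threeHalves β (Φ u) (VectorSpin.pathDeriv Φ u)).trace ∧
    μ.real (Icc 0 u) =
      VectorSpin.frob (VectorSpin.xiDeriv β 3 (Φ u))
          ((VectorSpin.pathDeriv Φ u).map fun y => y ^ 3) /
        (2 * (VectorSpin.threeHalves β (Φ u) (VectorSpin.pathDeriv Φ u)).trace) := by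
  have hm : (0 : ℝ) < m := (ha.trans_lt hab).trans hb
  obtain ⟨T, hT⟩ := hmin.1.exists_mem_cutoffs
  obtain ⟨⟨hμ, hΦ, -, -⟩, -⟩ := id hmin
  have hsub : Ioo a b ⊆ Icc (0 : ℝ) m := fun s hs => ⟨ha.trans hs.1.le, (hs.2.trans hb).le⟩
  have huT := hμ.support_subset (hsupp hu)
  have hdet : (Q - Φ T).PosDef := hΦ.posDef_sub
    ⟨(huT.1.trans huT.2).trans hT.1.le, hT.2.1.le⟩ (by rw [← hΦ.top]; exact hT.2.2)
  have hP := (hΦ.posDef_hatPath hμ hm hT.1 hT.2.1.le hdet ⟨huT.1, huT.2.trans hT.1.le⟩).inv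
  -- Differentiating Trace Φ(t) = t on (a,b) rules out a vanishing derivative.
  have hD0 : VectorSpin.pathDeriv Φ u ≠ 0 := fun h0 => by
    have := hΦ.trace_pathDeriv_eq_one hsub hsupp hu
    simp [h0] at this
  obtain ⟨hpos, htr⟩ := VectorSpin.trace_psdPow_conj (hΦ.posSemidef_pathDeriv hm (hsub hu)) hP hD0
    (hmin.xiDeriv_hadamard_eq hβ hQ hm hT hsupp hu)
  refine ⟨hpos, ?_⟩
  simp only [VectorSpin.threeHalves]
  rw [eq_div_iff (mul_pos two_pos hpos).ne', hmin.frob_xiDeriv_three hβ hQ hm hT hsupp hu, ← htr]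
  simp only [VectorSpin.orderParam]
  ring
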